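/- Let $\omega\subset\mathbb R^2$ be a bounded domain with piecewise $C^2$ boundary without cusps, let $\gamma_D\subset\partial\omega$ be a union of finitely many arcs, and put $Q=\omega\times\mathbb R$, $\Gamma=\gamma_D\times\mathbb R$. For an open set $\Omega$ and $\Gamma'\subset\partial\Omega$ let $H^1_0(\Omega,\Gamma')$ be the space of functions in $H^1(\Omega)$ vanishing on $\Gamma'$, that is, the closure in $H^1(\Omega)$ of the smooth compactly supported functions on the whole space (restricted to $\Omega$) that vanish near $\Gamma'$. Write $\partial_\varphi=x_1\partial_2-x_2\partial_1$. Consider a tube with cross-section $\omega$ that is twisted but not bent, with twisting angle $\beta_0\in C^1(\mathbb R)$; its Laplacian with Dirichlet condition on the part of the boundary swept out by $\gamma_D$ and Neumann condition on the rest is represented, in the coordinates of the straight tube, by the operator $T_{\beta_0}$ in $L^2(Q)$ associated with the quadratic form $$a_{\beta_0}[u]=\int_Q\Big(|\partial_1u|^2+|\partial_2u|^2+|(\partial_3+\dot\beta_0(x_3)\,\partial_\varphi)u|^2\Big)\,dx,\qquad u\in H^1_0(Q,\Gamma).$$ Suppose that $\dot\beta_0=\alpha$ is constant, $\alpha\in\mathbb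 R$. Then $T_{\beta_0}$ is a non-negative self-adjoint operator, the cross-sectional problem $$-\Delta\psi-\alpha^2\partial_\varphi^2\psi=\lambda\psi\ \text{ in }\omega,\qquad \psi=0\ \text{ on }\gamma_D,\qquad \partial_n\psi+\alpha^2(n_2x_1-n_1x_2)\,\partial_\varphi\psi=0\ \text{ on }\partial\omega\setminus\gamma_D$$ (understood weakly: $0\ne\psi\in H^1_0(\omega,\gamma_D)$ and $(\nabla\psi,\nabla\phi)_\omega+\alpha^2(\partial_\varphi\psi,\partial_\varphi\phi)_\omega=\lambda(\psi,\phi)_\omega$ for all $\phi\in H^1_0(\omega,\gamma_D)$) has a smallest eigenvalue $\lambda_1^\alpha$, and $$\sigma(T_{\beta_0})=[\lambda_1^\alpha,+\infty).$$ -/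

import Mathlib

open MeasureTheory Set Filter Topology TopologicalSpace
open scoped ENNReal NNReal ContDiff

noncomputable section

namespace TwistedTube

/-- Euclidean space `ℝᵈ`. -/
abbrev Euc (d : ℕ) : Type := EuclideanSpace ℝ (Fin d)

/-- The complex Hilbert space `L²(Ω)` of an open set `Ω ⊆ ℝᵈ`. -/
abbrev L2 {d : ℕ} (Ω : Opens (Euc d)) : Type :=
  Lp ℂ 2 (volume.restrict (Ω : Set (Euc d)))

/-! ### Sobolev spaces -/

/-- The classical partial derivative `∂ᵢ φ`. -/
def pderiv {d : ℕ} {F : Type*} [NormedAddCommGroup F] [NormedSpace ℝ F]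
    (i : Fin d) (φ : Euc d → F) (x : Euc d) : F :=
  fderiv ℝ φ x (EuclideanSpace.single i 1)

/-- `g` is the `i`-th weak partial derivative of `u` on `Ω`: for every `φ ∈ C_c^∞(Ω)`,
`∫_Ω u ∂ᵢφ = -∫_Ω g φ`. -/
def IsWeakPartial {d : ℕ} {Ω : Opens (Euc d)} (i : Fin d) (u g : L2 Ω) : Prop :=
  ∀ φ : Euc d → ℝ, ContDiff ℝ ∞ φ → HasCompactSupport φ → tsupport φ ⊆ Ω →
    ∫ x in (Ω : Set (Euc d)), pderiv i φ x • u x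
      = -∫ x in (Ω : Set (Euc d)), φ x • g x

theorem integrable_test_smul {d : ℕ} {Ω : Opens (Euc d)} {φ : Euc d → ℝ} (hφ : Continuous φ)
    (hc : HasCompactSupport φ) (u : L2 Ω) :
    Integrable (fun x => φ x • u x) (volume.restrict (Ω : Set (Euc d))) := by
  have h1 : MemLp φ 2 (volume.restrict (Ω : Set (Euc d))) := hφ.memLp_of_hasCompactSupport hc
  have := (Lp.memLp u).smul (r := 1) h1
  exact memLp_one_iff_integrable.1 this

theorem continuous_pderiv {d : ℕ} {F : Type*} [NormedAddCommGroup F] [NormedSpace ℝ F]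
    (i : Fin d) {φ : Euc d → F} (hφ : ContDiff ℝ ∞ φ) : Continuous (pderiv i φ) :=
  (hφ.continuous_fderiv (by simp)).clm_apply continuous_const

theorem hasCompactSupport_pderiv {d : ℕ} {F : Type*} [NormedAddCommGroup F] [NormedSpace ℝ F]
    (i : Fin d) {φ : Euc d → F} (hc : HasCompactSupport φ) : HasCompactSupport (pderiv i φ) :=
  hc.fderiv_apply ℝ _

theorem eq_zero_of_test {d : ℕ} {Ω : Opens (Euc d)} (w : L2 Ω)
    (h : ∀ φ : Euc d → ℝ, ContDiff ℝ ∞ φ → HasCompactSupport φ → tsupport φ ⊆ Ω →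
      ∫ x in (Ω : Set (Euc d)), φ x • w x = 0) : w = 0 := by
  have hloc : LocallyIntegrableOn w (Ω : Set (Euc d)) volume :=
    locallyIntegrableOn_of_locallyIntegrable_restrict
      ((Lp.memLp w).locallyIntegrable (by norm_num))
  have key := Ω.isOpen.ae_eq_zero_of_integral_contDiff_smul_eq_zero hloc (fun φ h1 h2 h3 => by
    rw [← h φ h1 h2 h3]
    refine (setIntegral_eq_integral_of_forall_compl_eq_zero fun x hx => ?_).symm
    have : φ x = 0 := image_eq_zero_of_notMem_tsupport fun hx' => hx (h3 hx')
    simp [this])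
  rw [Lp.eq_zero_iff_ae_eq_zero]
  exact (ae_restrict_iff' Ω.isOpen.measurableSet).2 key

theorem IsWeakPartial.unique {d : ℕ} {Ω : Opens (Euc d)} {i : Fin d} {u g g' : L2 Ω}
    (h : IsWeakPartial i u g) (h' : IsWeakPartial i u g') : g = g' := by
  rw [← sub_eq_zero]
  refine eq_zero_of_test _ fun φ h1 h2 h3 => ?_
  have e := (h φ h1 h2 h3).symm.trans (h' φ h1 h2 h3)
  have : ∫ x in (Ω : Set (Euc d)), φ x • (g - g') x
      = ∫ x in (Ω : Set (Euc d)), (φ x • g x - φ x • g' x) := by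
    refine integral_congr_ae ?_
    filter_upwards [Lp.coeFn_sub g g'] with x hx
    rw [hx, Pi.sub_apply, smul_sub]
  rw [this, integral_sub (integrable_test_smul h1.continuous h2 g)
    (integrable_test_smul h1.continuous h2 g'), neg_inj.1 e, sub_self]

theorem IsWeakPartial.add {d : ℕ} {Ω : Opens (Euc d)} {i : Fin d} {u v g k : L2 Ω}
    (h : IsWeakPartial i u g) (h' : IsWeakPartial i v k) : IsWeakPartial i (u + v) (g + k) := by
  intro φ h1 h2 h3
  have aux : ∀ (ψ : Euc d → ℝ), Continuous ψ → HasCompactSupport ψ → ∀ a b : L2 Ω,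
      ∫ x in (Ω : Set (Euc d)), ψ x • (a + b) x
        = (∫ x in (Ω : Set (Euc d)), ψ x • a x) + ∫ x in (Ω : Set (Euc d)), ψ x • b x := by
    intro ψ hψ hc a b
    rw [← integral_add (integrable_test_smul hψ hc a) (integrable_test_smul hψ hc b)]
    refine integral_congr_ae ?_
    filter_upwards [Lp.coeFn_add a b] with x hx
    rw [hx, Pi.add_apply, smul_add]
  rw [aux _ (continuous_pderiv i h1) (hasCompactSupport_pderiv i h2), aux _ h1.continuous h2,
    h φ h1 h2 h3, h' φ h1 h2 h3, neg_add]

theorem IsWeakPartial.smul {d : ℕ} {Ω : Opens (Euc d)} {i : Fin d} {u g : L2 Ω} (c : ℂ)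
    (h : IsWeakPartial i u g) : IsWeakPartial i (c • u) (c • g) := by
  intro φ h1 h2 h3
  have aux : ∀ (ψ : Euc d → ℝ) (a : L2 Ω),
      ∫ x in (Ω : Set (Euc d)), ψ x • (c • a) x = c • ∫ x in (Ω : Set (Euc d)), ψ x • a x := by
    intro ψ a
    rw [← integral_smul]
    refine integral_congr_ae ?_
    filter_upwards [Lp.coeFn_smul c a] with x hx
    rw [hx, Pi.smul_apply, smul_comm]
  rw [aux, aux, h φ h1 h2 h3, smul_neg]

/-- The Sobolev space `H¹(Ω)`. -/
def H1 {d : ℕ} (Ω : Opens (Euc d)) : Submodule ℂ (L2 Ω) where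
  carrier := {u | ∀ i, ∃ g, IsWeakPartial i u g}
  add_mem' hu hv i := by
    obtain ⟨g, hg⟩ := hu i
    obtain ⟨k, hk⟩ := hv i
    exact ⟨g + k, hg.add hk⟩
  zero_mem' i := ⟨0, fun φ _ _ _ => by
    have h0 : (⇑(0 : L2 Ω)) =ᵐ[volume.restrict (Ω : Set (Euc d))] 0 := Lp.coeFn_zero _ _ _
    have aux : ∀ ψ : Euc d → ℝ, ∫ x in (Ω : Set (Euc d)), ψ x • (0 : L2 Ω) x = 0 := fun ψ =>
      integral_eq_zero_of_ae (by
        filter_upwards [h0] with x hx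
        rw [hx]
        exact smul_zero _)
    rw [aux, aux, neg_zero]⟩
  smul_mem' c u hu i := by
    obtain ⟨g, hg⟩ := hu i
    exact ⟨c • g, hg.smul c⟩

/-- The weak partial derivative `∂ᵢ : H¹(Ω) → L²(Ω)`. -/
def wpderiv {d : ℕ} {Ω : Opens (Euc d)} (i : Fin d) : H1 Ω →ₗ[ℂ] L2 Ω where
  toFun u := (u.2 i).choose
  map_add' u v := ((u + v).2 i).choose_spec.unique
    (((u.2 i).choose_spec).add ((v.2 i).choose_spec))
  map_smul' c u := ((c • u).2 i).choose_spec.unique (((u.2 i).choose_spec).smul c)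

theorem wpderiv_spec {d : ℕ} {Ω : Opens (Euc d)} (i : Fin d) (u : H1 Ω) :
    IsWeakPartial i (u : L2 Ω) (wpderiv i u) := (u.2 i).choose_spec

/-- `φ` approximates `u` up to `ε` in the norm of `H¹(Ω)` (each of the functions `u`, `∂ᵢu`
is approximated up to `ε` in `L²(Ω)`). -/
def IsH1Close {d : ℕ} {Ω : Opens (Euc d)} (φ : Euc d → ℂ) (u : H1 Ω) (ε : ℝ) : Prop :=
  eLpNorm (fun x => φ x - (u : L2 Ω) x) 2 (volume.restrict (Ω : Set (Euc d)))
      ≤ ENNReal.ofReal ε ∧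
    ∀ i, eLpNorm (fun x => pderiv i φ x - wpderiv i u x) 2 (volume.restrict (Ω : Set (Euc d)))
      ≤ ENNReal.ofReal ε

theorem IsH1Close.add {d : ℕ} {Ω : Opens (Euc d)} {φ ψ : Euc d → ℂ} {u v : H1 Ω} {ε δ : ℝ}
    (hφ : ContDiff ℝ ∞ φ) (hψ : ContDiff ℝ ∞ ψ) (hε : 0 ≤ ε) (hδ : 0 ≤ δ)
    (h : IsH1Close φ u ε) (h' : IsH1Close ψ v δ) : IsH1Close (φ + ψ) (u + v) (ε + δ) := by
  have aux : ∀ (f g : Euc d → ℂ) (a b : L2 Ω), Continuous f → Continuous g →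
      eLpNorm (fun x => f x - a x) 2 (volume.restrict (Ω : Set (Euc d))) ≤ ENNReal.ofReal ε →
      eLpNorm (fun x => g x - b x) 2 (volume.restrict (Ω : Set (Euc d))) ≤ ENNReal.ofReal δ →
      eLpNorm (fun x => (f x + g x) - (a + b) x) 2 (volume.restrict (Ω : Set (Euc d)))
        ≤ ENNReal.ofReal (ε + δ) := by
    intro f g a b hf hg h1 h2
    rw [ENNReal.ofReal_add hε hδ]
    refine le_trans (le_of_eq ?_) ((eLpNorm_add_le
      (hf.aestronglyMeasurable.sub (Lp.aestronglyMeasurable a))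
      (hg.aestronglyMeasurable.sub (Lp.aestronglyMeasurable b)) (by norm_num)).trans
      (add_le_add h1 h2))
    refine eLpNorm_congr_ae ?_
    filter_upwards [Lp.coeFn_add a b] with x hx
    simp only [hx, Pi.add_apply, Pi.sub_apply]
    ring
  refine ⟨aux _ _ _ _ hφ.continuous hψ.continuous h.1 h'.1, fun i => ?_⟩
  rw [map_add]
  have e : ∀ x, pderiv i (φ + ψ) x = pderiv i φ x + pderiv i ψ x := fun x => by
    simp [pderiv, fderiv_add (hφ.differentiable (by simp) x) (hψ.differentiable (by simp) x)]
  simp only [e]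
  exact aux _ _ _ _ (continuous_pderiv i hφ) (continuous_pderiv i hψ) (h.2 i) (h'.2 i)

theorem IsH1Close.smul {d : ℕ} {Ω : Opens (Euc d)} {φ : Euc d → ℂ} {u : H1 Ω} {ε : ℝ} (c : ℂ)
    (hφ : ContDiff ℝ ∞ φ) (h : IsH1Close φ u ε) : IsH1Close (c • φ) (c • u) (‖c‖ * ε) := by
  have aux : ∀ (f : Euc d → ℂ) (a : L2 Ω),
      eLpNorm (fun x => f x - a x) 2 (volume.restrict (Ω : Set (Euc d))) ≤ ENNReal.ofReal ε →
      eLpNorm (fun x => c • f x - (c • a) x) 2 (volume.restrict (Ω : Set (Euc d)))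
        ≤ ENNReal.ofReal (‖c‖ * ε) := by
    intro f a h1
    have : eLpNorm (fun x => c • f x - (c • a) x) 2 (volume.restrict (Ω : Set (Euc d)))
        = eLpNorm (c • fun x => f x - a x) 2 (volume.restrict (Ω : Set (Euc d))) := by
      refine eLpNorm_congr_ae ?_
      filter_upwards [Lp.coeFn_smul c a] with x hx
      simp only [hx, Pi.smul_apply, smul_sub]
    rw [this, eLpNorm_const_smul, ENNReal.ofReal_mul (norm_nonneg c), ofReal_norm]
    gcongr
  refine ⟨aux _ _ h.1, fun i => ?_⟩
  rw [map_smul]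
  have e : ∀ x, pderiv i (c • φ) x = c • pderiv i φ x := fun x => by
    simp [pderiv, fderiv_const_smul (hφ.differentiable (by simp) x)]
  simp only [e]
  exact aux _ _ (h.2 i)

/-- `H¹₀(Ω, Γ)`, the functions of `H¹(Ω)` which vanish on `Γ`: the closure in `H¹(Ω)` of the
(restrictions to `Ω` of) functions of class `C_c^∞(ℝᵈ)` which vanish near `Γ`. -/
def H10 {d : ℕ} (Ω : Opens (Euc d)) (Γ : Set (Euc d)) : Submodule ℂ (H1 Ω) where
  carrier := {u | ∀ ε : ℝ, 0 < ε → ∃ φ : Euc d → ℂ, ContDiff ℝ ∞ φ ∧ HasCompactSupport φ ∧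
    Disjoint (tsupport φ) Γ ∧ IsH1Close φ u ε}
  add_mem' {u v} hu hv ε hε := by
    obtain ⟨φ, h1, h2, h3, h4⟩ := hu (ε / 2) (half_pos hε)
    obtain ⟨ψ, k1, k2, k3, k4⟩ := hv (ε / 2) (half_pos hε)
    refine ⟨φ + ψ, h1.add k1, h2.add k2, (h3.union_left k3).mono_left (tsupport_add φ ψ), ?_⟩
    simpa using h4.add h1 k1 (half_pos hε).le (half_pos hε).le k4
  zero_mem' ε hε := by
    refine ⟨0, contDiff_const, HasCompactSupport.zero, by simp [tsupport], ?_⟩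
    have aux : eLpNorm (fun x => (0 : ℂ) - (0 : L2 Ω) x) 2 (volume.restrict (Ω : Set (Euc d)))
        ≤ ENNReal.ofReal ε := by
      have h0 : (⇑(0 : L2 Ω)) =ᵐ[volume.restrict (Ω : Set (Euc d))] 0 := Lp.coeFn_zero _ _ _
      have : (fun x => (0 : ℂ) - (0 : L2 Ω) x) =ᵐ[volume.restrict (Ω : Set (Euc d))] 0 := by
        filter_upwards [h0] with x hx
        rw [hx]
        exact sub_zero _
      rw [eLpNorm_congr_ae this]
      simp
    refine ⟨aux, fun i => ?_⟩
    rw [map_zero]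
    have e : ∀ x, pderiv i (0 : Euc d → ℂ) x = 0 := fun x => by simp [pderiv]
    simp only [e]
    exact aux
  smul_mem' c u hu ε hε := by
    obtain ⟨φ, h1, h2, h3, h4⟩ := hu (ε / (‖c‖ + 1)) (by positivity)
    have hs : tsupport (c • φ) ⊆ tsupport φ := tsupport_smul_subset_right (fun _ => c) φ
    refine ⟨c • φ, h1.const_smul c, h2.smul_left (f := fun _ => c), h3.mono_left hs, ?_⟩
    have k := h4.smul c h1
    have hle : ‖c‖ * (ε / (‖c‖ + 1)) ≤ ε := by
      rw [mul_div_assoc', div_le_iff₀ (by positivity)]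
      nlinarith [norm_nonneg c]
    exact ⟨k.1.trans (ENNReal.ofReal_le_ofReal hle),
      fun i => (k.2 i).trans (ENNReal.ofReal_le_ofReal hle)⟩

/-- A test function `φ ∈ C_c^∞(Ω)` as an element of `L²(Ω)`. -/
def testL2 {d : ℕ} (Ω : Opens (Euc d)) (φ : Euc d → ℝ) (h : Continuous φ)
    (hc : HasCompactSupport φ) : L2 Ω :=
  MemLp.toLp (fun x => (φ x : ℂ)) ((h.memLp_of_hasCompactSupport hc).ofReal)

theorem isWeakPartial_test {d : ℕ} (Ω : Opens (Euc d)) (i : Fin d) {φ : Euc d → ℝ}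
    (h : ContDiff ℝ ∞ φ) (hc : HasCompactSupport φ) :
    IsWeakPartial i (testL2 Ω φ h.continuous hc)
      (testL2 Ω (pderiv i φ) (continuous_pderiv i h) (hasCompactSupport_pderiv i hc)) := by
  intro ψ k1 k2 k3
  have aux : ∀ (η : Euc d → ℝ), tsupport η ⊆ Ω → ∀ (f : Euc d → ℝ) (hf : Continuous f)
      (hfc : HasCompactSupport f), ∫ x in (Ω : Set (Euc d)), η x • testL2 Ω f hf hfc x
        = ((∫ x, η x * f x : ℝ) : ℂ) := by
    intro η hη f hf hfc
    have e : ∫ x in (Ω : Set (Euc d)), ((η x * f x : ℝ) : ℂ) = ∫ x, ((η x * f x : ℝ) : ℂ) := by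
      refine setIntegral_eq_integral_of_forall_compl_eq_zero fun x hx => ?_
      have : η x = 0 := image_eq_zero_of_notMem_tsupport fun hx' => hx (hη hx')
      simp [this]
    rw [← integral_complex_ofReal, ← e]
    refine integral_congr_ae ?_
    filter_upwards [MemLp.coeFn_toLp ((hf.memLp_of_hasCompactSupport (p := 2)
      (μ := volume.restrict (Ω : Set (Euc d))) hfc).ofReal (K := ℂ))] with x hx
    have hx' : testL2 Ω f hf hfc x = (f x : ℂ) := hx
    rw [hx']
    simp
  have int : ∀ {a b : Euc d → ℝ}, Continuous a → Continuous b → HasCompactSupport a →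
      Integrable (fun x => a x * b x) volume := fun ha hb hac =>
    (ha.mul hb).integrable_of_hasCompactSupport hac.mul_right
  rw [aux (pderiv i ψ) ((tsupport_fderiv_apply_subset ℝ _).trans k3), aux _ k3, ← Complex.ofReal_neg]
  congr 1
  have := integral_mul_fderiv_eq_neg_fderiv_mul_of_integrable (𝕜 := ℝ) (μ := volume)
    (f := ψ) (g := φ) (v := EuclideanSpace.single i 1)
    (int (continuous_pderiv i k1) h.continuous (hasCompactSupport_pderiv i k2))
    (int k1.continuous (continuous_pderiv i h) k2) (int k1.continuous h.continuous k2)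
    (fun x _ => k1.differentiable (by simp) x) (fun x _ => h.differentiable (by simp) x)
  simp only [pderiv] at *
  linarith

/-- A test function `φ ∈ C_c^∞(Ω)` as an element of `H¹(Ω)`. -/
def testH1 {d : ℕ} (Ω : Opens (Euc d)) (φ : Euc d → ℝ) (h : ContDiff ℝ ∞ φ)
    (hc : HasCompactSupport φ) : H1 Ω :=
  ⟨testL2 Ω φ h.continuous hc, fun i => ⟨_, isWeakPartial_test Ω i h hc⟩⟩

theorem wpderiv_testH1 {d : ℕ} (Ω : Opens (Euc d)) (i : Fin d) {φ : Euc d → ℝ}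
    (h : ContDiff ℝ ∞ φ) (hc : HasCompactSupport φ) :
    wpderiv i (testH1 Ω φ h hc) =ᵐ[volume.restrict (Ω : Set (Euc d))]
      fun x => ((pderiv i φ x : ℝ) : ℂ) := by
  have : wpderiv i (testH1 Ω φ h hc) = testL2 Ω (pderiv i φ) (continuous_pderiv i h)
      (hasCompactSupport_pderiv i hc) :=
    (wpderiv_spec i _).unique (isWeakPartial_test Ω i h hc)
  rw [this]
  exact MemLp.coeFn_toLp _

theorem testH1_mem_H10 {d : ℕ} (Ω : Opens (Euc d)) {Γ : Set (Euc d)} {φ : Euc d → ℝ}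
    (h : ContDiff ℝ ∞ φ) (hc : HasCompactSupport φ) (hd : Disjoint (tsupport φ) Γ) :
    testH1 Ω φ h hc ∈ H10 Ω Γ := by
  intro ε hε
  have hs : tsupport (fun x => (φ x : ℂ)) ⊆ tsupport φ :=
    closure_mono fun x hx hx' => hx (by simp [hx'])
  refine ⟨fun x => (φ x : ℂ), Complex.ofRealCLM.contDiff.comp h,
    hc.comp_left Complex.ofReal_zero, hd.mono_left hs, ?_, fun i => ?_⟩
  · refine le_trans (le_of_eq ?_) zero_le
    rw [eLpNorm_congr_ae (g := 0), eLpNorm_zero]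
    filter_upwards [MemLp.coeFn_toLp ((h.continuous.memLp_of_hasCompactSupport (p := 2)
        (μ := volume.restrict (Ω : Set (Euc d))) hc).ofReal (K := ℂ))] with x hx
    exact sub_eq_zero.2 hx.symm
  · refine le_trans (le_of_eq ?_) zero_le
    rw [eLpNorm_congr_ae (g := 0), eLpNorm_zero]
    filter_upwards [wpderiv_testH1 Ω i h hc] with x hx
    rw [hx, Pi.zero_apply, sub_eq_zero]
    have e : fderiv ℝ (fun x => (φ x : ℂ)) x = Complex.ofRealCLM.comp (fderiv ℝ φ x) :=
      (Complex.ofRealCLM.hasFDerivAt.comp x (h.differentiable (by simp) x).hasFDerivAt).fderiv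
    rw [pderiv, e]
    rfl

/-! ### Geometry of the cross-section -/

/-- `D` is a bounded planar domain with a piecewise `C²` boundary without cusps: near each
boundary point `p`, after a rigid motion taking `p` to the origin, `D` is the set of points above
the graph of a function that is of class `C²` up to `0` on either side of `0`.
(The interior angle at `p` is then in `(0, 2π)`; it may differ from `π` only at corners,
which are isolated, hence finite in number.) -/
structure IsCrossSection (D : Opens (Euc 2)) : Prop where
  isConnected : IsConnected (D : Set (Euc 2))
  isBounded : Bornology.IsBounded (D : Set (Euc 2))
  boundary : ∀ p ∈ frontier (D : Set (Euc 2)),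
    ∃ (R : Euc 2 ≃ₗᵢ[ℝ] Euc 2) (f₁ f₂ : ℝ → ℝ) (r : ℝ), 0 < r ∧
      ContDiff ℝ 2 f₁ ∧ ContDiff ℝ 2 f₂ ∧ f₁ 0 = 0 ∧ f₂ 0 = 0 ∧
      ∀ y : Euc 2, ‖y‖ < r →
        (p + R y ∈ D ↔ (if y 0 ≤ 0 then f₁ (y 0) else f₂ (y 0)) < y 1)

/-- `A` is an arc of the boundary of `D`: the image of a nondegenerate interval under an injective
continuous path in `∂D`. The end points may or may not belong to `A`. -/
def IsBoundaryArc (D : Opens (Euc 2)) (A : Set (Euc 2)) : Prop :=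
  ∃ c : ℝ → Euc 2, ContinuousOn c (Icc 0 1) ∧ InjOn c (Icc 0 1) ∧
    c '' Icc 0 1 ⊆ frontier (D : Set (Euc 2)) ∧ c '' Ioo 0 1 ⊆ A ∧ A ⊆ c '' Icc 0 1

/-- `γ` is the union of finitely many arcs of the boundary of `D`. -/
def IsFiniteUnionOfArcs (D : Opens (Euc 2)) (γ : Set (Euc 2)) : Prop :=
  ∃ (n : ℕ) (A : Fin n → Set (Euc 2)), (∀ j, IsBoundaryArc D (A j)) ∧ γ = ⋃ j, A j

/-- The projection `x = (x', x₃) ↦ x'`. -/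
def proj (x : Euc 3) : Euc 2 := !₂[x 0, x 1]

theorem continuous_proj : Continuous proj := by
  unfold proj
  refine (PiLp.continuous_toLp 2 _).comp (continuous_pi fun i => ?_)
  fin_cases i
  · exact EuclideanSpace.proj (𝕜 := ℝ) (0 : Fin 3) |>.continuous
  · exact EuclideanSpace.proj (𝕜 := ℝ) (1 : Fin 3) |>.continuous

/-- The straight tube `Q = D × ℝ`. -/
def tube (D : Opens (Euc 2)) : Opens (Euc 3) :=
  ⟨proj ⁻¹' (D : Set (Euc 2)), D.isOpen.preimage continuous_proj⟩

/-- The Dirichlet part `Γ = γ_D × ℝ` of the boundary of the tube. -/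
def tubeDirichlet (γ : Set (Euc 2)) : Set (Euc 3) := proj ⁻¹' γ

/-! ### The cross-sectional eigenvalue problem -/

/-- The angular derivative `∂_φ ψ = x₁ ∂₂ψ - x₂ ∂₁ψ` in the plane. -/
def angDeriv {D : Opens (Euc 2)} (ψ : H1 D) (x : Euc 2) : ℂ :=
  (x 0 : ℂ) * wpderiv 1 ψ x - (x 1 : ℂ) * wpderiv 0 ψ x

/-- The real number `μ` is an eigenvalue of the problem `-Δψ - α² ∂_φ² ψ = μ ψ` in `D`, `ψ = 0` on
`γ`, with vanishing co-normal derivative on the rest of the boundary, in the weak sense: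
there is a nonzero `ψ ∈ H¹₀(D, γ)` with
`(∇ψ, ∇φ) + α² (∂_φ ψ, ∂_φ φ) = μ (ψ, φ)` for all `φ ∈ H¹₀(D, γ)`. -/
def IsSectionEigenvalue (D : Opens (Euc 2)) (γ : Set (Euc 2)) (α μ : ℝ) : Prop :=
  ∃ ψ ∈ H10 D γ, ψ ≠ 0 ∧ ∀ φ ∈ H10 D γ,
    inner ℂ (wpderiv 0 φ) (wpderiv 0 ψ) + inner ℂ (wpderiv 1 φ) (wpderiv 1 ψ)
        + (α : ℂ) ^ 2 * ∫ x in (D : Set (Euc 2)), inner ℂ (angDeriv φ x) (angDeriv ψ x)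
      = (μ : ℂ) * inner ℂ (φ : L2 D) (ψ : L2 D)

/-! ### The operator of the twisted tube -/

/-- The function `(∂₃ + β' ∂_φ) u = ∂₃u + β'(x₃) (x₁ ∂₂u - x₂ ∂₁u)` on the tube. -/
def twistDeriv {D : Opens (Euc 2)} (β : ℝ → ℝ) (u : H1 (tube D)) (x : Euc 3) : ℂ :=
  wpderiv 2 u x
    + ((deriv β (x 2) : ℝ) : ℂ) * ((x 0 : ℂ) * wpderiv 1 u x - (x 1 : ℂ) * wpderiv 0 u x)

theorem twistDeriv_add {D : Opens (Euc 2)} (β : ℝ → ℝ) (u v : H1 (tube D)) :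
    twistDeriv β (u + v) =ᵐ[volume.restrict (tube D : Set (Euc 3))]
      twistDeriv β u + twistDeriv β v := by
  have h := fun i : Fin 3 => Lp.coeFn_add (wpderiv i u) (wpderiv i v)
  filter_upwards [h 0, h 1, h 2] with x h0 h1 h2
  simp only [twistDeriv, map_add, h0, h1, h2, Pi.add_apply]
  ring

theorem twistDeriv_smul {D : Opens (Euc 2)} (β : ℝ → ℝ) (c : ℂ) (u : H1 (tube D)) :
    twistDeriv β (c • u) =ᵐ[volume.restrict (tube D : Set (Euc 3))] c • twistDeriv β u := by
  have h := fun i : Fin 3 => Lp.coeFn_smul c (wpderiv i u)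
  filter_upwards [h 0, h 1, h 2] with x h0 h1 h2
  simp only [twistDeriv, map_smul, h0, h1, h2, Pi.smul_apply, smul_eq_mul]
  ring

/-- The form domain: all `u ∈ H¹₀(Q, γ × ℝ)` on which the form is finite. If `D` and `β'` are
bounded, this is the whole of `H¹₀(Q, γ × ℝ)`. -/
def formDomain (D : Opens (Euc 2)) (γ : Set (Euc 2)) (β : ℝ → ℝ) :
    Submodule ℂ (H1 (tube D)) where
  carrier := {u | u ∈ H10 (tube D) (tubeDirichlet γ) ∧
    MemLp (twistDeriv β u) 2 (volume.restrict (tube D : Set (Euc 3)))}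
  add_mem' hu hv := ⟨add_mem hu.1 hv.1, (memLp_congr_ae (twistDeriv_add β _ _)).2 (hu.2.add hv.2)⟩
  zero_mem' := ⟨zero_mem _, by
    have := twistDeriv_smul β 0 (0 : H1 (tube D))
    rw [zero_smul, zero_smul] at this
    exact (memLp_congr_ae this).2 MemLp.zero⟩
  smul_mem' c u hu := ⟨Submodule.smul_mem _ c hu.1,
    (memLp_congr_ae (twistDeriv_smul β c u)).2 (hu.2.const_smul c)⟩

/-- The sesquilinear form (antilinear in the first argument)
`a_β(v, u) = ∫_Q conj(∂₁v) ∂₁u + conj(∂₂v) ∂₂u + conj((∂₃ + β'∂_φ)v) (∂₃ + β'∂_φ)u`. -/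
def twistForm {D : Opens (Euc 2)} (β : ℝ → ℝ) (v u : H1 (tube D)) : ℂ :=
  inner ℂ (wpderiv 0 v) (wpderiv 0 u) + inner ℂ (wpderiv 1 v) (wpderiv 1 u)
    + ∫ x in (tube D : Set (Euc 3)), inner ℂ (twistDeriv β v x) (twistDeriv β u x)

theorem twistForm_add {D : Opens (Euc 2)} {γ : Set (Euc 2)} {β : ℝ → ℝ} {v u u' : H1 (tube D)}
    (hv : v ∈ formDomain D γ β) (hu : u ∈ formDomain D γ β) (hu' : u' ∈ formDomain D γ β) :
    twistForm β v (u + u') = twistForm β v u + twistForm β v u' := by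
  have hi : ∀ w ∈ formDomain D γ β, Integrable
      (fun x => inner ℂ (twistDeriv β v x) (twistDeriv β w x))
      (volume.restrict (tube D : Set (Euc 3))) := fun w hw => by
    simp only [RCLike.inner_apply]
    exact hw.2.integrable_mul hv.2.star
  have e : ∫ x in (tube D : Set (Euc 3)), inner ℂ (twistDeriv β v x) (twistDeriv β (u + u') x)
      = (∫ x in (tube D : Set (Euc 3)), inner ℂ (twistDeriv β v x) (twistDeriv β u x))
        + ∫ x in (tube D : Set (Euc 3)), inner ℂ (twistDeriv β v x) (twistDeriv β u' x) := by
    rw [← integral_add (hi u hu) (hi u' hu')]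
    refine integral_congr_ae ?_
    filter_upwards [twistDeriv_add β u u'] with x hx
    rw [hx, Pi.add_apply, inner_add_right]
  simp only [twistForm, map_add, inner_add_right, e]
  ring

theorem twistForm_smul {D : Opens (Euc 2)} (β : ℝ → ℝ) (v u : H1 (tube D)) (c : ℂ) :
    twistForm β v (c • u) = c * twistForm β v u := by
  have e : ∫ x in (tube D : Set (Euc 3)), inner ℂ (twistDeriv β v x) (twistDeriv β (c • u) x)
      = c * ∫ x in (tube D : Set (Euc 3)), inner ℂ (twistDeriv β v x) (twistDeriv β u x) := by
    rw [← integral_const_mul]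
    refine integral_congr_ae ?_
    filter_upwards [twistDeriv_smul β c u] with x hx
    rw [hx, Pi.smul_apply, inner_smul_right]
  simp only [twistForm, map_smul, inner_smul_right, e]
  ring

/-- The graph of the operator associated with the form `a_β`: the pairs `(u, w)` such that `u` is
in the form domain and `a_β(v, u) = (v, w)` for all `v` in the form domain. -/
def twistGraph (D : Opens (Euc 2)) (γ : Set (Euc 2)) (β : ℝ → ℝ) :
    Submodule ℂ (L2 (tube D) × L2 (tube D)) where
  carrier := {p | ∃ u ∈ formDomain D γ β, (u : L2 (tube D)) = p.1 ∧
    ∀ v ∈ formDomain D γ β, twistForm β v u = inner ℂ (v : L2 (tube D)) p.2}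
  add_mem' := by
    rintro p q ⟨u, hu, rfl', h⟩ ⟨u', hu', rfl'', h'⟩
    refine ⟨u + u', add_mem hu hu', by simp [rfl', rfl''], fun v hv => ?_⟩
    rw [twistForm_add hv hu hu', h v hv, h' v hv, Prod.snd_add, inner_add_right]
  zero_mem' := ⟨0, zero_mem _, rfl, fun v _ => by
    rw [← zero_smul ℂ (0 : H1 (tube D)), twistForm_smul]; simp⟩
  smul_mem' := by
    rintro c p ⟨u, hu, hp, h⟩
    refine ⟨c • u, Submodule.smul_mem _ c hu, by simp [hp], fun v hv => ?_⟩
    rw [twistForm_smul, h v hv, Prod.smul_snd, inner_smul_right]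

theorem testH1_mem_formDomain {D : Opens (Euc 2)} {γ : Set (Euc 2)}
    (hγ : γ ⊆ frontier (D : Set (Euc 2))) {β : ℝ → ℝ} (hβ : ContDiff ℝ 1 β) {φ : Euc 3 → ℝ}
    (h : ContDiff ℝ ∞ φ) (hc : HasCompactSupport φ) (hs : tsupport φ ⊆ tube D) :
    testH1 (tube D) φ h hc ∈ formDomain D γ β := by
  refine ⟨testH1_mem_H10 _ h hc (Set.disjoint_left.2 fun x hx hx' => ?_), ?_⟩
  · have h1 : proj x ∈ (D : Set (Euc 2)) := hs hx
    exact (hγ hx').2 (by rwa [D.isOpen.interior_eq])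
  · have co : ∀ i : Fin 3, Continuous fun x : Euc 3 => x i := fun i =>
      (EuclideanSpace.proj (𝕜 := ℝ) i).continuous
    have hβ' : Continuous (deriv β) := hβ.continuous_deriv le_rfl
    have hcs := fun i : Fin 3 => hasCompactSupport_pderiv i hc
    have hcc := fun i : Fin 3 => continuous_pderiv i h
    have key : MemLp (fun x : Euc 3 => pderiv 2 φ x
        + deriv β (x 2) * (x 0 * pderiv 1 φ x - x 1 * pderiv 0 φ x)) 2
        (volume.restrict (tube D : Set (Euc 3))) := by
      refine Continuous.memLp_of_hasCompactSupport ?_ ?_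
      · exact (hcc 2).add ((hβ'.comp (co 2)).mul
          (((co 0).mul (hcc 1)).sub ((co 1).mul (hcc 0))))
      · exact (hcs 2).add (((hcs 1).mul_left (f := fun x : Euc 3 => x 0)).sub
          ((hcs 0).mul_left (f := fun x : Euc 3 => x 1))).mul_left
    refine (memLp_congr_ae ?_).2 (key.ofReal (K := ℂ))
    filter_upwards [wpderiv_testH1 (tube D) 0 h hc, wpderiv_testH1 (tube D) 1 h hc,
      wpderiv_testH1 (tube D) 2 h hc] with x h0 h1 h2
    rw [twistDeriv, h0, h1, h2]
    simp

/-- The form domain is dense, so the operator associated with the form is well defined. -/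
theorem twistGraph_singleValued {D : Opens (Euc 2)} {γ : Set (Euc 2)}
    (hγ : γ ⊆ frontier (D : Set (Euc 2))) {β : ℝ → ℝ} (hβ : ContDiff ℝ 1 β)
    (p : L2 (tube D) × L2 (tube D)) (hp : p ∈ twistGraph D γ β) (h0 : p.1 = 0) : p.2 = 0 := by
  obtain ⟨u, hu, hu', h⟩ := hp
  have hu0 : u = 0 := Subtype.ext (hu'.trans h0)
  refine eq_zero_of_test _ fun φ h1 h2 h3 => ?_
  have e := h _ (testH1_mem_formDomain hγ hβ h1 h2 h3)
  rw [hu0, ← zero_smul ℂ (0 : H1 (tube D)), twistForm_smul, zero_mul, L2.inner_def] at e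
  rw [e]
  refine integral_congr_ae ?_
  filter_upwards [MemLp.coeFn_toLp ((h1.continuous.memLp_of_hasCompactSupport (p := 2)
    (μ := volume.restrict (tube D : Set (Euc 3))) h2).ofReal (K := ℂ))] with x hx
  have hx' : (testH1 (tube D) φ h1 h2 : L2 (tube D)) x = (φ x : ℂ) := hx
  rw [hx']
  simp [RCLike.inner_apply, mul_comm]

/-- The operator `T_β` on `L²(Q)` associated with the form `a_β`. -/
def twistOp (D : Opens (Euc 2)) (γ : Set (Euc 2)) (β : ℝ → ℝ) :
    L2 (tube D) →ₗ.[ℂ] L2 (tube D) :=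
  (twistGraph D γ β).toLinearPMap

/-! ### The spectrum of an unbounded operator -/

/-- The resolvent set of `T`: those `z` for which `T - z`, from the domain of `T` to `E`, has a
bounded everywhere defined two-sided inverse. -/
def opResolventSet {E : Type*} [NormedAddCommGroup E] [NormedSpace ℂ E] (T : E →ₗ.[ℂ] E) : Set ℂ :=
  {z | ∃ R : E →L[ℂ] E,
    (∀ f, ∃ h : R f ∈ T.domain, T ⟨R f, h⟩ - z • R f = f) ∧
    ∀ u : T.domain, R (T u - z • (u : E)) = u}

/-- The spectrum of `T`. -/
def opSpectrum {E : Type*} [NormedAddCommGroup E] [NormedSpace ℂ E] (T : E →ₗ.[ℂ] E) : Set ℂ :=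
  (opResolventSet T)ᶜ

end TwistedTube

end

/-! With `α` constant the form is invariant under translations in `x₃`, so it is governed by the
cross-sectional forms `‖∂₁ψ‖² + ‖∂₂ψ‖² + ‖(ik + α∂_φ)ψ‖²`, where `k` is the frequency in `x₃`. Let
`m(k)²` be the lowest eigenvalue of such a form, so that `λ₁ = m(0)²`. No Fourier transform or
direct integral is used: the two inclusions are proved separately.

Lower bound. For a test function `u` on the tube let `f(x') = ‖u(x', ·)‖` be its norm in `L²(ℝ)`. By
Cauchy–Schwarz on the fibres, `|∂ᵢf|` is at most the fibre norm of `∂ᵢu`. Moreover `Re ∫ ū ∂₃u dx₃ =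
0`, so that `α∂_φ f` is also what one gets by pairing `u` with `(∂₃ + α∂_φ)u`, and it is bounded by
the fibre norm of that function. Hence the tube form of `u` is at least the form of `f` at `k = 0`,
which is at least `λ₁‖f‖² = λ₁‖u‖²`. This diamagnetic inequality is `norm_sectionMap_fibreNorm_le`;
it leads to `le_norm_tubeMap`.

Filling the half-line. If `ψ` is a ground state at frequency `k`, then `ψ(x')` times a slowly
cut-off wave `e^{ikx₃}` is an approximate eigenfunction with value `m(k)²`
(`exists_approximate_eigenfunction`). Since `m` is continuous and grows at least linearly in `|k|`
(`exists_section_ground_states`), the intermediate value theorem shows that `m(k)²` takes every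
value in `[λ₁, ∞)`.

Ground states exist because `H¹₀(D, γ)` embeds compactly in `L²(D)`. This is derived from the
boundary charts: thin strips along the boundary are controlled by pushing them inwards, and the rest
is covered by small squares with a Poincaré inequality (`IsCrossSection.lintegral_sq_le`).

The operator theory is abstract. A form is written `(Su, Sv)` on a space with an embedding `J` into
the Hilbert space, and everything is read off from the bounded operator `J J†`, the inverse of `T +
1`. Function spaces appear as closed graphs of the weak gradient (`gradGraph`), so that any closed
condition needs checking on test functions only. -/

open MeasureTheory Set Filter Topology TopologicalSpace
open scoped ENNReal NNReal ContDiff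

noncomputable section

namespace TwistedTube

/-! ### Operators associated with closed forms -/

section AbstractForm

open ContinuousLinearMap InnerProductSpace
open scoped ComplexOrder

set_option linter.unusedSectionVars false

variable {V E F : Type*} [NormedAddCommGroup V] [InnerProductSpace ℂ V] [CompleteSpace V]
  [NormedAddCommGroup E] [InnerProductSpace ℂ E] [CompleteSpace E]
  [NormedAddCommGroup F] [InnerProductSpace ℂ F]

/-- The operator `J J†`; it is `(T + 1)⁻¹` if the scalar product of the form domain is
`a(u, v) + (Ju, Jv)` and `T` is the operator associated with `a`. -/
def formResolvent (J : V →L[ℂ] E) : E →L[ℂ] E := J ∘L adjoint J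

theorem formResolvent_isSymm (J : V →L[ℂ] E) (f g : E) :
    inner ℂ (formResolvent J f) g = inner ℂ f (formResolvent J g) := by
  simp only [formResolvent, coe_comp, Function.comp_apply]
  rw [← adjoint_inner_left, ← adjoint_inner_right J]

/-- If `J J† f = 0` then `‖J† f‖² = (f, J J† f) = 0`, so `f` is orthogonal to the dense range of
`J`. -/
theorem formResolvent_injective {J : V →L[ℂ] E} (hJ : DenseRange J) :
    Function.Injective (formResolvent J) := by
  rw [injective_iff_map_eq_zero]
  intro f hf
  have h1 : adjoint J f = 0 := by
    rw [← inner_self_eq_zero (𝕜 := ℂ), adjoint_inner_left]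
    simp only [formResolvent, coe_comp, Function.comp_apply] at hf
    rw [hf, inner_zero_right]
  refine hJ.eq_zero_of_inner_left ℂ ?_
  rintro v
  rw [← adjoint_inner_left, h1, inner_zero_left]

/-- Adding `(Ju, Jv)` to the weak equation turns it into `(u, v) = (Ju, p.1 + p.2)` for all `u`,
which says exactly that `v = J† (p.1 + p.2)`. From here on `T` enters only through the bounded
operator `J J†`. -/
theorem mem_graph_iff_formResolvent {J : V →L[ℂ] E} {S : V →L[ℂ] F}
    (hV : ∀ u v, inner ℂ u v = inner ℂ (J u) (J v) + inner ℂ (S u) (S v))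
    {T : E →ₗ.[ℂ] E}
    (hT : ∀ p, p ∈ T.graph ↔ ∃ v, J v = p.1 ∧ ∀ u, inner ℂ (S u) (S v) = inner ℂ (J u) p.2)
    (p : E × E) : p ∈ T.graph ↔ formResolvent J (p.1 + p.2) = p.1 := by
  rw [hT]
  constructor
  · rintro ⟨v, h1, h2⟩
    have : adjoint J (p.1 + p.2) = v := by
      refine ext_inner_left ℂ fun u => ?_
      rw [adjoint_inner_right, inner_add_right, hV, h2, h1]
    simp [formResolvent, this, h1]
  · intro h
    refine ⟨adjoint J (p.1 + p.2), h, fun u => ?_⟩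
    have h1 := hV u (adjoint J (p.1 + p.2))
    have h2 : J (adjoint J (p.1 + p.2)) = p.1 := h
    rw [adjoint_inner_right, h2, inner_add_right] at h1
    exact (add_left_cancel h1).symm

/-! ### Operators recovered from a bounded inverse of `T + 1`, and Weyl's criterion. -/

variable {R : E →L[ℂ] E} {T : E →ₗ.[ℂ] E}

theorem apply_eq_of_graph_iff (hT : ∀ p : E × E, p ∈ T.graph ↔ R (p.1 + p.2) = p.1) (f : E) :
    ∃ h : R f ∈ T.domain, T ⟨R f, h⟩ = f - R f := by
  have : ((R f, f - R f) : E × E) ∈ T.graph := by rw [hT]; simp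
  obtain ⟨y, hy1, hy2⟩ := (LinearPMap.mem_graph_iff T).1 this
  simp only at hy1 hy2
  have h : R f ∈ T.domain := hy1 ▸ y.2
  refine ⟨h, ?_⟩
  rw [← hy2]
  congr 1
  exact Subtype.ext hy1.symm

/-- `T` is `R⁻¹ - 1` with `R` symmetric, injective and defined everywhere. A vector orthogonal to
the domain, which contains the range of `R`, is annihilated by `R`, so the domain is dense. A pair
`p` in the graph of the adjoint, tested against `R f`, satisfies `(R (p.1 + p.2), f) = (p.1, f)`,
which is the criterion for `p` to lie in the graph of `T`. -/
theorem isSelfAdjoint_of_graph_iff (hR : ∀ f g, inner ℂ (R f) g = inner ℂ f (R g))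
    (hinj : Function.Injective R)
    (hT : ∀ p : E × E, p ∈ T.graph ↔ R (p.1 + p.2) = p.1) : IsSelfAdjoint T := by
  have hsub : ∀ f, R f ∈ T.domain := fun f => (apply_eq_of_graph_iff hT f).1
  have hdense : Dense (T.domain : Set E) := by
    rw [Submodule.dense_iff_topologicalClosure_eq_top,
      ← Submodule.orthogonal_eq_bot_iff (K := T.domain.topologicalClosure),
      Submodule.orthogonal_closure, Submodule.eq_bot_iff]
    intro x hx
    refine hinj ?_
    rw [map_zero, ← inner_self_eq_zero (𝕜 := ℂ), hR]
    rw [Submodule.mem_orthogonal'] at hx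
    exact hx _ (hsub _)
  have hgr : ∀ x : T.domain, R ((x : E) + T x) = x := fun x =>
    (hT (x, T x)).1 (LinearPMap.mem_graph T x)
  rw [LinearPMap.isSelfAdjoint_def]
  have hsymm : T.IsFormalAdjoint T := fun x y => by
    have e1 : inner ℂ (T x) (y : E) + inner ℂ (x : E) (y : E)
        = inner ℂ (x : E) (T y) + inner ℂ (x : E) (y : E) := by
      rw [← inner_add_left, ← inner_add_right]
      conv_lhs => rw [← hgr y]
      conv_rhs => rw [← hgr x]
      rw [hR, add_comm (T x), add_comm (T y)]
    exact add_right_cancel e1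
  refine le_antisymm ?_ (hsymm.le_adjoint hdense)
  rw [← LinearPMap.le_graph_iff]
  intro p hp
  obtain ⟨y, hy1, hy2⟩ := (LinearPMap.mem_graph_iff _).1 hp
  rw [hT]
  refine ext_inner_right ℂ fun f => ?_
  obtain ⟨h, hf⟩ := apply_eq_of_graph_iff hT f
  have := LinearPMap.adjoint_isFormalAdjoint hdense y ⟨R f, h⟩
  rw [hf, hy1, hy2] at this
  simp only [inner_sub_right] at this
  rw [hR, inner_add_left, this]
  ring

/-- Since `T R = 1 - R`, one has `(T - z) R = 1 - (z + 1) R`; the resolvent at `z` is therefore `R`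
times the inverse of the right-hand side. -/
theorem mem_opResolventSet_of_isUnit
    (hT : ∀ p : E × E, p ∈ T.graph ↔ R (p.1 + p.2) = p.1) {z : ℂ}
    (hz : IsUnit (1 - (z + 1) • R)) : z ∈ opResolventSet T := by
  obtain ⟨U, hU⟩ := hz
  set W : E →L[ℂ] E := ↑U⁻¹ with hW
  have h1 : ∀ f, W f - (z + 1) • R (W f) = f := fun f => by
    have := congrArg (fun A : E →L[ℂ] E => A f) U.mul_inv
    simpa [hU] using this
  have h2 : ∀ f, W (f - (z + 1) • R f) = f := fun f => by
    have := congrArg (fun A : E →L[ℂ] E => A f) U.inv_mul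
    simpa [hU] using this
  have hcomm : ∀ f, W (R f) = R (W f) := fun f => by
    conv_lhs => rw [← h1 f, map_sub, map_smul]
    rw [h2]
  refine ⟨R ∘L W, fun f => ?_, fun u => ?_⟩
  · obtain ⟨h, hf⟩ := apply_eq_of_graph_iff hT (W f)
    refine ⟨h, ?_⟩
    simp only [coe_comp, Function.comp_apply]
    rw [hf]
    conv_rhs => rw [← h1 f]
    module
  · have hu := (hT (u, T u)).1 (LinearPMap.mem_graph T u)
    simp only at hu
    simp only [coe_comp, Function.comp_apply]
    have e : T u - z • (u : E) = ((u : E) + T u) - (z + 1) • R ((u : E) + T u) := by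
      rw [hu]; module
    rw [e, h2, hu]

/-- The bound on the form gives `0 ≤ J J† ≤ 1 / (m + 1)`. A point `z ≠ -1` of the spectrum of `T`
produces `1 / (z + 1)` in the spectrum of `J J†`, hence in `(0, 1 / (m + 1)]`, so `z` is real and at
least `m`. -/
theorem opSpectrum_subset_of_form_lower_bound {J : V →L[ℂ] E} {S : V →L[ℂ] F}
    (hV : ∀ u v, inner ℂ u v = inner ℂ (J u) (J v) + inner ℂ (S u) (S v))
    (hT : ∀ p : E × E, p ∈ T.graph ↔ formResolvent J (p.1 + p.2) = p.1) {m : ℝ} (hm : 0 ≤ m)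
    (hS : ∀ u, m * ‖J u‖ ^ 2 ≤ ‖S u‖ ^ 2) :
    opSpectrum T ⊆ (fun t : ℝ => (t : ℂ)) '' Ici m := by
  have hnorm : ∀ u, ‖u‖ ^ 2 = ‖J u‖ ^ 2 + ‖S u‖ ^ 2 := fun u => by
    have := congrArg Complex.re (hV u u)
    simpa [← Complex.ofReal_pow] using this
  have hJ1 : ∀ u, (m + 1) * ‖J u‖ ^ 2 ≤ ‖u‖ ^ 2 := fun u => by
    rw [hnorm]; nlinarith [hS u]
  -- `(m + 1) ‖J J† f‖² ≤ ‖J† f‖² = (f, J J† f) ≤ ‖f‖ ‖J J† f‖`.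
  have hRn : ∀ f, (m + 1) * ‖formResolvent J f‖ ≤ ‖f‖ := by
    intro f
    have a1 : ‖adjoint J f‖ ^ 2 ≤ ‖f‖ * ‖formResolvent J f‖ := by
      have : (‖adjoint J f‖ ^ 2 : ℝ) = (inner ℂ f (formResolvent J f)).re := by
        simp only [formResolvent, coe_comp, Function.comp_apply]
        rw [← adjoint_inner_left, inner_self_eq_norm_sq_to_K]
        simp [← Complex.ofReal_pow]
      rw [this]
      exact (Complex.re_le_norm _).trans (norm_inner_le_norm _ _)
    have a2 := hJ1 (adjoint J f)
    have a3 : J (adjoint J f) = formResolvent J f := rfl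
    rw [a3] at a2
    rcases (norm_nonneg (formResolvent J f)).eq_or_lt with h | h
    · rw [← h]; simp
    · nlinarith
  have hpos : ∀ f, 0 ≤ (inner ℂ (formResolvent J f) f).re := fun f => by
    simp only [formResolvent, coe_comp, Function.comp_apply]
    rw [← adjoint_inner_right, inner_self_eq_norm_sq_to_K]
    simp only [Complex.coe_algebraMap, ← Complex.ofReal_pow, Complex.ofReal_re]
    positivity
  have hpos' : (formResolvent J).IsPositive :=
    ⟨fun f g => formResolvent_isSymm J f g, fun f => hpos f⟩
  intro z hz
  by_contra hcon
  refine hz (mem_opResolventSet_of_isUnit hT ?_)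
  rcases eq_or_ne (z + 1) 0 with h0 | h0
  · rw [h0]; simp
  have key : (z + 1)⁻¹ ∉ spectrum ℂ (formResolvent J) := by
    intro hsp
    have h1 : 0 ≤ (z + 1)⁻¹ := by
      have := (ContinuousLinearMap.nonneg_iff_isPositive _).2 hpos'
      exact spectrum_nonneg_of_nonneg this hsp
    have h2 : ‖(z + 1)⁻¹‖ ≤ (m + 1)⁻¹ := by
      refine (spectrum.norm_le_norm_mul_of_mem hsp).trans ?_
      have b1 : ‖formResolvent J‖ ≤ (m + 1)⁻¹ := by
        refine ContinuousLinearMap.opNorm_le_bound _ (by positivity) fun f => ?_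
        rw [inv_mul_eq_div, le_div_iff₀ (by positivity), mul_comm]
        exact hRn f
      have b2 : ‖(1 : E →L[ℂ] E)‖ ≤ 1 := ContinuousLinearMap.norm_id_le
      nlinarith [norm_nonneg (formResolvent J)]
    obtain ⟨t, ht⟩ : ∃ t : ℝ, (z + 1)⁻¹ = t := by
      rw [Complex.nonneg_iff] at h1
      exact ⟨((z + 1)⁻¹).re, Complex.ext rfl (by simp [← h1.2])⟩
    have ht0 : 0 ≤ t := by rw [ht] at h1; exact_mod_cast h1
    have htp : 0 < t := lt_of_le_of_ne ht0 fun h => by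
      rw [← h, Complex.ofReal_zero, inv_eq_zero] at ht
      exact h0 ht
    rw [ht, Complex.norm_real, Real.norm_of_nonneg ht0] at h2
    refine hcon ⟨t⁻¹ - 1, ?_, ?_⟩
    · have : m + 1 ≤ t⁻¹ := by
        rw [le_inv_comm₀ (by positivity) htp]; exact h2
      simp only [mem_Ici]; linarith
    · have : z + 1 = (t : ℂ)⁻¹ := by rw [← ht, inv_inv]
      push_cast
      rw [← this]; ring
  have h3 := spectrum.notMem_iff.1 key
  have e : (1 - (z + 1) • formResolvent J : E →L[ℂ] E)
      = algebraMap ℂ (E →L[ℂ] E) (z + 1) *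
        (algebraMap ℂ (E →L[ℂ] E) (z + 1)⁻¹ - formResolvent J) := by
    rw [mul_sub, ← map_mul, mul_inv_cancel₀ h0, map_one, Algebra.smul_def]
  rw [e]
  exact ((IsUnit.mk0 _ h0).map (algebraMap ℂ (E →L[ℂ] E))).mul h3

theorem re_inner_apply_nonneg {J : V →L[ℂ] E} {S : V →L[ℂ] F}
    (hT : ∀ p, p ∈ T.graph ↔ ∃ v, J v = p.1 ∧ ∀ u, inner ℂ (S u) (S v) = inner ℂ (J u) p.2)
    (u : T.domain) : 0 ≤ (inner ℂ (u : E) (T u)).re := by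
  obtain ⟨v, h1, h2⟩ := (hT (u, T u)).1 (LinearPMap.mem_graph T u)
  simp only at h1 h2
  rw [← h1, ← h2 v, inner_self_eq_norm_sq_to_K]
  simp only [Complex.coe_algebraMap, ← Complex.ofReal_pow, Complex.ofReal_re]
  positivity

/-- Weyl's criterion in the form sense. -/
theorem mem_opSpectrum_of_approx {J : V →L[ℂ] E} {S : V →L[ℂ] F}
    (hV : ∀ u v, inner ℂ u v = inner ℂ (J u) (J v) + inner ℂ (S u) (S v))
    (hT : ∀ p, p ∈ T.graph ↔ ∃ v, J v = p.1 ∧ ∀ u, inner ℂ (S u) (S v) = inner ℂ (J u) p.2)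
    {μ : ℝ} (hμ : ∀ ε : ℝ, 0 < ε → ∃ v, ‖J v‖ = 1 ∧
      ∀ w, ‖inner ℂ (S w) (S v) - (μ : ℂ) * inner ℂ (J w) (J v)‖ ≤ ε * ‖w‖) :
    (μ : ℂ) ∈ opSpectrum T := by
  rintro ⟨R, hR, -⟩
  have hnorm : ∀ u, ‖u‖ ^ 2 = ‖J u‖ ^ 2 + ‖S u‖ ^ 2 := fun u => by
    have := congrArg Complex.re (hV u u)
    simpa [← Complex.ofReal_pow] using this
  -- `C` will bound `‖w‖²`, where `J w` is the solution of `(T - μ) J w = J v`. Testing the equation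
  -- for `w` with `v` makes the approximate eigenvalue expression equal to `1`, which must be at
  -- most `‖w‖ / (C + 2)`; this is incompatible with `‖w‖² ≤ C`.
  set C : ℝ := (1 + |μ|) * ‖R‖ ^ 2 + ‖R‖ with hC
  have hC0 : 0 ≤ C := by positivity
  obtain ⟨v, hv1, hv2⟩ := hμ (1 / (C + 2)) (by positivity)
  obtain ⟨h, hf⟩ := hR (J v)
  obtain ⟨w, hw1, hw2⟩ := (hT (R (J v), T ⟨R (J v), h⟩)).1 (LinearPMap.mem_graph T ⟨_, h⟩)
  simp only at hw1 hw2
  have hTw : T ⟨R (J v), h⟩ = J v + (μ : ℂ) • J w := by rw [hw1]; exact sub_eq_iff_eq_add.1 hf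
  have hJw : ‖J w‖ ≤ ‖R‖ := by
    rw [hw1]; simpa [hv1] using R.le_opNorm (J v)
  have e1 : inner ℂ (S w) (S v) - (μ : ℂ) * inner ℂ (J w) (J v) = 1 := by
    have h3 := hw2 v
    rw [hTw, inner_add_right, inner_smul_right, inner_self_eq_norm_sq_to_K, hv1] at h3
    have h4 := congrArg (starRingEnd ℂ) h3
    simp only [map_add, map_mul, inner_conj_symm, Complex.conj_ofReal] at h4
    rw [h4]; simp
  have e2 : ‖S w‖ ^ 2 ≤ |μ| * ‖J w‖ ^ 2 + ‖J w‖ := by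
    have h3 := congrArg Complex.re (hw2 w)
    rw [hTw, inner_add_right, inner_smul_right, inner_self_eq_norm_sq_to_K,
      inner_self_eq_norm_sq_to_K] at h3
    simp only [Complex.coe_algebraMap, ← Complex.ofReal_pow, ← Complex.ofReal_mul, Complex.add_re,
      Complex.ofReal_re] at h3
    have h5 := (Complex.re_le_norm _).trans (norm_inner_le_norm (𝕜 := ℂ) (J w) (J v))
    rw [hv1, mul_one] at h5
    nlinarith [le_abs_self μ, sq_nonneg ‖J w‖]
  have e3 : ‖w‖ ^ 2 ≤ C := by
    rw [hnorm]
    have : ‖J w‖ ^ 2 ≤ ‖R‖ ^ 2 := by gcongr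
    nlinarith [abs_nonneg μ]
  have e4 := hv2 w
  rw [e1, norm_one, one_div, inv_mul_eq_div, le_div_iff₀ (by positivity)] at e4
  nlinarith

theorem norm_sq_eq_of_inner_eq {J : V →L[ℂ] E} {S : V →L[ℂ] F}
    (hV : ∀ u v, inner ℂ u v = inner ℂ (J u) (J v) + inner ℂ (S u) (S v)) (u : V) :
    ‖u‖ ^ 2 = ‖J u‖ ^ 2 + ‖S u‖ ^ 2 := by
  have := congrArg Complex.re (hV u u)
  simpa [← Complex.ofReal_pow] using this

/-- An operator that is small up to operators of finite rank maps balls to totally bounded sets. -/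
theorem totallyBounded_image_closedBall {J : V →L[ℂ] E}
    (hJ : ∀ ε : ℝ, 0 < ε → ∃ (n : ℕ) (L : E →L[ℂ] EuclideanSpace ℂ (Fin n)),
      ∀ v, ‖J v‖ ^ 2 ≤ ε * ‖v‖ ^ 2 + ‖L (J v)‖ ^ 2) (r : ℝ) :
    TotallyBounded (J '' Metric.closedBall 0 r) := by
  rw [Metric.totallyBounded_iff]
  intro ε hε
  -- Two points of the ball are at distance at most `2 r`, so with this parameter the first term
  -- contributes at most `ε² / 2`. The finite-dimensional image has a finite `ε / 2`-net, which
  -- contributes less than `ε² / 4`.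
  obtain ⟨n, L, hL⟩ := hJ (ε ^ 2 / (8 * (r ^ 2 + 1))) (by positivity)
  have hb : Bornology.IsBounded ((L ∘L J) '' Metric.closedBall 0 r) :=
    (L ∘L J).lipschitz.isBounded_image Metric.isBounded_closedBall
  have htb : TotallyBounded ((L ∘L J) '' Metric.closedBall 0 r) :=
    (hb.isCompact_closure.totallyBounded).subset subset_closure
  obtain ⟨t, hts, htf, htc⟩ := Metric.finite_approx_of_totallyBounded htb (ε / 2) (half_pos hε)
  have hts' : ∀ y ∈ t, ∃ v ∈ Metric.closedBall (0 : V) r, (L ∘L J) v = y := fun y hy => hts hy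
  choose! g hg using hts'
  refine ⟨(J ∘ g) '' t, htf.image _, ?_⟩
  rintro _ ⟨v, hv, rfl⟩
  obtain ⟨y, hy, hvy⟩ := mem_iUnion₂.1 (htc ⟨v, hv, rfl⟩)
  refine mem_iUnion₂.2 ⟨J (g y), ⟨y, hy, rfl⟩, ?_⟩
  have h1 := hg _ hy
  rw [Metric.mem_ball, ← h1.2, dist_eq_norm, ← map_sub] at hvy
  rw [Metric.mem_ball, dist_eq_norm, ← map_sub]
  have h2 : ‖v - g y‖ ≤ 2 * r := by
    have a := mem_closedBall_zero_iff.1 hv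
    have b := mem_closedBall_zero_iff.1 h1.1
    linarith [norm_sub_le v (g y)]
  have h3 := hL (v - g y)
  have h4 : ‖L (J (v - g y))‖ ^ 2 < (ε / 2) ^ 2 := by
    have : ‖L (J (v - g y))‖ < ε / 2 := hvy
    gcongr
  have h5 : ε ^ 2 / (8 * (r ^ 2 + 1)) * ‖v - g y‖ ^ 2 ≤ ε ^ 2 / 2 := by
    have : ‖v - g y‖ ^ 2 ≤ (2 * r) ^ 2 := by gcongr
    rw [div_mul_eq_mul_div, div_le_div_iff₀ (by positivity) (by positivity)]
    nlinarith [sq_nonneg ε, mul_le_mul_of_nonneg_left this (sq_nonneg ε)]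
  refine lt_of_pow_lt_pow_left₀ 2 hε.le ?_
  nlinarith [sq_pos_of_pos hε]

/-- First-variation argument: along `t = s * conj b` with `s` small and negative, the linear term
dominates the quadratic one unless `b = 0`. -/
theorem inner_eq_zero_of_nonneg_quadratic {a : ℝ} {b : ℂ}
    (h : ∀ t : ℂ, 0 ≤ 2 * (t * b).re + a * ‖t‖ ^ 2) : b = 0 := by
  by_contra hb
  have hb' : 0 < ‖b‖ ^ 2 := by positivity
  have key : ∀ s : ℝ, 0 ≤ 2 * s * ‖b‖ ^ 2 + a * s ^ 2 * ‖b‖ ^ 2 := fun s => by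
    have := h (s * starRingEnd ℂ b)
    rw [mul_assoc, mul_comm (starRingEnd ℂ b), Complex.mul_conj, norm_mul, RCLike.norm_conj,
      Complex.norm_real, mul_pow, Real.norm_eq_abs, sq_abs, Complex.normSq_eq_norm_sq,
      ← Complex.ofReal_mul, Complex.ofReal_re] at this
    linarith
  have h1 := key (-1 / (|a| + 1))
  have h2 : 2 * (-1 / (|a| + 1)) + a * (-1 / (|a| + 1)) ^ 2 < 0 := by
    have : 2 * (-1 / (|a| + 1)) + a * (-1 / (|a| + 1)) ^ 2
        = (-2 * (|a| + 1) + a) / (|a| + 1) ^ 2 := by field_simp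
    rw [this]
    refine div_neg_of_neg_of_pos ?_ (by positivity)
    linarith [le_abs_self a, abs_nonneg a]
  nlinarith

/-- If the form domain is compactly embedded, the Rayleigh quotient attains its infimum, and the
minimizer is an eigenvector. -/
theorem exists_form_minimizer {J : V →L[ℂ] E} {S : V →L[ℂ] F}
    (hV : ∀ u v, inner ℂ u v = inner ℂ (J u) (J v) + inner ℂ (S u) (S v))
    (hne : ∃ v, J v ≠ 0)
    (hJ : ∀ ε : ℝ, 0 < ε → ∃ (n : ℕ) (L : E →L[ℂ] EuclideanSpace ℂ (Fin n)),
      ∀ v, ‖J v‖ ^ 2 ≤ ε * ‖v‖ ^ 2 + ‖L (J v)‖ ^ 2) :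
    ∃ v, ‖J v‖ = 1 ∧ (∀ u, ‖S v‖ * ‖J u‖ ≤ ‖S u‖) ∧
      ∀ u, inner ℂ (S u) (S v) = ((‖S v‖ ^ 2 : ℝ) : ℂ) * inner ℂ (J u) (J v) := by
  have hnorm := norm_sq_eq_of_inner_eq hV
  set A : Set ℝ := (fun v => ‖S v‖ ^ 2) '' {v | ‖J v‖ = 1} with hA
  have hscale : ∀ v, J v ≠ 0 → ∃ w, ‖J w‖ = 1 ∧ ‖S w‖ * ‖J v‖ = ‖S v‖ := fun v hv => by
    have hv' : ‖J v‖ ≠ 0 := norm_ne_zero_iff.2 hv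
    refine ⟨((‖J v‖⁻¹ : ℝ) : ℂ) • v, ?_, ?_⟩
    · rw [map_smul, norm_smul, Complex.norm_real, norm_inv, norm_norm, inv_mul_cancel₀ hv']
    · rw [map_smul, norm_smul, Complex.norm_real, norm_inv, norm_norm]
      field_simp
  have hAne : A.Nonempty := by
    obtain ⟨v, hv⟩ := hne
    obtain ⟨w, hw, -⟩ := hscale v hv
    exact ⟨_, w, hw, rfl⟩
  have hAb : BddBelow A := ⟨0, by rintro _ ⟨v, -, rfl⟩; positivity⟩
  set m : ℝ := sInf A with hm
  have hm0 : 0 ≤ m := le_csInf hAne (by rintro _ ⟨v, -, rfl⟩; positivity)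
  have hmle : ∀ v, m * ‖J v‖ ^ 2 ≤ ‖S v‖ ^ 2 := fun v => by
    by_cases hv : J v = 0
    · rw [hv]; simp
    · obtain ⟨w, hw, hw2⟩ := hscale v hv
      have : m ≤ ‖S w‖ ^ 2 := csInf_le hAb ⟨w, hw, rfl⟩
      rw [← hw2, mul_pow]
      gcongr
  have hseq : ∀ n : ℕ, ∃ v, ‖J v‖ = 1 ∧ ‖S v‖ ^ 2 < m + 1 / ((n : ℝ) + 1) := fun n => by
    obtain ⟨_, ⟨v, hv, rfl⟩, hlt⟩ := exists_lt_of_csInf_lt hAne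
      (show sInf A < m + 1 / ((n : ℝ) + 1) by
        have : 0 < 1 / ((n : ℝ) + 1) := by positivity
        linarith)
    exact ⟨v, hv, hlt⟩
  choose v hv1 hv2 using hseq
  have hbd : ∀ n, v n ∈ Metric.closedBall (0 : V) (m + 2) := fun n => by
    rw [mem_closedBall_zero_iff]
    have h1 := hnorm (v n)
    have h2 := hv2 n
    have h3 : 1 / ((n : ℝ) + 1) ≤ 1 := by
      rw [div_le_one (by positivity)]; linarith [Nat.cast_nonneg (α := ℝ) n]
    rw [hv1] at h1
    nlinarith [norm_nonneg (v n)]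
  have hcomp : IsCompact (closure (J '' Metric.closedBall 0 (m + 2))) :=
    (totallyBounded_image_closedBall hJ _).closure.isCompact_of_isClosed isClosed_closure
  obtain ⟨g, -, φ, hφ, hlim⟩ :=
    hcomp.tendsto_subseq (fun n => subset_closure (mem_image_of_mem J (hbd n)))
  have hJc : CauchySeq (fun n => J (v (φ n))) := hlim.cauchySeq
  -- The parallelogram law for `S` and for `J`, with `‖S (vᵢ + vⱼ)‖² ≥ m ‖J (vᵢ + vⱼ)‖²`, shows that
  -- a minimising sequence which is Cauchy after `J` is already Cauchy in the form norm. Compactness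
  -- is therefore needed only in `E`.
  have hpar : ∀ i j, ‖v i - v j‖ ^ 2 ≤ 2 * (1 / ((i : ℝ) + 1)) + 2 * (1 / ((j : ℝ) + 1))
      + (1 + m) * ‖J (v i) - J (v j)‖ ^ 2 := fun i j => by
    have p1 := parallelogram_law_with_norm ℂ (S (v i)) (S (v j))
    have p2 := parallelogram_law_with_norm ℂ (J (v i)) (J (v j))
    have p3 := hmle (v i + v j)
    rw [hnorm (v i - v j)]
    simp only [map_add, map_sub, hv1] at *
    nlinarith [hv2 i, hv2 j]
  have htend : Tendsto (fun n : ℕ => 1 / ((φ n : ℝ) + 1)) atTop (𝓝 0) :=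
    tendsto_one_div_add_atTop_nhds_zero_nat.comp hφ.tendsto_atTop
  have hVc : CauchySeq (fun n => v (φ n)) := by
    rw [Metric.cauchySeq_iff]
    intro ε hε
    obtain ⟨N1, hN1⟩ := (Metric.tendsto_atTop.1 htend) (ε ^ 2 / 8) (by positivity)
    obtain ⟨N2, hN2⟩ := (Metric.cauchySeq_iff.1 hJc) (ε / (2 * (1 + m))) (by positivity)
    refine ⟨max N1 N2, fun i hi j hj => ?_⟩
    have a1 := hN1 i (le_trans (le_max_left _ _) hi)
    have a2 := hN1 j (le_trans (le_max_left _ _) hj)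
    have a3 := hN2 i (le_trans (le_max_right _ _) hi) j (le_trans (le_max_right _ _) hj)
    have a4 := hpar (φ i) (φ j)
    rw [Real.dist_eq, sub_zero, abs_of_pos (by positivity)] at a1 a2
    rw [dist_eq_norm] at a3 ⊢
    have a5 : (1 + m) * ‖J (v (φ i)) - J (v (φ j))‖ ^ 2 ≤ ε ^ 2 / 4 := by
      have : ‖J (v (φ i)) - J (v (φ j))‖ ^ 2 ≤ (ε / (2 * (1 + m))) ^ 2 := by gcongr
      calc (1 + m) * ‖J (v (φ i)) - J (v (φ j))‖ ^ 2
          ≤ (1 + m) * (ε / (2 * (1 + m))) ^ 2 := by gcongr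
        _ = ε ^ 2 / 4 / (1 + m) := by field_simp; ring
        _ ≤ ε ^ 2 / 4 := div_le_self (by positivity) (by linarith)
    refine lt_of_pow_lt_pow_left₀ 2 hε.le ?_
    nlinarith [sq_pos_of_pos hε]
  obtain ⟨w, hw⟩ := cauchySeq_tendsto_of_complete hVc
  have hJw : ‖J w‖ = 1 := by
    have : Tendsto (fun n => ‖J (v (φ n))‖) atTop (𝓝 ‖J w‖) :=
      ((J.continuous.tendsto w).comp hw).norm
    exact tendsto_nhds_unique this (by simp [hv1])
  have hSw : ‖S w‖ ^ 2 = m := by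
    refine le_antisymm ?_ (by simpa [hJw] using hmle w)
    have t1 : Tendsto (fun n => ‖S (v (φ n))‖ ^ 2) atTop (𝓝 (‖S w‖ ^ 2)) :=
      (((S.continuous.tendsto w).comp hw).norm).pow 2
    have t2 : Tendsto (fun n : ℕ => m + 1 / ((φ n : ℝ) + 1)) atTop (𝓝 (m + 0)) :=
      tendsto_const_nhds.add htend
    rw [add_zero] at t2
    exact le_of_tendsto_of_tendsto' t1 t2 fun n => (hv2 (φ n)).le
  refine ⟨w, hJw, fun u => ?_, fun u => ?_⟩
  · refine le_of_sq_le_sq ?_ (norm_nonneg _)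
    rw [mul_pow, hSw]
    exact hmle u
  -- The quadratic functional `‖S·‖² - m ‖J·‖²` is nonnegative and vanishes at `w`, so its first
  -- variation there is zero. The perturbation carries `conj t` because the scalar product is
  -- antilinear in the first argument.
  · rw [← sub_eq_zero, hSw]
    refine inner_eq_zero_of_nonneg_quadratic (a := ‖S u‖ ^ 2 - m * ‖J u‖ ^ 2) fun t => ?_
    have h1 := hmle (w + starRingEnd ℂ t • u)
    rw [map_add, map_add, map_smul, map_smul, add_comm (S w), add_comm (J w),
      @norm_add_sq ℂ, @norm_add_sq ℂ, hSw, hJw, inner_smul_left, inner_smul_left, norm_smul,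
      norm_smul, Complex.conj_conj, RCLike.norm_conj] at h1
    have h2 : (t * (inner ℂ (S u) (S w) - (m : ℂ) * inner ℂ (J u) (J w))).re
        = (t * inner ℂ (S u) (S w)).re - m * (t * inner ℂ (J u) (J w)).re := by
      rw [mul_sub, Complex.sub_re, mul_left_comm, Complex.re_ofReal_mul]
    rw [h2]
    simp only [RCLike.re_eq_complex_re] at h1
    nlinarith

end AbstractForm

/-! ### Forms on a Banach space whose norm is only equivalent to the form norm. -/

section FormOnBanachSpace

variable {V E F : Type*} [NormedAddCommGroup V] [NormedSpace ℂ V] [CompleteSpace V]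
  [NormedAddCommGroup E] [InnerProductSpace ℂ E] [CompleteSpace E]
  [NormedAddCommGroup F] [InnerProductSpace ℂ F]

/-- A complete space on which `‖Jv‖ + ‖Sv‖` is an equivalent norm can be replaced by the Hilbert
space with the scalar product `(Ju, Jv) + (Su, Sv)`. -/
theorem exists_hilbert_form_space [CompleteSpace F] (J : V →L[ℂ] E) (S : V →L[ℂ] F) {C : ℝ}
    (hC : ∀ v, ‖v‖ ≤ C * (‖J v‖ + ‖S v‖)) :
    ∃ (W : Submodule ℂ (WithLp 2 (E × F))) (_ : CompleteSpace W) (J' : W →L[ℂ] E)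
      (S' : W →L[ℂ] F),
      (∀ u v : W, inner ℂ u v = inner ℂ (J' u) (J' v) + inner ℂ (S' u) (S' v)) ∧
      (∀ v : V, ∃ w : W, J' w = J v ∧ S' w = S v) ∧ ∀ w : W, ∃ v : V, J' w = J v ∧ S' w = S v := by
  set A : V →L[ℂ] WithLp 2 (E × F) :=
    (WithLp.prodContinuousLinearEquiv 2 ℂ E F).symm.toContinuousLinearMap ∘L (J.prod S) with hA
  have hA1 : ∀ v, (A v).fst = J v := fun v => rfl
  have hA2 : ∀ v, (A v).snd = S v := fun v => rfl
  -- The equivalence of norms makes `v ↦ (Jv, Sv)` bounded below, so its range is closed; this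
  -- range, as a subspace of the Hilbert sum, is the required space.
  have hanti : AntilipschitzWith (2 * C.toNNReal) A := by
    refine A.antilipschitz_of_bound fun v => ?_
    have h1 := hC v
    have h2 : ‖J v‖ ^ 2 + ‖S v‖ ^ 2 = ‖A v‖ ^ 2 := by
      rw [WithLp.prod_norm_sq_eq_of_L2, hA1, hA2]
    have h3 : ‖J v‖ ≤ ‖A v‖ :=
      le_of_sq_le_sq (by nlinarith [sq_nonneg ‖S v‖]) (norm_nonneg _)
    have h4 : ‖S v‖ ≤ ‖A v‖ :=
      le_of_sq_le_sq (by nlinarith [sq_nonneg ‖J v‖]) (norm_nonneg _)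
    have h5 : C ≤ (C.toNNReal : ℝ) := Real.le_coe_toNNReal C
    push_cast
    calc ‖v‖ ≤ C * (‖J v‖ + ‖S v‖) := h1
      _ ≤ (C.toNNReal : ℝ) * (‖J v‖ + ‖S v‖) := by gcongr
      _ ≤ (C.toNNReal : ℝ) * (‖A v‖ + ‖A v‖) := by gcongr
      _ = 2 * (C.toNNReal : ℝ) * ‖A v‖ := by ring
  have hcl : IsClosed (LinearMap.range A.toLinearMap : Set (WithLp 2 (E × F))) := by
    have := hanti.isClosed_range A.uniformContinuous
    simpa [LinearMap.coe_range] using this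
  refine ⟨LinearMap.range A.toLinearMap, hcl.completeSpace_coe,
    (ContinuousLinearMap.fst ℂ E F ∘L
      (WithLp.prodContinuousLinearEquiv 2 ℂ E F).toContinuousLinearMap) ∘L Submodule.subtypeL _,
    (ContinuousLinearMap.snd ℂ E F ∘L
      (WithLp.prodContinuousLinearEquiv 2 ℂ E F).toContinuousLinearMap) ∘L Submodule.subtypeL _,
    fun u v => ?_, fun v => ⟨⟨A v, v, rfl⟩, rfl, rfl⟩, ?_⟩
  · rw [Submodule.coe_inner, WithLp.prod_inner_apply]
    rfl
  · rintro ⟨_, v, rfl⟩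
    exact ⟨v, rfl, rfl⟩

/-- Basic properties of the operator associated with a closed form `(Su, Sv)`. -/
theorem form_operator_spectrum [CompleteSpace F] (J : V →L[ℂ] E) (S : V →L[ℂ] F) {C : ℝ}
    (hC : ∀ v, ‖v‖ ≤ C * (‖J v‖ + ‖S v‖)) (hJ : DenseRange J) {T : E →ₗ.[ℂ] E}
    (hT : ∀ p, p ∈ T.graph ↔ ∃ v, J v = p.1 ∧ ∀ u, inner ℂ (S u) (S v) = inner ℂ (J u) p.2) :
    IsSelfAdjoint T ∧ (∀ u : T.domain, 0 ≤ (inner ℂ (u : E) (T u)).re) ∧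
    (∀ m : ℝ, 0 ≤ m → (∀ u, m * ‖J u‖ ^ 2 ≤ ‖S u‖ ^ 2) →
      opSpectrum T ⊆ (fun t : ℝ => (t : ℂ)) '' Ici m) ∧
    ∀ μ : ℝ, (∀ ε : ℝ, 0 < ε → ∃ v, ‖J v‖ = 1 ∧
      ∀ w, ‖inner ℂ (S w) (S v) - (μ : ℂ) * inner ℂ (J w) (J v)‖ ≤ ε * (‖J w‖ + ‖S w‖)) →
      (μ : ℂ) ∈ opSpectrum T := by
  obtain ⟨W, hW, J', S', h1, h2, h3⟩ := exists_hilbert_form_space J S hC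
  have hT' : ∀ p, p ∈ T.graph ↔
      ∃ v, J' v = p.1 ∧ ∀ u, inner ℂ (S' u) (S' v) = inner ℂ (J' u) p.2 := fun p => by
    rw [hT]
    constructor
    · rintro ⟨v, e1, e2⟩
      obtain ⟨w, k1, k2⟩ := h2 v
      refine ⟨w, k1.trans e1, fun u => ?_⟩
      obtain ⟨u', l1, l2⟩ := h3 u
      rw [l1, l2, k2, e2]
    · rintro ⟨v, e1, e2⟩
      obtain ⟨w, k1, k2⟩ := h3 v
      refine ⟨w, k1.symm.trans e1, fun u => ?_⟩
      obtain ⟨u', l1, l2⟩ := h2 u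
      rw [← l1, ← l2, ← k2, e2]
  have hJ' : DenseRange J' := by
    have : range J ⊆ range J' := by
      rintro _ ⟨v, rfl⟩
      obtain ⟨w, k1, -⟩ := h2 v
      exact ⟨w, k1⟩
    exact Dense.mono this hJ
  have hgr := mem_graph_iff_formResolvent h1 hT'
  refine ⟨isSelfAdjoint_of_graph_iff (formResolvent_isSymm J') (formResolvent_injective hJ') hgr,
    re_inner_apply_nonneg hT', fun m hm hS =>
      opSpectrum_subset_of_form_lower_bound h1 hgr hm fun w => ?_, fun μ hμ => ?_⟩
  · obtain ⟨v, k1, k2⟩ := h3 w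
    rw [k1, k2]
    exact hS v
  · refine mem_opSpectrum_of_approx h1 hT' fun ε hε => ?_
    -- Half of `ε`, since `‖J' x‖ + ‖S' x‖ ≤ 2 ‖x‖`.
    obtain ⟨v, hv, hv'⟩ := hμ (ε / 2) (half_pos hε)
    obtain ⟨w, k1, k2⟩ := h2 v
    refine ⟨w, by rw [k1, hv], fun x => ?_⟩
    obtain ⟨y, l1, l2⟩ := h3 x
    have n1 := norm_sq_eq_of_inner_eq h1 x
    have n2 : ‖J' x‖ ≤ ‖x‖ :=
      le_of_sq_le_sq (by nlinarith [sq_nonneg ‖S' x‖]) (norm_nonneg _)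
    have n3 : ‖S' x‖ ≤ ‖x‖ :=
      le_of_sq_le_sq (by nlinarith [sq_nonneg ‖J' x‖]) (norm_nonneg _)
    have n4 := hv' y
    rw [← l1, ← l2, ← k1, ← k2] at n4
    refine n4.trans ?_
    nlinarith

theorem exists_form_minimizer_of_compact [CompleteSpace F] (J : V →L[ℂ] E) (S : V →L[ℂ] F) {C : ℝ}
    (hC : ∀ v, ‖v‖ ≤ C * (‖J v‖ + ‖S v‖)) (hne : ∃ v, J v ≠ 0)
    (hJ : ∀ ε : ℝ, 0 < ε → ∃ (n : ℕ) (L : E →L[ℂ] EuclideanSpace ℂ (Fin n)),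
      ∀ v, ‖J v‖ ^ 2 ≤ ε * (‖J v‖ ^ 2 + ‖S v‖ ^ 2) + ‖L (J v)‖ ^ 2) :
    ∃ v, ‖J v‖ = 1 ∧ (∀ u, ‖S v‖ * ‖J u‖ ≤ ‖S u‖) ∧
      ∀ u, inner ℂ (S u) (S v) = ((‖S v‖ ^ 2 : ℝ) : ℂ) * inner ℂ (J u) (J v) := by
  obtain ⟨W, hW, J', S', h1, h2, h3⟩ := exists_hilbert_form_space J S hC
  obtain ⟨w, k1, k2, k3⟩ := exists_form_minimizer h1
    (by
      obtain ⟨v, hv⟩ := hne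
      obtain ⟨w, k1, -⟩ := h2 v
      exact ⟨w, by rwa [k1]⟩)
    (fun ε hε => by
      obtain ⟨n, L, hL⟩ := hJ ε hε
      refine ⟨n, L, fun w => ?_⟩
      obtain ⟨v, k1, k2⟩ := h3 w
      rw [norm_sq_eq_of_inner_eq h1, k1, k2]
      exact hL v)
  obtain ⟨v, l1, l2⟩ := h3 w
  rw [l1] at k1
  refine ⟨v, k1, fun u => ?_, fun u => ?_⟩
  · obtain ⟨x, m1, m2⟩ := h2 u
    rw [← m1, ← m2, ← l2]; exact k2 x
  · obtain ⟨x, m1, m2⟩ := h2 u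
    rw [← m1, ← m2, ← l2, ← l1]; exact k3 x

end FormOnBanachSpace

/-! ### Test functions and the closed graph of the weak gradient -/

section Sobolev

variable {d : ℕ}

/-- `φ ∈ C_c^∞(ℝᵈ)`, with complex values, vanishing near `Γ`. -/
structure IsTest (Γ : Set (Euc d)) (φ : Euc d → ℂ) : Prop where
  contDiff : ContDiff ℝ ∞ φ
  hasCompactSupport : HasCompactSupport φ
  disjoint : Disjoint (tsupport φ) Γ

/-- The class of `f` in `L²(Ω)` (zero if `f` is not square integrable). -/
def restrL2 (Ω : Opens (Euc d)) (f : Euc d → ℂ) : L2 Ω :=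
  open Classical in
  if h : MemLp f 2 (volume.restrict (Ω : Set (Euc d))) then h.toLp f else 0

theorem coeFn_restrL2 {Ω : Opens (Euc d)} {f : Euc d → ℂ}
    (h : MemLp f 2 (volume.restrict (Ω : Set (Euc d)))) :
    restrL2 Ω f =ᵐ[volume.restrict (Ω : Set (Euc d))] f := by
  rw [restrL2, dif_pos h]
  exact h.coeFn_toLp

theorem memLp_test (Ω : Opens (Euc d)) {f : Euc d → ℂ} (h : Continuous f)
    (hc : HasCompactSupport f) : MemLp f 2 (volume.restrict (Ω : Set (Euc d))) :=
  h.memLp_of_hasCompactSupport hc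

theorem norm_restrL2_sub_le_iff {Ω : Opens (Euc d)} {f : Euc d → ℂ}
    (h : MemLp f 2 (volume.restrict (Ω : Set (Euc d)))) (u : L2 Ω) {ε : ℝ} (hε : 0 ≤ ε) :
    eLpNorm (fun x => f x - u x) 2 (volume.restrict (Ω : Set (Euc d))) ≤ ENNReal.ofReal ε ↔
      ‖restrL2 Ω f - u‖ ≤ ε := by
  have e : eLpNorm (fun x => f x - u x) 2 (volume.restrict (Ω : Set (Euc d)))
      = eLpNorm (restrL2 Ω f - u : L2 Ω) 2 (volume.restrict (Ω : Set (Euc d))) := by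
    refine eLpNorm_congr_ae ?_
    filter_upwards [Lp.coeFn_sub (restrL2 Ω f) u, coeFn_restrL2 h] with x h1 h2
    rw [h1, Pi.sub_apply, h2]
  rw [e, Lp.norm_def, ENNReal.le_ofReal_iff_toReal_le (Lp.eLpNorm_ne_top _) hε]

/-- Integration by parts on all of `ℝᵈ`. The function `φ` need not vanish on the boundary of `Ω`,
because the function it is tested against is supported inside `Ω`. -/
theorem isWeakPartial_restrL2 (Ω : Opens (Euc d)) (i : Fin d) {φ : Euc d → ℂ}
    (h : ContDiff ℝ ∞ φ) (hc : HasCompactSupport φ) :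
    IsWeakPartial i (restrL2 Ω φ) (restrL2 Ω (pderiv i φ)) := by
  intro ψ k1 k2 k3
  have aux : ∀ (η : Euc d → ℝ), tsupport η ⊆ Ω → ∀ (f : Euc d → ℂ), Continuous f →
      HasCompactSupport f → ∫ x in (Ω : Set (Euc d)), η x • restrL2 Ω f x
        = ∫ x, η x • f x := by
    intro η hη f hf hfc
    have e : ∫ x in (Ω : Set (Euc d)), η x • f x = ∫ x, η x • f x := by
      refine setIntegral_eq_integral_of_forall_compl_eq_zero fun x hx => ?_
      have : η x = 0 := image_eq_zero_of_notMem_tsupport fun hx' => hx (hη hx')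
      simp [this]
    rw [← e]
    refine integral_congr_ae ?_
    filter_upwards [coeFn_restrL2 (memLp_test Ω hf hfc)] with x hx
    rw [hx]
  have int : ∀ {a : Euc d → ℝ} {b : Euc d → ℂ}, Continuous a → Continuous b →
      HasCompactSupport a → Integrable (fun x => a x • b x) volume := fun ha hb hac =>
    (ha.smul hb).integrable_of_hasCompactSupport hac.smul_right
  rw [aux (pderiv i ψ) ((tsupport_fderiv_apply_subset ℝ _).trans k3) _ h.continuous hc,
    aux _ k3 _ (continuous_pderiv i h) (hasCompactSupport_pderiv i hc)]
  have := integral_smul_fderiv_eq_neg_fderiv_smul_of_integrable (𝕜 := ℝ) (μ := volume)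
    (f := ψ) (g := φ) (v := EuclideanSpace.single i 1)
    (int (continuous_pderiv i k1) h.continuous (hasCompactSupport_pderiv i k2))
    (int k1.continuous (continuous_pderiv i h) k2) (int k1.continuous h.continuous k2)
    (fun x _ => k1.differentiable (by simp) x) (fun x _ => h.differentiable (by simp) x)
  change ∫ x, ψ x • pderiv i φ x = -∫ x, pderiv i ψ x • φ x at this
  rw [this, neg_neg]

/-- A function and its weak gradient. -/
def gradMap (Ω : Opens (Euc d)) : H1 Ω →ₗ[ℂ] L2 Ω × (Fin d → L2 Ω) :=
  (H1 Ω).subtype.prod (LinearMap.pi fun i => wpderiv i)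

theorem gradMap_apply {Ω : Opens (Euc d)} (u : H1 Ω) :
    gradMap Ω u = ((u : L2 Ω), fun i => wpderiv i u) := rfl

/-- A test function and its gradient, in `L²(Ω)`. -/
def testGrad (Ω : Opens (Euc d)) (φ : Euc d → ℂ) : L2 Ω × (Fin d → L2 Ω) :=
  (restrL2 Ω φ, fun i => restrL2 Ω (pderiv i φ))

/-- For a fixed test function both sides of the defining identity are scalar products with fixed
elements of `L²(Ω)`, hence continuous in the pair. Thus the weak derivative has a closed graph. -/
theorem IsWeakPartial.of_mem_closure {Ω : Opens (Euc d)} {i : Fin d}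
    {A : Set (L2 Ω × L2 Ω)} (hA : ∀ p ∈ A, IsWeakPartial i p.1 p.2) {p : L2 Ω × L2 Ω}
    (hp : p ∈ closure A) : IsWeakPartial i p.1 p.2 := by
  intro φ h1 h2 h3
  have key : ∀ (ψ : Euc d → ℝ) (hψ : Continuous ψ) (hc : HasCompactSupport ψ) (w : L2 Ω),
      ∫ x in (Ω : Set (Euc d)), ψ x • w x = inner ℂ (testL2 Ω ψ hψ hc) w := by
    intro ψ hψ hc w
    rw [L2.inner_def]
    refine integral_congr_ae ?_
    filter_upwards [MemLp.coeFn_toLp ((hψ.memLp_of_hasCompactSupport (p := 2)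
      (μ := volume.restrict (Ω : Set (Euc d))) hc).ofReal (K := ℂ))] with x hx
    have hx' : testL2 Ω ψ hψ hc x = (ψ x : ℂ) := hx
    rw [hx']
    simp [RCLike.inner_apply, mul_comm]
  rw [key _ (continuous_pderiv i h1) (hasCompactSupport_pderiv i h2), key _ h1.continuous h2]
  have hcl : IsClosed {q : L2 Ω × L2 Ω |
      inner ℂ (testL2 Ω (pderiv i φ) (continuous_pderiv i h1) (hasCompactSupport_pderiv i h2)) q.1
        = -inner ℂ (testL2 Ω φ h1.continuous h2) q.2} :=
    isClosed_eq (by fun_prop) (by fun_prop)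
  refine closure_minimal (fun q hq => ?_) hcl hp
  have := hA q hq φ h1 h2 h3
  rwa [key _ (continuous_pderiv i h1) (hasCompactSupport_pderiv i h2), key _ h1.continuous h2]
    at this

/-- The functions of `H¹₀(Ω, Γ)` with their gradients are the closure of the test functions. -/
theorem mem_closure_testGrad_iff {Ω : Opens (Euc d)} {Γ : Set (Euc d)}
    {U : L2 Ω × (Fin d → L2 Ω)} :
    U ∈ closure (testGrad Ω '' {φ | IsTest Γ φ}) ↔ ∃ u ∈ H10 Ω Γ, gradMap Ω u = U := by
  have hclose : ∀ {φ : Euc d → ℂ}, ContDiff ℝ ∞ φ → HasCompactSupport φ → ∀ (u : H1 Ω) {ε : ℝ},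
      0 ≤ ε → (IsH1Close φ u ε ↔ dist (testGrad Ω φ) (gradMap Ω u) ≤ ε) := by
    intro φ h1 h2 u ε hε
    rw [IsH1Close, norm_restrL2_sub_le_iff (memLp_test Ω h1.continuous h2) _ hε, Prod.dist_eq,
      max_le_iff, dist_pi_le_iff hε]
    refine and_congr (by rw [dist_eq_norm]; rfl) (forall_congr' fun i => ?_)
    rw [norm_restrL2_sub_le_iff (memLp_test Ω (continuous_pderiv i h1)
      (hasCompactSupport_pderiv i h2)) _ hε, dist_eq_norm]
    rfl
  constructor
  · intro hU
    have hw : ∀ i, IsWeakPartial i U.1 (U.2 i) := fun i => by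
      refine IsWeakPartial.of_mem_closure
        (A := (fun p : L2 Ω × (Fin d → L2 Ω) => (p.1, p.2 i)) '' (testGrad Ω '' {φ | IsTest Γ φ}))
        (p := (U.1, U.2 i)) ?_ (image_closure_subset_closure_image (by fun_prop) ⟨U, hU, rfl⟩)
      rintro _ ⟨_, ⟨φ, hφ, rfl⟩, rfl⟩
      exact isWeakPartial_restrL2 Ω i hφ.1 hφ.2
    have hG : gradMap Ω ⟨U.1, fun i => ⟨_, hw i⟩⟩ = U := by
      refine Prod.ext rfl (funext fun i => ?_)
      exact (wpderiv_spec i _).unique (hw i)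
    refine ⟨_, fun ε hε => ?_, hG⟩
    obtain ⟨_, ⟨φ, hφ, rfl⟩, h⟩ := Metric.mem_closure_iff.1 hU ε hε
    refine ⟨φ, hφ.1, hφ.2, hφ.3, (hclose hφ.1 hφ.2 _ hε.le).2 ?_⟩
    rw [hG, dist_comm]
    exact h.le
  · rintro ⟨u, hu, rfl⟩
    refine Metric.mem_closure_iff.2 fun ε hε => ?_
    obtain ⟨φ, h1, h2, h3, h4⟩ := hu (ε / 2) (half_pos hε)
    refine ⟨_, ⟨φ, ⟨h1, h2, h3⟩, rfl⟩, ?_⟩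
    rw [dist_comm]
    exact ((hclose h1 h2 u (half_pos hε).le).1 h4).trans_lt (half_lt_self hε)

/-- The graph of the weak gradient on `H¹₀(Ω, Γ)`. -/
def gradGraph (Ω : Opens (Euc d)) (Γ : Set (Euc d)) : Submodule ℂ (L2 Ω × (Fin d → L2 Ω)) :=
  (H10 Ω Γ).map (gradMap Ω)

theorem coe_gradGraph (Ω : Opens (Euc d)) (Γ : Set (Euc d)) :
    (gradGraph Ω Γ : Set (L2 Ω × (Fin d → L2 Ω)))
      = closure (testGrad Ω '' {φ | IsTest Γ φ}) := by
  ext U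
  rw [mem_closure_testGrad_iff]
  rfl

instance (Ω : Opens (Euc d)) (Γ : Set (Euc d)) : CompleteSpace (gradGraph Ω Γ) := by
  have : IsClosed (gradGraph Ω Γ : Set (L2 Ω × (Fin d → L2 Ω))) := by
    rw [coe_gradGraph]; exact isClosed_closure
  exact this.completeSpace_coe

theorem testGrad_mem_gradGraph {Ω : Opens (Euc d)} {Γ : Set (Euc d)} {φ : Euc d → ℂ}
    (h : IsTest Γ φ) : testGrad Ω φ ∈ gradGraph Ω Γ := by
  rw [← SetLike.mem_coe, coe_gradGraph]
  exact subset_closure ⟨φ, h, rfl⟩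

/-- Closed conditions on a function and its gradient can be checked on test functions. -/
theorem gradGraph_induction {Ω : Opens (Euc d)} {Γ : Set (Euc d)}
    {p : L2 Ω × (Fin d → L2 Ω) → Prop} (hp : IsClosed {U | p U})
    (h : ∀ φ, IsTest Γ φ → p (testGrad Ω φ)) {U : L2 Ω × (Fin d → L2 Ω)}
    (hU : U ∈ gradGraph Ω Γ) : p U := by
  rw [← SetLike.mem_coe, coe_gradGraph] at hU
  refine closure_minimal ?_ hp hU
  rintro _ ⟨φ, hφ, rfl⟩
  exact h φ hφ

/-! ### Multiplication by bounded functions -/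

theorem memLp_mul_of_bounded {Ω : Opens (Euc d)} {a : Euc d → ℂ} (ha : Continuous a) {C : ℝ}
    (hC : ∀ x ∈ Ω, ‖a x‖ ≤ C) (f : L2 Ω) :
    MemLp (fun x => a x * f x) 2 (volume.restrict (Ω : Set (Euc d))) :=
  (Lp.memLp f).of_le_mul (c := C) (ha.aestronglyMeasurable.mul (Lp.aestronglyMeasurable f)) (by
    filter_upwards [ae_restrict_mem Ω.isOpen.measurableSet] with x hx
    rw [norm_mul]
    gcongr
    exact hC x hx)

/-- Multiplication by a bounded function on `L²(Ω)`. -/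
def mulL2 (Ω : Opens (Euc d)) (a : Euc d → ℂ) (ha : Continuous a) (C : ℝ)
    (hC : ∀ x ∈ Ω, ‖a x‖ ≤ C) : L2 Ω →L[ℂ] L2 Ω :=
  have hmem := memLp_mul_of_bounded ha hC
  LinearMap.mkContinuous
    { toFun := fun f => (hmem f).toLp _
      map_add' := fun f g => by
        refine Lp.ext ?_
        filter_upwards [(hmem (f + g)).coeFn_toLp, (hmem f).coeFn_toLp, (hmem g).coeFn_toLp,
          Lp.coeFn_add f g, Lp.coeFn_add ((hmem f).toLp _) ((hmem g).toLp _)] with x h1 h2 h3 h4 h5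
        rw [h1, h5, Pi.add_apply, h2, h3, h4, Pi.add_apply, mul_add]
      map_smul' := fun c f => by
        refine Lp.ext ?_
        filter_upwards [(hmem (c • f)).coeFn_toLp, (hmem f).coeFn_toLp,
          Lp.coeFn_smul c f, Lp.coeFn_smul c ((hmem f).toLp _)] with x h1 h2 h3 h4
        rw [h1, RingHom.id_apply, h4, Pi.smul_apply, h2, h3, Pi.smul_apply, smul_eq_mul,
          smul_eq_mul, mul_left_comm] }
    C fun f => by
      refine Lp.norm_le_mul_norm_of_ae_le_mul ?_
      filter_upwards [(hmem f).coeFn_toLp, ae_restrict_mem Ω.isOpen.measurableSet] with x h1 h2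
      change ‖(hmem f).toLp _ x‖ ≤ _
      rw [h1, norm_mul]
      gcongr
      exact hC x h2

theorem coeFn_mulL2 {Ω : Opens (Euc d)} {a : Euc d → ℂ} (ha : Continuous a) {C : ℝ}
    (hC : ∀ x ∈ Ω, ‖a x‖ ≤ C) (f : L2 Ω) :
    mulL2 Ω a ha C hC f =ᵐ[volume.restrict (Ω : Set (Euc d))] fun x => a x * f x :=
  (memLp_mul_of_bounded ha hC f).coeFn_toLp

end Sobolev

/-! ### Estimates by translations -/

theorem sq_lintegral_le {X : Type*} [MeasurableSpace X] (μ : Measure X) {f : X → ℝ≥0∞}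
    (hf : AEMeasurable f μ) : (∫⁻ x, f x ∂μ) ^ 2 ≤ μ univ * ∫⁻ x, f x ^ 2 ∂μ := by
  have h := ENNReal.lintegral_mul_le_Lp_mul_Lq μ Real.HolderConjugate.two_two hf
    (aemeasurable_const (b := (1 : ℝ≥0∞)))
  simp only [Pi.mul_apply, mul_one, ENNReal.one_rpow, lintegral_const, one_mul] at h
  have h2 : (∫⁻ x, f x ∂μ) ^ 2
      ≤ ((∫⁻ x, f x ^ (2 : ℝ) ∂μ) ^ (1 / (2 : ℝ)) * μ univ ^ (1 / (2 : ℝ))) ^ 2 := by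
    gcongr
  refine h2.trans (le_of_eq ?_)
  rw [mul_pow, ← ENNReal.rpow_natCast, ← ENNReal.rpow_natCast, ← ENNReal.rpow_mul,
    ← ENNReal.rpow_mul]
  norm_num
  rw [mul_comm]

theorem enorm_add_sq_le {F : Type*} [NormedAddCommGroup F] (a b : F) :
    ‖a + b‖ₑ ^ 2 ≤ 2 * ‖a‖ₑ ^ 2 + 2 * ‖b‖ₑ ^ 2 := by
  have h : ‖a + b‖₊ ^ 2 ≤ 2 * ‖a‖₊ ^ 2 + 2 * ‖b‖₊ ^ 2 := by
    rw [← NNReal.coe_le_coe]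
    push_cast
    nlinarith [norm_add_le a b, norm_nonneg (a + b), sq_nonneg (‖a‖ - ‖b‖), norm_nonneg a,
      norm_nonneg b]
  simp only [enorm_eq_nnnorm]
  exact_mod_cast h

variable {d : ℕ}

/-- Fundamental theorem of calculus on the segment from `x` to `x + z`, then Cauchy–Schwarz on the
unit interval. -/
theorem enorm_sub_sq_le_lintegral_fderiv {φ : Euc d → ℂ} (hφ : ContDiff ℝ ∞ φ) (x z : Euc d) :
    ‖φ (x + z) - φ x‖ₑ ^ 2
      ≤ ‖z‖ₑ ^ 2 * ∫⁻ t in Icc (0 : ℝ) 1, ‖fderiv ℝ φ (x + t • z)‖ₑ ^ 2 := by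
  have hc : Continuous fun t : ℝ => fderiv ℝ φ (x + t • z) :=
    (hφ.continuous_fderiv (by simp)).comp (by fun_prop)
  have hd : ∀ t : ℝ, HasDerivAt (fun t : ℝ => φ (x + t • z)) (fderiv ℝ φ (x + t • z) z) t := by
    intro t
    have h1 : HasDerivAt (fun t : ℝ => x + t • z) z t := by
      simpa using ((hasDerivAt_id t).smul_const z).const_add x
    exact ((hφ.differentiable (by simp) _).hasFDerivAt).comp_hasDerivAt t h1
  have h2 : ∫ t in (0 : ℝ)..1, fderiv ℝ φ (x + t • z) z = φ (x + z) - φ x := by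
    rw [intervalIntegral.integral_eq_sub_of_hasDerivAt (fun t _ => hd t)
      ((hc.clm_apply continuous_const).intervalIntegrable _ _)]
    simp
  rw [← h2, intervalIntegral.integral_of_le zero_le_one]
  have hm : Measurable fun t : ℝ => ‖fderiv ℝ φ (x + t • z)‖ₑ := hc.enorm.measurable
  calc ‖∫ t in Ioc (0 : ℝ) 1, fderiv ℝ φ (x + t • z) z‖ₑ ^ 2
      ≤ (∫⁻ t in Ioc (0 : ℝ) 1, ‖fderiv ℝ φ (x + t • z) z‖ₑ) ^ 2 := by
        gcongr; exact enorm_integral_le_lintegral_enorm _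
    _ ≤ (∫⁻ t in Icc (0 : ℝ) 1, ‖fderiv ℝ φ (x + t • z)‖ₑ * ‖z‖ₑ) ^ 2 := by
        gcongr
        · exact Ioc_subset_Icc_self
        · exact ContinuousLinearMap.le_opENorm _ _
    _ = (∫⁻ t in Icc (0 : ℝ) 1, ‖fderiv ℝ φ (x + t • z)‖ₑ) ^ 2 * ‖z‖ₑ ^ 2 := by
        rw [lintegral_mul_const _ hm, mul_pow]
    _ ≤ (volume.restrict (Icc (0 : ℝ) 1) univ
          * ∫⁻ t in Icc (0 : ℝ) 1, ‖fderiv ℝ φ (x + t • z)‖ₑ ^ 2) * ‖z‖ₑ ^ 2 := by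
        gcongr; exact sq_lintegral_le _ hm.aemeasurable
    _ = _ := by
        rw [Measure.restrict_apply_univ, Real.volume_Icc]
        simp [mul_comm]

theorem setLIntegral_comp_add_le {S A : Set (Euc d)} (hS : MeasurableSet S)
    (hA : MeasurableSet A) {z : Euc d} (h : ∀ x ∈ S, x + z ∈ A) (g : Euc d → ℝ≥0∞) :
    ∫⁻ x in S, g (x + z) ≤ ∫⁻ x in A, g x := by
  rw [← lintegral_indicator hS, ← lintegral_indicator hA,
    ← lintegral_add_right_eq_self (A.indicator g) z]
  refine lintegral_mono fun x => ?_
  by_cases hx : x ∈ S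
  · rw [indicator_of_mem hx, indicator_of_mem (h x hx)]
  · rw [indicator_of_notMem hx]; exact zero_le

/-- The `L²` norm of a difference quotient is bounded by that of the gradient. -/
theorem lintegral_translate_sub_le {φ : Euc d → ℂ} (hφ : ContDiff ℝ ∞ φ) {S A : Set (Euc d)}
    (hS : MeasurableSet S) (hA : MeasurableSet A) {z : Euc d}
    (h : ∀ x ∈ S, ∀ t ∈ Icc (0 : ℝ) 1, x + t • z ∈ A) :
    ∫⁻ x in S, ‖φ (x + z) - φ x‖ₑ ^ 2 ≤ ‖z‖ₑ ^ 2 * ∫⁻ x in A, ‖fderiv ℝ φ x‖ₑ ^ 2 := by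
  have hg : Continuous fun x => ‖fderiv ℝ φ x‖ₑ ^ 2 :=
    (ENNReal.continuous_pow 2).comp (hφ.continuous_fderiv (by simp)).enorm
  have hm : Measurable (Function.uncurry fun (x : Euc d) (t : ℝ) =>
      ‖fderiv ℝ φ (x + t • z)‖ₑ ^ 2) :=
    (hg.comp (by fun_prop : Continuous fun p : Euc d × ℝ => p.1 + p.2 • z)).measurable
  calc ∫⁻ x in S, ‖φ (x + z) - φ x‖ₑ ^ 2
      ≤ ∫⁻ x in S, ‖z‖ₑ ^ 2 * ∫⁻ t in Icc (0 : ℝ) 1, ‖fderiv ℝ φ (x + t • z)‖ₑ ^ 2 :=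
        lintegral_mono fun x => enorm_sub_sq_le_lintegral_fderiv hφ x z
    _ = ‖z‖ₑ ^ 2 * ∫⁻ x in S, ∫⁻ t in Icc (0 : ℝ) 1, ‖fderiv ℝ φ (x + t • z)‖ₑ ^ 2 :=
        lintegral_const_mul _ hm.lintegral_prod_right'
    _ = ‖z‖ₑ ^ 2 * ∫⁻ t in Icc (0 : ℝ) 1, ∫⁻ x in S, ‖fderiv ℝ φ (x + t • z)‖ₑ ^ 2 := by
        rw [lintegral_lintegral_swap hm.aemeasurable]
    _ ≤ ‖z‖ₑ ^ 2 * ∫⁻ t in Icc (0 : ℝ) 1, ∫⁻ x in A, ‖fderiv ℝ φ x‖ₑ ^ 2 := by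
        refine mul_le_mul_right ?_ _
        refine setLIntegral_mono' measurableSet_Icc fun t ht => ?_
        exact setLIntegral_comp_add_le hS hA (fun x hx => h x hx t ht)
          (fun y => ‖fderiv ℝ φ y‖ₑ ^ 2)
    _ = _ := by
        rw [lintegral_const, Measure.restrict_apply_univ, Real.volume_Icc]
        simp

/-- The estimate in a thin strip near the boundary: `S` is moved into `A` by the translations
by `s • e`, `0 ≤ s ≤ ℓ`, and each line parallel to `e` meets `S` in a set of length `≤ τ`. -/
theorem lintegral_strip_le {φ : Euc d → ℂ} (hφ : ContDiff ℝ ∞ φ) {S A : Set (Euc d)}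
    (hS : MeasurableSet S) (hA : MeasurableSet A) {e : Euc d} (he : ‖e‖ = 1) {ℓ τ : ℝ}
    (hℓ : 0 < ℓ) (h : ∀ x ∈ S, ∀ t ∈ Icc (0 : ℝ) ℓ, x + t • e ∈ A)
    (hτ : ∀ z, volume {t : ℝ | t ∈ Icc 0 ℓ ∧ z - t • e ∈ S} ≤ ENNReal.ofReal τ) :
    ∫⁻ x in S, ‖φ x‖ₑ ^ 2 ≤ ENNReal.ofReal (2 * τ / ℓ) * (∫⁻ x in A, ‖φ x‖ₑ ^ 2)
      + ENNReal.ofReal (2 * ℓ ^ 2) * ∫⁻ x in A, ‖fderiv ℝ φ x‖ₑ ^ 2 := by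
  have hcφ := hφ.continuous
  set G := ∫⁻ x in A, ‖fderiv ℝ φ x‖ₑ ^ 2 with hG
  -- Compare `φ x` with the value at the shifted point `x + s • e`, at the cost of a gradient term;
  -- the estimate is later averaged over `s ∈ [0, ℓ]`.
  have h1 : ∀ s ∈ Icc (0 : ℝ) ℓ, ∫⁻ x in S, ‖φ x‖ₑ ^ 2
      ≤ 2 * (∫⁻ x in S, ‖φ (x + s • e)‖ₑ ^ 2) + ENNReal.ofReal (2 * ℓ ^ 2) * G := by
    intro s hs
    have k1 := lintegral_translate_sub_le hφ (z := s • e) hS hA (fun x hx t ht => by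
      rw [smul_smul]
      exact h x hx _ ⟨mul_nonneg ht.1 hs.1, (mul_le_of_le_one_left hs.1 ht.2).trans hs.2⟩)
    have k2 : ‖s • e‖ₑ ^ 2 ≤ ENNReal.ofReal (ℓ ^ 2) := by
      rw [← ofReal_norm, norm_smul, he, mul_one, Real.norm_of_nonneg hs.1,
        ← ENNReal.ofReal_pow hs.1]
      refine ENNReal.ofReal_le_ofReal ?_
      have := hs.1
      gcongr
      exact hs.2
    calc ∫⁻ x in S, ‖φ x‖ₑ ^ 2
        ≤ ∫⁻ x in S, (2 * ‖φ (x + s • e)‖ₑ ^ 2 + 2 * ‖φ (x + s • e) - φ x‖ₑ ^ 2) := by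
          refine lintegral_mono fun x => ?_
          have := enorm_add_sq_le (φ (x + s • e)) (-(φ (x + s • e) - φ x))
          rw [enorm_neg] at this
          simpa using this
      _ = 2 * (∫⁻ x in S, ‖φ (x + s • e)‖ₑ ^ 2)
          + 2 * ∫⁻ x in S, ‖φ (x + s • e) - φ x‖ₑ ^ 2 := by
          rw [lintegral_add_left, lintegral_const_mul, lintegral_const_mul]
          · exact (by fun_prop : Continuous fun x => ‖φ (x + s • e) - φ x‖ₑ ^ 2).measurable
          · exact (by fun_prop : Continuous fun x => ‖φ (x + s • e)‖ₑ ^ 2).measurable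
          · exact (by fun_prop : Continuous fun x => ‖φ (x + s • e)‖ₑ ^ 2).measurable.const_mul _
      _ ≤ 2 * (∫⁻ x in S, ‖φ (x + s • e)‖ₑ ^ 2) + 2 * (ENNReal.ofReal (ℓ ^ 2) * G) := by
          gcongr
          exact k1.trans (by gcongr)
      _ = _ := by
          rw [ENNReal.ofReal_mul zero_le_two, mul_assoc]
          simp
  -- Tonelli after the substitution `z = x + s • e`: each `z ∈ A` is counted for a set of shifts of
  -- measure at most `τ`, and no other `z` is reached. Dividing by `ℓ` gives the small factor `τ /
  -- ℓ`.
  have h2 : ∫⁻ s in Icc (0 : ℝ) ℓ, ∫⁻ x in S, ‖φ (x + s • e)‖ₑ ^ 2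
      ≤ ENNReal.ofReal τ * ∫⁻ x in A, ‖φ x‖ₑ ^ 2 := by
    have hmS : Measurable (Function.uncurry fun (s : ℝ) (z : Euc d) =>
        S.indicator (fun _ => ‖φ z‖ₑ ^ 2) (z - s • e)) := by
      have a1 : Measurable fun p : ℝ × Euc d => p.2 - p.1 • e :=
        (by fun_prop : Continuous fun p : ℝ × Euc d => p.2 - p.1 • e).measurable
      have a2 : Measurable fun p : ℝ × Euc d => ‖φ p.2‖ₑ ^ 2 :=
        (by fun_prop : Continuous fun p : ℝ × Euc d => ‖φ p.2‖ₑ ^ 2).measurable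
      have : (Function.uncurry fun (s : ℝ) (z : Euc d) =>
          S.indicator (fun _ => ‖φ z‖ₑ ^ 2) (z - s • e))
          = ((fun p : ℝ × Euc d => p.2 - p.1 • e) ⁻¹' S).indicator
              (fun p : ℝ × Euc d => ‖φ p.2‖ₑ ^ 2) := by
        ext p
        rfl
      rw [this]
      exact a2.indicator (a1 hS)
    calc ∫⁻ s in Icc (0 : ℝ) ℓ, ∫⁻ x in S, ‖φ (x + s • e)‖ₑ ^ 2
        = ∫⁻ s in Icc (0 : ℝ) ℓ, ∫⁻ z, S.indicator (fun _ => ‖φ z‖ₑ ^ 2) (z - s • e) := by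
          refine lintegral_congr fun s => ?_
          rw [← lintegral_indicator hS, ← lintegral_sub_right_eq_self _ (s • e)]
          refine lintegral_congr fun x => ?_
          change S.indicator (fun y => ‖φ (y + s • e)‖ₑ ^ 2) (x - s • e) = _
          by_cases hx : x - s • e ∈ S
          · rw [indicator_of_mem hx, indicator_of_mem hx, sub_add_cancel]
          · rw [indicator_of_notMem hx, indicator_of_notMem hx]
      _ = ∫⁻ z, ∫⁻ s in Icc (0 : ℝ) ℓ, S.indicator (fun _ => ‖φ z‖ₑ ^ 2) (z - s • e) :=
          lintegral_lintegral_swap hmS.aemeasurable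
      _ ≤ ∫⁻ z, A.indicator (fun z => ENNReal.ofReal τ * ‖φ z‖ₑ ^ 2) z := by
          refine lintegral_mono fun z => ?_
          have hmz : MeasurableSet {s : ℝ | z - s • e ∈ S} :=
            (by fun_prop : Continuous fun s : ℝ => z - s • e).measurable hS
          have e1 : ∫⁻ s in Icc (0 : ℝ) ℓ, S.indicator (fun _ => ‖φ z‖ₑ ^ 2) (z - s • e)
              = ‖φ z‖ₑ ^ 2 * volume {t : ℝ | t ∈ Icc 0 ℓ ∧ z - t • e ∈ S} := by
            have : (fun s : ℝ => S.indicator (fun _ => ‖φ z‖ₑ ^ 2) (z - s • e))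
                = {s : ℝ | z - s • e ∈ S}.indicator fun _ => ‖φ z‖ₑ ^ 2 := by
              ext s; rfl
            rw [this, lintegral_indicator_const hmz, Measure.restrict_apply hmz, inter_comm]
            rfl
          rw [e1]
          by_cases hz : z ∈ A
          · rw [indicator_of_mem hz, mul_comm]
            gcongr
            exact hτ z
          · have : {t : ℝ | t ∈ Icc 0 ℓ ∧ z - t • e ∈ S} = ∅ := by
              refine eq_empty_of_forall_notMem fun t ht => hz ?_
              simpa using h _ ht.2 t ht.1
            rw [this]
            simp
      _ = ENNReal.ofReal τ * ∫⁻ x in A, ‖φ x‖ₑ ^ 2 := by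
          rw [lintegral_indicator hA, lintegral_const_mul]
          exact (by fun_prop : Continuous fun x => ‖φ x‖ₑ ^ 2).measurable
  have h3 : ENNReal.ofReal ℓ * ∫⁻ x in S, ‖φ x‖ₑ ^ 2
      ≤ 2 * (ENNReal.ofReal τ * ∫⁻ x in A, ‖φ x‖ₑ ^ 2)
        + ENNReal.ofReal ℓ * (ENNReal.ofReal (2 * ℓ ^ 2) * G) := by
    have hm2 : Measurable fun s : ℝ => ∫⁻ x in S, ‖φ (x + s • e)‖ₑ ^ 2 := by
      refine Measurable.lintegral_prod_right' (f := fun p : ℝ × Euc d => ‖φ (p.2 + p.1 • e)‖ₑ ^ 2) ?_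
      exact (by fun_prop : Continuous fun p : ℝ × Euc d => ‖φ (p.2 + p.1 • e)‖ₑ ^ 2).measurable
    calc ENNReal.ofReal ℓ * ∫⁻ x in S, ‖φ x‖ₑ ^ 2
        = ∫⁻ s in Icc (0 : ℝ) ℓ, ∫⁻ x in S, ‖φ x‖ₑ ^ 2 := by
          rw [lintegral_const, Measure.restrict_apply_univ, Real.volume_Icc, sub_zero, mul_comm]
      _ ≤ ∫⁻ s in Icc (0 : ℝ) ℓ, (2 * (∫⁻ x in S, ‖φ (x + s • e)‖ₑ ^ 2)
          + ENNReal.ofReal (2 * ℓ ^ 2) * G) := setLIntegral_mono' measurableSet_Icc h1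
      _ = 2 * (∫⁻ s in Icc (0 : ℝ) ℓ, ∫⁻ x in S, ‖φ (x + s • e)‖ₑ ^ 2)
          + ENNReal.ofReal ℓ * (ENNReal.ofReal (2 * ℓ ^ 2) * G) := by
          rw [lintegral_add_left (hm2.const_mul _), lintegral_const_mul _ hm2, lintegral_const,
            Measure.restrict_apply_univ, Real.volume_Icc, sub_zero]
          congr 1
          rw [mul_comm]
      _ ≤ _ := by gcongr
  have hℓ' : ENNReal.ofReal ℓ ≠ 0 := by simpa using hℓ
  rw [← ENNReal.mul_le_mul_iff_right hℓ' ENNReal.ofReal_ne_top]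
  refine h3.trans (le_of_eq ?_)
  rw [mul_add]
  congr 1
  rw [← mul_assoc, ← mul_assoc, ← ENNReal.ofReal_mul hℓ.le]
  congr 1
  rw [show ℓ * (2 * τ / ℓ) = 2 * τ by field_simp, ENNReal.ofReal_mul zero_le_two]
  simp

/-- A Poincaré inequality on convex sets. -/
theorem lintegral_convex_le {φ : Euc d → ℂ} (hφ : ContDiff ℝ ∞ φ) {Q : Set (Euc d)}
    (hQ : MeasurableSet Q) (hconv : Convex ℝ Q) (h0 : volume Q ≠ 0) {δ : ℝ}
    (hδ : ∀ x ∈ Q, ∀ y ∈ Q, ‖x - y‖ ≤ δ) (hQb : Bornology.IsBounded Q) :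
    ∫⁻ x in Q, ‖φ x‖ₑ ^ 2 ≤ 2 * (volume Q)⁻¹ * ‖∫ x in Q, φ x‖ₑ ^ 2
      + 2 * (volume Q)⁻¹ * (volume (Metric.closedBall (0 : Euc d) δ) * ENNReal.ofReal (δ ^ 2)
        * ∫⁻ x in Q, ‖fderiv ℝ φ x‖ₑ ^ 2) := by
  have hcφ := hφ.continuous
  have hQt : volume Q ≠ ⊤ := hQb.measure_lt_top.ne
  set A := volume Q with hA
  set G := ∫⁻ x in Q, ‖fderiv ℝ φ x‖ₑ ^ 2 with hG
  have hint : IntegrableOn φ Q :=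
    (hcφ.continuousOn.integrableOn_compact hQb.isCompact_closure).mono_set subset_closure
  -- With `y = x + z`, only differences `z` in the ball of radius `δ` occur, and convexity keeps the
  -- segment from `x` to `x + z` inside `Q`, so the difference estimate applies for each `z`.
  have hPP : ∫⁻ x in Q, ∫⁻ y in Q, ‖φ y - φ x‖ₑ ^ 2
      ≤ volume (Metric.closedBall (0 : Euc d) δ) * ENNReal.ofReal (δ ^ 2) * G := by
    have hm : Measurable (Function.uncurry fun (x z : Euc d) =>
        Q.indicator (fun _ => ‖φ (x + z) - φ x‖ₑ ^ 2) (x + z)) := by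
      have a1 : Measurable fun p : Euc d × Euc d => p.1 + p.2 :=
        (by fun_prop : Continuous fun p : Euc d × Euc d => p.1 + p.2).measurable
      have a2 : Measurable fun p : Euc d × Euc d => ‖φ (p.1 + p.2) - φ p.1‖ₑ ^ 2 :=
        (by fun_prop :
          Continuous fun p : Euc d × Euc d => ‖φ (p.1 + p.2) - φ p.1‖ₑ ^ 2).measurable
      exact a2.indicator (a1 hQ)
    calc ∫⁻ x in Q, ∫⁻ y in Q, ‖φ y - φ x‖ₑ ^ 2
        = ∫⁻ x in Q, ∫⁻ z, Q.indicator (fun _ => ‖φ (x + z) - φ x‖ₑ ^ 2) (x + z) := by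
          refine lintegral_congr fun x => ?_
          rw [← lintegral_indicator hQ, ← lintegral_add_left_eq_self _ x]
          rfl
      _ = ∫⁻ z, ∫⁻ x in Q, Q.indicator (fun _ => ‖φ (x + z) - φ x‖ₑ ^ 2) (x + z) :=
          lintegral_lintegral_swap hm.aemeasurable
      _ ≤ ∫⁻ z, (Metric.closedBall (0 : Euc d) δ).indicator
            (fun _ => ENNReal.ofReal (δ ^ 2) * G) z := by
          refine lintegral_mono fun z => ?_
          have hmz : MeasurableSet {x : Euc d | x + z ∈ Q} :=
            (by fun_prop : Continuous fun x : Euc d => x + z).measurable hQ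
          have e1 : ∫⁻ x in Q, Q.indicator (fun _ => ‖φ (x + z) - φ x‖ₑ ^ 2) (x + z)
              = ∫⁻ x in Q ∩ {x : Euc d | x + z ∈ Q}, ‖φ (x + z) - φ x‖ₑ ^ 2 := by
            rw [inter_comm, ← Measure.restrict_restrict hmz, ← lintegral_indicator hmz]
            rfl
          rw [e1]
          have e2 := lintegral_translate_sub_le hφ (z := z) (hQ.inter hmz) hQ
            (fun x hx t ht => by
              have := hconv hx.1 hx.2 (sub_nonneg.2 ht.2) ht.1 (by ring)
              convert this using 1
              module)
          by_cases hz : z ∈ Metric.closedBall (0 : Euc d) δ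
          · rw [indicator_of_mem hz]
            refine e2.trans ?_
            rw [mem_closedBall_zero_iff] at hz
            gcongr ?_ * _
            rw [← ofReal_norm, ← ENNReal.ofReal_pow (norm_nonneg z)]
            exact ENNReal.ofReal_le_ofReal (by gcongr)
          · have : Q ∩ {x : Euc d | x + z ∈ Q} = ∅ := by
              refine eq_empty_of_forall_notMem fun x hx => hz ?_
              rw [mem_closedBall_zero_iff]
              simpa using hδ _ hx.2 _ hx.1
            rw [this]
            simp
      _ = _ := by
          rw [lintegral_indicator_const measurableSet_closedBall]
          ring
  have h1 : ∀ x, A ^ 2 * ‖φ x‖ₑ ^ 2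
      ≤ 2 * ‖∫ y in Q, φ y‖ₑ ^ 2 + 2 * (A * ∫⁻ y in Q, ‖φ y - φ x‖ₑ ^ 2) := by
    intro x
    -- `|Q| φ(x)` is the integral of `φ` minus the integral of `φ(y) - φ(x)` over `y ∈ Q`.
    have e1 : (A.toReal : ℂ) * φ x = (∫ y in Q, φ y) + -∫ y in Q, (φ y - φ x) := by
      rw [integral_sub hint (integrableOn_const hQt), setIntegral_const, Complex.real_smul]
      simp only [Measure.real]
      ring
    have e2 : A * ‖φ x‖ₑ = ‖(A.toReal : ℂ) * φ x‖ₑ := by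
      rw [enorm_mul]
      congr 1
      rw [← ofReal_norm, Complex.norm_real, Real.norm_of_nonneg ENNReal.toReal_nonneg,
        ENNReal.ofReal_toReal hQt]
    rw [← mul_pow, e2, e1]
    refine (enorm_add_sq_le _ _).trans ?_
    rw [enorm_neg]
    gcongr
    calc ‖∫ y in Q, (φ y - φ x)‖ₑ ^ 2 ≤ (∫⁻ y in Q, ‖φ y - φ x‖ₑ) ^ 2 := by
          gcongr; exact enorm_integral_le_lintegral_enorm _
      _ ≤ _ := by
          refine (sq_lintegral_le _ (by fun_prop :
            Continuous fun y => ‖φ y - φ x‖ₑ).measurable.aemeasurable).trans ?_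
          rw [Measure.restrict_apply_univ]
  have h2 : A ^ 2 * ∫⁻ x in Q, ‖φ x‖ₑ ^ 2
      ≤ A * (2 * ‖∫ y in Q, φ y‖ₑ ^ 2)
        + A * (2 * (volume (Metric.closedBall (0 : Euc d) δ) * ENNReal.ofReal (δ ^ 2) * G)) := by
    have hm : Measurable fun x => ∫⁻ y in Q, ‖φ y - φ x‖ₑ ^ 2 :=
      Measurable.lintegral_prod_right' (f := fun p : Euc d × Euc d => ‖φ p.2 - φ p.1‖ₑ ^ 2)
        (by fun_prop : Continuous fun p : Euc d × Euc d => ‖φ p.2 - φ p.1‖ₑ ^ 2).measurable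
    calc A ^ 2 * ∫⁻ x in Q, ‖φ x‖ₑ ^ 2 = ∫⁻ x in Q, A ^ 2 * ‖φ x‖ₑ ^ 2 := by
          rw [lintegral_const_mul]
          exact (by fun_prop : Continuous fun x => ‖φ x‖ₑ ^ 2).measurable
      _ ≤ ∫⁻ x in Q, (2 * ‖∫ y in Q, φ y‖ₑ ^ 2 + 2 * (A * ∫⁻ y in Q, ‖φ y - φ x‖ₑ ^ 2)) :=
          lintegral_mono h1
      _ = A * (2 * ‖∫ y in Q, φ y‖ₑ ^ 2)
          + 2 * (A * ∫⁻ x in Q, ∫⁻ y in Q, ‖φ y - φ x‖ₑ ^ 2) := by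
          rw [lintegral_add_left measurable_const, lintegral_const, Measure.restrict_apply_univ,
            lintegral_const_mul _ (hm.const_mul _), lintegral_const_mul _ hm, mul_comm]
      _ ≤ _ := by
          rw [mul_left_comm 2 A]
          gcongr
  have hA2 : A ^ 2 ≠ 0 := pow_ne_zero 2 h0
  have hA2t : A ^ 2 ≠ ⊤ := ENNReal.pow_ne_top hQt
  rw [← ENNReal.mul_le_mul_iff_right hA2 hA2t]
  refine h2.trans (le_of_eq ?_)
  have hAA : A ^ 2 * A⁻¹ = A := by
    rw [sq, mul_assoc, ENNReal.mul_inv_cancel h0 hQt, mul_one]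
  rw [mul_add]
  have hX : ∀ X, A ^ 2 * (2 * A⁻¹ * X) = A ^ 2 * A⁻¹ * (2 * X) := fun X => by ring
  rw [hX, hX, hAA]

/-! ### The geometry of the boundary -/

theorem norm_lt_of_norm_lt_half {y : Euc 2} {r t : ℝ} (hy : ‖y‖ < r / 2) (ht : |t| ≤ r / 2) :
    ‖y + t • EuclideanSpace.single (1 : Fin 2) (1 : ℝ)‖ < r := by
  have : ‖t • EuclideanSpace.single (1 : Fin 2) (1 : ℝ)‖ ≤ r / 2 := by
    rw [norm_smul, PiLp.norm_single]
    simpa using ht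
  linarith [norm_add_le y (t • EuclideanSpace.single (1 : Fin 2) (1 : ℝ))]

/-- Near a boundary point there is a direction pointing into the domain. -/
theorem IsCrossSection.exists_direction {D : Opens (Euc 2)} (hD : IsCrossSection D) {p : Euc 2}
    (hp : p ∈ frontier (D : Set (Euc 2))) :
    ∃ (e : Euc 2) (ρ : ℝ), ‖e‖ = 1 ∧ 0 < ρ ∧
      (∀ x ∈ Metric.ball p ρ, x ∈ D → ∀ t ∈ Icc 0 ρ, x + t • e ∈ D) ∧
      ∀ x ∈ Metric.ball p ρ, x ∉ D → ∀ t ∈ Ioc 0 ρ, x - t • e ∉ closure (D : Set (Euc 2)) := by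
  obtain ⟨R, f₁, f₂, r, hr, hf₁, hf₂, h₁, h₂, hchart⟩ := hD.boundary p hp
  set F : ℝ → ℝ := fun s => if s ≤ 0 then f₁ s else f₂ s with hF
  have hFc : Continuous F := by
    refine Continuous.if_le hf₁.continuous hf₂.continuous continuous_id continuous_const ?_
    intro x hx
    rw [hx, h₁, h₂]
  set e₁ : Euc 2 := EuclideanSpace.single (1 : Fin 2) (1 : ℝ) with he₁
  have hcoord : ∀ x : Euc 2, ∃ y : Euc 2, x = p + R y ∧ ‖y‖ = dist x p := fun x => by
    refine ⟨R.symm (x - p), by simp, ?_⟩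
    rw [LinearIsometryEquiv.norm_map, dist_eq_norm]
  have hy0 : ∀ (y : Euc 2) (t : ℝ), (y + t • e₁) 0 = y 0 := fun y t => by simp [he₁]
  have hy1 : ∀ (y : Euc 2) (t : ℝ), (y + t • e₁) 1 = y 1 + t := fun y t => by simp [he₁]
  refine ⟨R e₁, r / 2, by rw [LinearIsometryEquiv.norm_map]; simp [he₁], half_pos hr,
    fun x hx hxD t ht => ?_, fun x hx hxD t ht => ?_⟩
  · obtain ⟨y, rfl, hy⟩ := hcoord x
    rw [Metric.mem_ball, ← hy] at hx
    have hlt := norm_lt_of_norm_lt_half hx (t := t) (by rw [abs_of_nonneg ht.1]; exact ht.2)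
    rw [add_assoc, ← map_smul, ← map_add, hchart _ hlt, hy0, hy1]
    rw [hchart y (by linarith)] at hxD
    linarith [ht.1]
  · obtain ⟨y, rfl, hy⟩ := hcoord x
    rw [Metric.mem_ball, ← hy] at hx
    have hlt := norm_lt_of_norm_lt_half hx (t := -t)
      (by rw [abs_neg, abs_of_pos ht.1]; exact ht.2)
    rw [sub_eq_add_neg, add_assoc, ← neg_smul, ← map_smul, ← map_add]
    rw [hchart y (by linarith)] at hxD
    intro hcl
    -- The part of the chart strictly below the graph is open and misses `D`. A positive shift `t`
    -- is essential: a point outside `D` may lie on the graph itself, and only after moving it down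
    -- does it leave the closure.
    have hopen : IsOpen {z : Euc 2 | ‖R.symm (z - p)‖ < r ∧
        (R.symm (z - p)) 1 < F ((R.symm (z - p)) 0)} := by
      have hc : Continuous fun z : Euc 2 => R.symm (z - p) :=
        R.symm.continuous.comp (continuous_id.sub continuous_const)
      refine (isOpen_lt hc.norm continuous_const).and (isOpen_lt ?_ ?_)
      · exact (EuclideanSpace.proj (𝕜 := ℝ) (1 : Fin 2)).continuous.comp hc
      · exact hFc.comp ((EuclideanSpace.proj (𝕜 := ℝ) (0 : Fin 2)).continuous.comp hc)
    obtain ⟨z, ⟨hz1, hz2⟩, hzD⟩ := mem_closure_iff.1 hcl _ hopen (by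
      simp only [mem_ofPred_eq, add_sub_cancel_left, LinearIsometryEquiv.symm_apply_apply]
      refine ⟨hlt, ?_⟩
      change (y + -t • e₁) 1 < F ((y + -t • e₁) 0)
      rw [hy0, hy1]
      change ¬F (y 0) < y 1 at hxD
      linarith [ht.1, not_lt.1 hxD])
    have := (hchart (R.symm (z - p)) hz1).1 (by simpa using hzD)
    exact lt_asymm this hz2

/-! ### Grids of squares -/

/-- The squares of a grid of mesh `h`. -/
def gridCell (h : ℝ) (m : Fin 2 → ℤ) : Set (Euc 2) :=
  {x | ∀ i, x i ∈ Ico (h * m i) (h * (m i + 1))}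

theorem gridCell_eq_preimage (h : ℝ) (m : Fin 2 → ℤ) :
    gridCell h m = WithLp.ofLp ⁻¹' (Set.pi univ fun i => Ico (h * m i) (h * (m i + 1))) := by
  ext x
  simp [gridCell, Set.mem_pi]

theorem measurableSet_gridCell (h : ℝ) (m : Fin 2 → ℤ) : MeasurableSet (gridCell h m) := by
  rw [gridCell_eq_preimage]
  exact (PiLp.volume_preserving_ofLp (Fin 2)).measurable
    (MeasurableSet.univ_pi fun i => measurableSet_Ico)

theorem volume_gridCell {h : ℝ} (hh : 0 < h) (m : Fin 2 → ℤ) :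
    volume (gridCell h m) = ENNReal.ofReal (h ^ 2) := by
  rw [gridCell_eq_preimage, (PiLp.volume_preserving_ofLp (Fin 2)).measure_preimage
    (MeasurableSet.univ_pi fun i => measurableSet_Ico).nullMeasurableSet, Real.volume_pi_Ico]
  have : ∀ i, h * ((m i : ℝ) + 1) - h * m i = h := fun i => by ring
  simp only [this, Fin.prod_univ_two]
  rw [← ENNReal.ofReal_mul hh.le, sq]

theorem convex_gridCell (h : ℝ) (m : Fin 2 → ℤ) : Convex ℝ (gridCell h m) := by
  intro x hx y hy a b ha hb hab i
  exact (convex_Ico _ _) (hx i) (hy i) ha hb hab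

theorem norm_sub_le_of_mem_gridCell {h : ℝ} (hh : 0 < h) {m : Fin 2 → ℤ} {x y : Euc 2}
    (hx : x ∈ gridCell h m) (hy : y ∈ gridCell h m) : ‖x - y‖ ≤ 2 * h := by
  have key : ∀ i, ‖(x - y) i‖ ≤ h := fun i => by
    have h1 := hx i
    have h2 := hy i
    simp only [mem_Ico] at h1 h2
    rw [PiLp.sub_apply, Real.norm_eq_abs, abs_le]
    constructor <;> nlinarith
  refine le_of_sq_le_sq ?_ (by positivity)
  rw [EuclideanSpace.norm_sq_eq, Fin.sum_univ_two]
  have h0 : ‖(x - y) 0‖ ^ 2 ≤ h ^ 2 := pow_le_pow_left₀ (norm_nonneg _) (key 0) 2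
  have h1 : ‖(x - y) 1‖ ^ 2 ≤ h ^ 2 := pow_le_pow_left₀ (norm_nonneg _) (key 1) 2
  nlinarith

theorem isBounded_gridCell {h : ℝ} (hh : 0 < h) (m : Fin 2 → ℤ) :
    Bornology.IsBounded (gridCell h m) :=
  Metric.isBounded_iff.2 ⟨2 * h, fun _ hx _ hy => by
    rw [dist_eq_norm]; exact norm_sub_le_of_mem_gridCell hh hx hy⟩

theorem eq_floor_of_mem_gridCell {h : ℝ} (hh : 0 < h) {m : Fin 2 → ℤ} {x : Euc 2} :
    x ∈ gridCell h m ↔ (fun i => ⌊x i / h⌋) = m := by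
  rw [funext_iff]
  refine forall_congr' fun i => ?_
  rw [Int.floor_eq_iff, le_div_iff₀ hh, div_lt_iff₀ hh, mul_comm h, mul_comm h]
  rfl

theorem finite_gridCell_inter {h : ℝ} (hh : 0 < h) {K : Set (Euc 2)} (hK : Bornology.IsBounded K) :
    {m | (gridCell h m ∩ K).Nonempty}.Finite := by
  obtain ⟨C, hC⟩ := hK.exists_norm_le
  refine (Set.Finite.pi' (fun _ : Fin 2 => finite_Icc (⌊-C / h⌋) (⌊C / h⌋))).subset ?_
  rintro m ⟨x, hx, hxK⟩ i
  rw [eq_floor_of_mem_gridCell hh] at hx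
  have h1 : |x i| ≤ C := (PiLp.norm_apply_le x i).trans (hC x hxK)
  rw [← hx]
  exact ⟨Int.floor_le_floor (by gcongr; exact neg_le_of_abs_le h1),
    Int.floor_le_floor (by gcongr; exact le_of_abs_le h1)⟩

/-! ### Compactness of the embedding of `H¹` of the cross-section -/

/-- The `L²` norm is bounded by a small multiple of the `H¹` norm and finitely many averages. -/
theorem IsCrossSection.lintegral_sq_le {D : Opens (Euc 2)} (hD : IsCrossSection D) {ε : ℝ}
    (hε : 0 < ε) :
    ∃ (M : Finset (Fin 2 → ℤ)) (h : ℝ), 0 < h ∧ (∀ m ∈ M, gridCell h m ⊆ D) ∧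
      ∀ φ : Euc 2 → ℂ, ContDiff ℝ ∞ φ →
        ∫⁻ x in (D : Set (Euc 2)), ‖φ x‖ₑ ^ 2 ≤ ENNReal.ofReal ε *
          ((∫⁻ x in (D : Set (Euc 2)), ‖φ x‖ₑ ^ 2)
            + ∫⁻ x in (D : Set (Euc 2)), ‖fderiv ℝ φ x‖ₑ ^ 2)
          + ∑ m ∈ M, ENNReal.ofReal (2 / h ^ 2) * ‖∫ x in gridCell h m, φ x‖ₑ ^ 2 := by
  classical
  have hDm : MeasurableSet (D : Set (Euc 2)) := D.isOpen.measurableSet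
  have hfr : IsCompact (frontier (D : Set (Euc 2))) :=
    hD.isBounded.isCompact_closure.of_isClosed_subset isClosed_frontier frontier_subset_closure
  have hdir := fun (p : Euc 2) (hp : p ∈ frontier (D : Set (Euc 2))) => hD.exists_direction hp
  choose! e ρ he hρ hin hout using hdir
  obtain ⟨t, htf, htc⟩ := hfr.elim_nhds_subcover (fun p => Metric.ball p (ρ p))
    fun p hp => Metric.ball_mem_nhds p (hρ p hp)
  set N : ℝ := (t.card : ℝ) with hN
  have hN0 : 0 ≤ N := by positivity
  -- `ℓ` is the length over which strips are pushed inwards. It has to fit all the chosen charts,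
  -- and the gradient terms of all `N` strips together may use only half of `ε`; the other half is
  -- kept for the squares.
  obtain ⟨ℓ, hℓ0, hℓρ, hℓε⟩ : ∃ ℓ : ℝ, 0 < ℓ ∧ (∀ p ∈ t, ℓ ≤ ρ p) ∧ N * (2 * ℓ ^ 2) ≤ ε / 2 := by
    have h1 : ∀ᶠ ℓ in 𝓝[>] (0 : ℝ), ∀ p ∈ t, ℓ ≤ ρ p :=
      (Filter.eventually_all_finset t).2 fun p hp =>
        eventually_nhdsWithin_of_eventually_nhds (eventually_le_nhds (hρ p (htf p hp)))
    have h2 : ∀ᶠ ℓ in 𝓝[>] (0 : ℝ), N * (2 * ℓ ^ 2) < ε / 2 := by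
      refine eventually_nhdsWithin_of_eventually_nhds ?_
      have : Tendsto (fun ℓ : ℝ => N * (2 * ℓ ^ 2)) (𝓝 0) (𝓝 (N * (2 * 0 ^ 2))) :=
        (by fun_prop : Continuous fun ℓ : ℝ => N * (2 * ℓ ^ 2)).tendsto 0
      exact this.eventually_lt_const (by simpa using hε)
    obtain ⟨ℓ, ⟨k1, k2⟩, k3⟩ := ((h1.and h2).and self_mem_nhdsWithin).exists
    exact ⟨ℓ, k3, k1, k2.le⟩
  -- `τ` is the thickness of the strips; being small relative to `ℓ`, it makes the `L²` terms of the
  -- `N` strips sum to at most `ε` times the norm squared.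
  obtain ⟨τ, hτ0, hτℓ, hτε⟩ : ∃ τ : ℝ, 0 < τ ∧ τ ≤ ℓ ∧ N * (2 * τ / ℓ) ≤ ε := by
    refine ⟨min ℓ (ε * ℓ / (2 * (N + 1))), by positivity, min_le_left _ _, ?_⟩
    calc N * (2 * min ℓ (ε * ℓ / (2 * (N + 1))) / ℓ)
        ≤ N * (2 * (ε * ℓ / (2 * (N + 1))) / ℓ) := by
          gcongr; exact min_le_right _ _
      _ = ε * (N / (N + 1)) := by field_simp
      _ ≤ ε * 1 := by
          gcongr
          rw [div_le_one (by positivity)]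
          linarith
      _ = ε := mul_one ε
  set S : Euc 2 → Set (Euc 2) := fun p => {x | x ∈ D ∧ x ∈ Metric.ball p (ρ p) ∧ x - τ • e p ∉ D}
    with hS
  have hSm : ∀ p, MeasurableSet (S p) := fun p => by
    refine hDm.inter (Metric.isOpen_ball.measurableSet.inter (MeasurableSet.compl ?_))
    exact (by fun_prop : Continuous fun x : Euc 2 => x - τ • e p).measurable hDm
  set K : Set (Euc 2) := {x | x ∈ D ∧ ∀ p ∈ t, x ∈ Metric.ball p (ρ p) → x - τ • e p ∈ D} with hK
  have hKD : K ⊆ D := fun x hx => hx.1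
  -- What remains after removing the strips stays away from the boundary: near a boundary point, `x
  -- - τ • e p` lies outside `closure D` by the choice of direction, and this is stable under small
  -- perturbations of `x`, while it would have to be in `D` for points of `K`.
  have hKcl : closure K ⊆ (D : Set (Euc 2)) := by
    intro x hx
    by_contra hxD
    have hxf : x ∈ frontier (D : Set (Euc 2)) := by
      rw [D.isOpen.frontier_eq]
      exact ⟨closure_mono hKD hx, hxD⟩
    obtain ⟨p, hp, hxp⟩ := mem_iUnion₂.1 (htc hxf)
    have h1 := hout p (htf p hp) x hxp hxD τ ⟨hτ0, hτℓ.trans (hℓρ p hp)⟩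
    have hopen : IsOpen (Metric.ball p (ρ p) ∩
        {z : Euc 2 | z - τ • e p ∈ (closure (D : Set (Euc 2)))ᶜ}) :=
      Metric.isOpen_ball.inter (isClosed_closure.isOpen_compl.preimage (by fun_prop))
    obtain ⟨z, ⟨hz1, hz2⟩, hzK⟩ := mem_closure_iff.1 hx _ hopen ⟨hxp, h1⟩
    exact hz2 (subset_closure (hzK.2 p hp hz1))
  obtain ⟨δ, hδ0, hδ⟩ :=
    (hD.isBounded.subset hKD).isCompact_closure.exists_cthickening_subset_open D.isOpen hKcl
  set v : ℝ := (volume (Metric.ball (0 : Euc 2) 1)).toReal with hv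
  have hvt : volume (Metric.ball (0 : Euc 2) 1) = ENNReal.ofReal v :=
    (ENNReal.ofReal_toReal Metric.isBounded_ball.measure_lt_top.ne).symm
  have hv0 : 0 ≤ v := ENNReal.toReal_nonneg
  -- A square of side `h` has differences of length at most `2 h`, so `2 h ≤ δ` keeps every square
  -- that meets `K` inside `D`. The Poincaré constant is `2 h⁻² · v (2h)² · (2h)² = 32 v h²`.
  obtain ⟨h, hh0, hhδ, hhε⟩ : ∃ h : ℝ, 0 < h ∧ 2 * h ≤ δ ∧ 32 * v * h ^ 2 ≤ ε / 2 := by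
    have h1 : ∀ᶠ h in 𝓝[>] (0 : ℝ), 2 * h < δ := by
      refine eventually_nhdsWithin_of_eventually_nhds ?_
      have : Tendsto (fun h : ℝ => 2 * h) (𝓝 0) (𝓝 (2 * 0)) :=
        (by fun_prop : Continuous fun h : ℝ => 2 * h).tendsto 0
      exact this.eventually_lt_const (by simpa using hδ0)
    have h2 : ∀ᶠ h in 𝓝[>] (0 : ℝ), 32 * v * h ^ 2 < ε / 2 := by
      refine eventually_nhdsWithin_of_eventually_nhds ?_
      have : Tendsto (fun h : ℝ => 32 * v * h ^ 2) (𝓝 0) (𝓝 (32 * v * 0 ^ 2)) :=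
        (by fun_prop : Continuous fun h : ℝ => 32 * v * h ^ 2).tendsto 0
      exact this.eventually_lt_const (by simpa using hε)
    obtain ⟨h, ⟨k1, k2⟩, k3⟩ := ((h1.and h2).and self_mem_nhdsWithin).exists
    exact ⟨h, k3, k1.le, k2.le⟩
  set M := (finite_gridCell_inter hh0 (hD.isBounded.subset hKD)).toFinset with hM
  have hMD : ∀ m ∈ M, gridCell h m ⊆ D := by
    intro m hm y hy
    obtain ⟨x, hx, hxK⟩ := (Set.Finite.mem_toFinset _).1 hm
    refine hδ (Metric.mem_cthickening_of_dist_le y x δ _ (subset_closure hxK) ?_)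
    rw [dist_eq_norm]
    exact (norm_sub_le_of_mem_gridCell hh0 hy hx).trans hhδ
  refine ⟨M, h, hh0, hMD, fun φ hφ => ?_⟩
  set A := ∫⁻ x in (D : Set (Euc 2)), ‖φ x‖ₑ ^ 2 with hA
  set G := ∫⁻ x in (D : Set (Euc 2)), ‖fderiv ℝ φ x‖ₑ ^ 2 with hG
  have hcover : (D : Set (Euc 2)) ⊆ (⋃ p ∈ t, S p) ∪ ⋃ m ∈ M, gridCell h m := by
    intro x hx
    by_cases hxK : x ∈ K
    · right
      refine mem_iUnion₂.2 ⟨fun i => ⌊x i / h⌋, ?_, (eq_floor_of_mem_gridCell hh0).2 rfl⟩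
      rw [hM, Set.Finite.mem_toFinset]
      exact ⟨x, (eq_floor_of_mem_gridCell hh0).2 rfl, hxK⟩
    · left
      have : ∃ p ∈ t, x ∈ Metric.ball p (ρ p) ∧ x - τ • e p ∉ D := by
        by_contra hcon
        push Not at hcon
        exact hxK ⟨hx, hcon⟩
      obtain ⟨p, hp, h1, h2⟩ := this
      exact mem_iUnion₂.2 ⟨p, hp, hx, h1, h2⟩
  have hstrip : ∀ p ∈ t, ∫⁻ x in S p, ‖φ x‖ₑ ^ 2
      ≤ ENNReal.ofReal (2 * τ / ℓ) * A + ENNReal.ofReal (2 * ℓ ^ 2) * G := by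
    intro p hp
    refine lintegral_strip_le hφ (hSm p) hDm (he p (htf p hp)) hℓ0
      (fun x hx s hs => hin p (htf p hp) x hx.2.1 hx.1 s ⟨hs.1, hs.2.trans (hℓρ p hp)⟩)
      fun z => (Real.volume_le_diam _).trans (Metric.ediam_le_of_forall_dist_le ?_)
    -- If `s' - s > τ`, pushing `z - s' • e p` inwards by `s' - s - τ` lands in `D` at `(z - s • e
    -- p) - τ • e p`, which contradicts that `z - s • e p` lies in the strip.
    have key : ∀ s ∈ {s : ℝ | s ∈ Icc 0 ℓ ∧ z - s • e p ∈ S p},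
        ∀ s' ∈ {s : ℝ | s ∈ Icc 0 ℓ ∧ z - s • e p ∈ S p}, s' - s ≤ τ := by
      rintro s ⟨hs1, hs2⟩ s' ⟨hs1', hs2'⟩
      by_contra hlt
      push Not at hlt
      have h1 := hin p (htf p hp) _ hs2'.2.1 hs2'.1 (s' - s - τ)
        ⟨by linarith, by linarith [hs1.1, hs1'.2, hℓρ p hp]⟩
      refine hs2.2.2 ?_
      convert h1 using 1
      module
    intro s hs s' hs'
    rw [Real.dist_eq, abs_le]
    constructor
    · linarith [key s hs s' hs']
    · linarith [key s' hs' s hs]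
  have hcell : ∀ m ∈ M, ∫⁻ x in gridCell h m, ‖φ x‖ₑ ^ 2
      ≤ ENNReal.ofReal (2 / h ^ 2) * ‖∫ x in gridCell h m, φ x‖ₑ ^ 2
        + ENNReal.ofReal (ε / 2) * ∫⁻ x in gridCell h m, ‖fderiv ℝ φ x‖ₑ ^ 2 := by
    intro m hm
    have h2 : 0 < h ^ 2 := by positivity
    have h1 := lintegral_convex_le hφ (measurableSet_gridCell h m) (convex_gridCell h m)
      (by rw [volume_gridCell hh0]; simpa using hh0.ne')
      (fun x hx y hy => norm_sub_le_of_mem_gridCell hh0 hx hy) (isBounded_gridCell hh0 m)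
    rw [volume_gridCell hh0, ← ENNReal.ofReal_inv_of_pos h2] at h1
    have e1 : 2 * ENNReal.ofReal (h ^ 2)⁻¹ = ENNReal.ofReal (2 / h ^ 2) := by
      rw [div_eq_mul_inv, ENNReal.ofReal_mul zero_le_two]
      simp
    rw [e1, Measure.addHaar_closedBall _ _ (by positivity), hvt, finrank_euclideanSpace_fin,
      ← ENNReal.ofReal_mul (by positivity), ← ENNReal.ofReal_mul (by positivity), ← mul_assoc,
      ← ENNReal.ofReal_mul (by positivity)] at h1
    refine h1.trans ?_
    gcongr
    refine le_trans (le_of_eq ?_) hhε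
    field_simp
    ring
  calc A ≤ ∫⁻ x in (⋃ p ∈ t, S p) ∪ ⋃ m ∈ M, gridCell h m, ‖φ x‖ₑ ^ 2 := lintegral_mono_set hcover
    _ ≤ (∫⁻ x in ⋃ p ∈ t, S p, ‖φ x‖ₑ ^ 2) + ∫⁻ x in ⋃ m ∈ M, gridCell h m, ‖φ x‖ₑ ^ 2 :=
        lintegral_union_le _ _ _
    _ ≤ (∑ p ∈ t, ∫⁻ x in S p, ‖φ x‖ₑ ^ 2) + ∑ m ∈ M, ∫⁻ x in gridCell h m, ‖φ x‖ₑ ^ 2 := by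
        have aux : ∀ {ι : Type} (s : Finset ι) (B : ι → Set (Euc 2)),
            ∫⁻ x in ⋃ i ∈ s, B i, ‖φ x‖ₑ ^ 2 ≤ ∑ i ∈ s, ∫⁻ x in B i, ‖φ x‖ₑ ^ 2 := by
          intro ι s B
          induction s using Finset.induction_on with
          | empty => simp
          | insert a s ha ih =>
            rw [Finset.set_biUnion_insert, Finset.sum_insert ha]
            exact (lintegral_union_le _ _ _).trans (by gcongr)
        gcongr
        · exact aux _ _
        · exact aux _ _
    _ ≤ (∑ p ∈ t, (ENNReal.ofReal (2 * τ / ℓ) * A + ENNReal.ofReal (2 * ℓ ^ 2) * G))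
        + ∑ m ∈ M, (ENNReal.ofReal (2 / h ^ 2) * ‖∫ x in gridCell h m, φ x‖ₑ ^ 2
          + ENNReal.ofReal (ε / 2) * ∫⁻ x in gridCell h m, ‖fderiv ℝ φ x‖ₑ ^ 2) := by
        gcongr with p hp m hm
        · exact hstrip p hp
        · exact hcell m hm
    _ ≤ (ENNReal.ofReal ε * A + ENNReal.ofReal (ε / 2) * G)
        + ((∑ m ∈ M, ENNReal.ofReal (2 / h ^ 2) * ‖∫ x in gridCell h m, φ x‖ₑ ^ 2)
          + ENNReal.ofReal (ε / 2) * G) := by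
        refine add_le_add ?_ ?_
        · rw [Finset.sum_const, nsmul_eq_mul, mul_add, ← mul_assoc, ← mul_assoc]
          have hNc : (t.card : ℝ≥0∞) = ENNReal.ofReal N := by simp [hN]
          rw [hNc, ← ENNReal.ofReal_mul hN0, ← ENNReal.ofReal_mul hN0]
          gcongr
        -- The squares are disjoint and contained in `D`, so their gradient integrals add up to at
        -- most `G` however many squares there are. The strips may overlap, which is why their
        -- number enters the choice of `ℓ` and `τ`.
        · rw [Finset.sum_add_distrib, ← Finset.mul_sum, ← Finset.mul_sum, ← lintegral_biUnion_finset]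
          · gcongr
            exact lintegral_mono_set (iUnion₂_subset hMD)
          · intro m _ m' _ hmm
            refine Set.disjoint_left.2 fun x hx hx' => hmm ?_
            rw [← (eq_floor_of_mem_gridCell hh0).1 hx, ← (eq_floor_of_mem_gridCell hh0).1 hx']
          · exact fun m _ => measurableSet_gridCell h m
    _ = _ := by
        have : ENNReal.ofReal ε = ENNReal.ofReal (ε / 2) + ENNReal.ofReal (ε / 2) := by
          rw [← ENNReal.ofReal_add (by positivity) (by positivity), add_halves]
        rw [mul_add (ENNReal.ofReal ε) A G]
        nth_rewrite 3 [this]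
        ring

theorem ofReal_norm_sq_eq_lintegral {d : ℕ} {Ω : Opens (Euc d)} (u : L2 Ω) :
    ENNReal.ofReal (‖u‖ ^ 2) = ∫⁻ x in (Ω : Set (Euc d)), ‖u x‖ₑ ^ 2 := by
  rw [ENNReal.ofReal_pow (norm_nonneg _), ofReal_norm, Lp.enorm_def,
    eLpNorm_eq_lintegral_rpow_enorm_toReal two_ne_zero ENNReal.ofNat_ne_top,
    ← ENNReal.rpow_natCast, ← ENNReal.rpow_mul]
  norm_num

theorem ofReal_norm_restrL2_sq {d : ℕ} {Ω : Opens (Euc d)} {f : Euc d → ℂ}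
    (h : MemLp f 2 (volume.restrict (Ω : Set (Euc d)))) :
    ENNReal.ofReal (‖restrL2 Ω f‖ ^ 2) = ∫⁻ x in (Ω : Set (Euc d)), ‖f x‖ₑ ^ 2 := by
  rw [ofReal_norm_sq_eq_lintegral]
  refine lintegral_congr_ae ?_
  filter_upwards [coeFn_restrL2 h] with x hx
  rw [hx]

theorem enorm_fderiv_sq_le {φ : Euc 2 → ℂ} (x : Euc 2) :
    ‖fderiv ℝ φ x‖ₑ ^ 2 ≤ 2 * ‖pderiv 0 φ x‖ₑ ^ 2 + 2 * ‖pderiv 1 φ x‖ₑ ^ 2 := by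
  have h : ‖fderiv ℝ φ x‖ ≤ ‖pderiv 0 φ x‖ + ‖pderiv 1 φ x‖ := by
    refine ContinuousLinearMap.opNorm_le_bound _ (by positivity) fun v => ?_
    have hv : v = v 0 • EuclideanSpace.single (0 : Fin 2) (1 : ℝ)
        + v 1 • EuclideanSpace.single (1 : Fin 2) (1 : ℝ) := by
      ext i; fin_cases i <;> simp
    have e : fderiv ℝ φ x v = v 0 • pderiv 0 φ x + v 1 • pderiv 1 φ x := by
      conv_lhs => rw [hv]
      rw [map_add, map_smul, map_smul]
      rfl
    rw [e, add_mul]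
    refine (norm_add_le _ _).trans ?_
    rw [norm_smul, norm_smul, mul_comm, mul_comm ‖v 1‖]
    gcongr <;> exact PiLp.norm_apply_le v _
  have h2 : ‖fderiv ℝ φ x‖₊ ^ 2 ≤ 2 * ‖pderiv 0 φ x‖₊ ^ 2 + 2 * ‖pderiv 1 φ x‖₊ ^ 2 := by
    rw [← NNReal.coe_le_coe]
    push_cast
    nlinarith [norm_nonneg (fderiv ℝ φ x), sq_nonneg (‖pderiv 0 φ x‖ - ‖pderiv 1 φ x‖)]
  simp only [enorm_eq_nnnorm]
  exact_mod_cast h2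

/-- The embedding of `H¹₀(D, γ)` in `L²(D)` is small up to operators of finite rank, hence
compact. -/
theorem IsCrossSection.exists_finite_rank {D : Opens (Euc 2)} (hD : IsCrossSection D)
    (γ : Set (Euc 2)) {ε : ℝ} (hε : 0 < ε) :
    ∃ (n : ℕ) (L : L2 D →L[ℂ] EuclideanSpace ℂ (Fin n)), ∀ U ∈ gradGraph D γ,
      ‖U.1‖ ^ 2 ≤ ε * (‖U.1‖ ^ 2 + ‖U.2 0‖ ^ 2 + ‖U.2 1‖ ^ 2) + ‖L U.1‖ ^ 2 := by
  -- Half of `ε` absorbs the factor `2` in `enorm_fderiv_sq_le`. The finite-rank map `L` collects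
  -- the averages over the squares, weighted by `c` so that `‖L u‖²` is the sum in the estimate.
  obtain ⟨M, h, hh, hMD, hM⟩ := hD.lintegral_sq_le (half_pos hε)
  have hfin : ∀ m, volume.restrict (D : Set (Euc 2)) (gridCell h m) ≠ ⊤ := fun m =>
    ((Measure.restrict_apply_le _ _).trans_lt (isBounded_gridCell hh m).measure_lt_top).ne
  set I : (Fin 2 → ℤ) → L2 D := fun m =>
    indicatorConstLp 2 (measurableSet_gridCell h m) (hfin m) (1 : ℂ) with hI
  set c : ℝ := Real.sqrt (2 / h ^ 2) with hc
  have hc2 : c ^ 2 = 2 / h ^ 2 := Real.sq_sqrt (by positivity)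
  set L : L2 D →L[ℂ] EuclideanSpace ℂ (Fin M.card) :=
    (PiLp.continuousLinearEquiv 2 ℂ (fun _ : Fin M.card => ℂ)).symm.toContinuousLinearMap ∘L
      ContinuousLinearMap.pi fun j => (c : ℂ) • innerSL ℂ (I (M.equivFin.symm j)) with hL
  have hLn : ∀ u, ‖L u‖ ^ 2 = ∑ m ∈ M, 2 / h ^ 2 * ‖inner ℂ (I m) u‖ ^ 2 := fun u => by
    rw [EuclideanSpace.norm_sq_eq, ← Finset.sum_coe_sort M, ← M.equivFin.symm.sum_comp]
    refine Finset.sum_congr rfl fun j _ => ?_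
    change ‖(c : ℂ) • inner ℂ (I (M.equivFin.symm j)) u‖ ^ 2 = _
    rw [norm_smul, mul_pow, Complex.norm_real, Real.norm_eq_abs, sq_abs, hc2]
  refine ⟨M.card, L, fun U hU => ?_⟩
  refine gradGraph_induction (p := fun U => ‖U.1‖ ^ 2
    ≤ ε * (‖U.1‖ ^ 2 + ‖U.2 0‖ ^ 2 + ‖U.2 1‖ ^ 2) + ‖L U.1‖ ^ 2) ?_ (fun φ hφ => ?_) hU
  · exact isClosed_le (by fun_prop) (by fun_prop)
  have m0 := memLp_test D hφ.1.continuous hφ.2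
  have m1 := fun i : Fin 2 => memLp_test D (continuous_pderiv i hφ.1)
    (hasCompactSupport_pderiv i hφ.2)
  have hin : ∀ m ∈ M, ‖∫ x in gridCell h m, φ x‖ₑ ^ 2
      = ENNReal.ofReal (‖inner ℂ (I m) (restrL2 D φ)‖ ^ 2) := fun m hm => by
    rw [hI, L2.inner_indicatorConstLp_one, ENNReal.ofReal_pow (norm_nonneg _), ofReal_norm]
    congr 2
    rw [Measure.restrict_restrict (measurableSet_gridCell h m),
      inter_eq_self_of_subset_left (hMD m hm)]
    refine integral_congr_ae ?_
    filter_upwards [ae_restrict_of_ae_restrict_of_subset (hMD m hm) (coeFn_restrL2 m0)] with x hx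
    exact hx.symm
  have key := hM φ hφ.1
  have hG : ∫⁻ x in (D : Set (Euc 2)), ‖fderiv ℝ φ x‖ₑ ^ 2
      ≤ 2 * ENNReal.ofReal (‖restrL2 D (pderiv 0 φ)‖ ^ 2)
        + 2 * ENNReal.ofReal (‖restrL2 D (pderiv 1 φ)‖ ^ 2) := by
    have hmeas : ∀ i : Fin 2, Measurable fun x => ‖pderiv i φ x‖ₑ ^ 2 := fun i =>
      ((ENNReal.continuous_pow 2).comp (continuous_pderiv i hφ.1).enorm).measurable
    rw [ofReal_norm_restrL2_sq (m1 0), ofReal_norm_restrL2_sq (m1 1),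
      ← lintegral_const_mul _ (hmeas 0), ← lintegral_const_mul _ (hmeas 1),
      ← lintegral_add_left ((hmeas 0).const_mul _)]
    exact lintegral_mono fun x => enorm_fderiv_sq_le x
  rw [← ofReal_norm_restrL2_sq m0, Finset.sum_congr rfl fun m hm => by rw [hin m hm]] at key
  have key2 := key.trans (add_le_add (mul_le_mul_right (add_le_add le_rfl hG) _) le_rfl)
  have e2 : ∀ r : ℝ, 2 * ENNReal.ofReal r = ENNReal.ofReal (2 * r) := fun r => by
    rw [ENNReal.ofReal_mul zero_le_two]; simp
  rw [e2, e2,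
    ← ENNReal.ofReal_add (by positivity) (by positivity),
    ← ENNReal.ofReal_add (by positivity) (by positivity), ← ENNReal.ofReal_mul (by positivity),
    Finset.sum_congr rfl fun m _ => (ENNReal.ofReal_mul (by positivity)).symm,
    ← ENNReal.ofReal_sum_of_nonneg (fun m _ => by positivity),
    ← ENNReal.ofReal_add (by positivity) (Finset.sum_nonneg fun m _ => by positivity),
    ENNReal.ofReal_le_ofReal_iff (add_nonneg (by positivity)
      (Finset.sum_nonneg fun m _ => by positivity)), ← hLn] at key2
  change ‖restrL2 D φ‖ ^ 2 ≤ ε * (‖restrL2 D φ‖ ^ 2 + ‖restrL2 D (pderiv 0 φ)‖ ^ 2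
    + ‖restrL2 D (pderiv 1 φ)‖ ^ 2) + ‖L (restrL2 D φ)‖ ^ 2
  nlinarith [sq_nonneg ‖restrL2 D φ‖]

/-! ### Density of the test functions -/

section Density

variable {d : ℕ} {Ω : Opens (Euc d)} {Γ : Set (Euc d)}

theorem isTest_ofReal (hΓ : Disjoint (Ω : Set (Euc d)) Γ) {φ : Euc d → ℝ} (h1 : ContDiff ℝ ∞ φ)
    (h2 : HasCompactSupport φ) (h3 : tsupport φ ⊆ Ω) : IsTest Γ fun x => (φ x : ℂ) := by
  have hs : tsupport (fun x => (φ x : ℂ)) ⊆ tsupport φ :=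
    closure_mono fun x hx hx' => hx (by simp [hx'])
  exact ⟨Complex.ofRealCLM.contDiff.comp h1, h2.comp_left Complex.ofReal_zero,
    hΓ.mono_left (hs.trans h3)⟩

theorem denseRange_gradGraph_fst (hΓ : Disjoint (Ω : Set (Euc d)) Γ) :
    DenseRange (ContinuousLinearMap.fst ℂ (L2 Ω) (Fin d → L2 Ω) ∘L (gradGraph Ω Γ).subtypeL) := by
  set J := ContinuousLinearMap.fst ℂ (L2 Ω) (Fin d → L2 Ω) ∘L (gradGraph Ω Γ).subtypeL with hJ
  have h : Dense (LinearMap.range J.toLinearMap : Set (L2 Ω)) := by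
    rw [Submodule.dense_iff_topologicalClosure_eq_top,
      ← Submodule.orthogonal_eq_bot_iff (K := (LinearMap.range J.toLinearMap).topologicalClosure),
      Submodule.orthogonal_closure, Submodule.eq_bot_iff]
    intro w hw
    refine eq_zero_of_test w fun φ h1 h2 h3 => ?_
    have hT := isTest_ofReal hΓ h1 h2 h3
    have e := (Submodule.mem_orthogonal _ _).1 hw _
      ⟨⟨testGrad Ω _, testGrad_mem_gradGraph hT⟩, rfl⟩
    change inner ℂ (restrL2 Ω fun x => (φ x : ℂ)) w = 0 at e
    rw [← e, L2.inner_def]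
    refine integral_congr_ae ?_
    filter_upwards [coeFn_restrL2 (memLp_test Ω hT.1.continuous hT.2)] with x hx
    rw [hx]
    simp [RCLike.inner_apply, mul_comm]
  simpa [DenseRange, LinearMap.coe_range] using h

/-- Otherwise the constant function `1`, which is in `L²` because `Ω` is bounded, would be
orthogonal to a dense set. -/
theorem exists_gradGraph_fst_ne_zero (hΓ : Disjoint (Ω : Set (Euc d)) Γ)
    (hne : (Ω : Set (Euc d)).Nonempty) (hb : Bornology.IsBounded (Ω : Set (Euc d))) :
    ∃ U : gradGraph Ω Γ, U.1.1 ≠ 0 := by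
  by_contra hcon
  push Not at hcon
  have hvol : volume.restrict (Ω : Set (Euc d)) univ ≠ ⊤ := by
    rw [Measure.restrict_apply_univ]; exact hb.measure_lt_top.ne
  set w : L2 Ω := indicatorConstLp 2 MeasurableSet.univ hvol (1 : ℂ) with hw
  have hw0 : w ≠ 0 := by
    rw [← norm_ne_zero_iff, hw, norm_indicatorConstLp two_ne_zero ENNReal.ofNat_ne_top, norm_one,
      one_mul]
    have : 0 < (volume.restrict (Ω : Set (Euc d))).real univ := by
      rw [Measure.real, Measure.restrict_apply_univ]
      exact ENNReal.toReal_pos (Ω.isOpen.measure_pos volume hne).ne' hb.measure_lt_top.ne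
    positivity
  refine hw0 ((denseRange_gradGraph_fst hΓ).eq_zero_of_inner_left ℂ fun U => ?_)
  change inner ℂ w U.1.1 = 0
  rw [hcon U, inner_zero_right]

end Density

/-! ### The angular derivative -/

section Angular

variable {d : ℕ} {Ω : Opens (Euc d)}

theorem continuous_coord (i : Fin d) : Continuous fun x : Euc d => ((x i : ℝ) : ℂ) :=
  Complex.continuous_ofReal.comp (EuclideanSpace.proj (𝕜 := ℝ) i).continuous

/-- The map `g ↦ xᵢ gⱼ - xⱼ gᵢ` of gradients. -/
def angL2 (i j : Fin d) {C : ℝ} (hi : ∀ x ∈ Ω, ‖((x i : ℝ) : ℂ)‖ ≤ C)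
    (hj : ∀ x ∈ Ω, ‖((x j : ℝ) : ℂ)‖ ≤ C) : (Fin d → L2 Ω) →L[ℂ] L2 Ω :=
  mulL2 Ω _ (continuous_coord i) C hi ∘L ContinuousLinearMap.proj j
    - mulL2 Ω _ (continuous_coord j) C hj ∘L ContinuousLinearMap.proj i

variable {i j : Fin d} {C : ℝ} (hi : ∀ x ∈ Ω, ‖((x i : ℝ) : ℂ)‖ ≤ C)
  (hj : ∀ x ∈ Ω, ‖((x j : ℝ) : ℂ)‖ ≤ C)

theorem angL2_apply (g : Fin d → L2 Ω) :
    angL2 i j hi hj g = mulL2 Ω _ (continuous_coord i) C hi (g j)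
      - mulL2 Ω _ (continuous_coord j) C hj (g i) := rfl

theorem coeFn_angL2 (g : Fin d → L2 Ω) :
    angL2 i j hi hj g =ᵐ[volume.restrict (Ω : Set (Euc d))]
      fun x => ((x i : ℝ) : ℂ) * g j x - ((x j : ℝ) : ℂ) * g i x := by
  filter_upwards [coeFn_mulL2 (continuous_coord i) hi (g j),
    coeFn_mulL2 (continuous_coord j) hj (g i), Lp.coeFn_sub
      (mulL2 Ω _ (continuous_coord i) C hi (g j)) (mulL2 Ω _ (continuous_coord j) C hj (g i))]
    with x h1 h2 h3
  rw [angL2_apply, h3, Pi.sub_apply, h1, h2]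

theorem norm_mulL2_le {a : Euc d → ℂ} (ha : Continuous a)
    (hC : ∀ x ∈ Ω, ‖a x‖ ≤ C) (f : L2 Ω) : ‖mulL2 Ω a ha C hC f‖ ≤ C * ‖f‖ := by
  refine Lp.norm_le_mul_norm_of_ae_le_mul ?_
  filter_upwards [coeFn_mulL2 ha hC f, ae_restrict_mem Ω.isOpen.measurableSet] with x h1 h2
  rw [h1, norm_mul]
  gcongr
  exact hC x h2

theorem norm_angL2_le (g : Fin d → L2 Ω) :
    ‖angL2 i j hi hj g‖ ≤ C * (‖g j‖ + ‖g i‖) := by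
  rw [angL2_apply, mul_add]
  exact (norm_sub_le _ _).trans (add_le_add (norm_mulL2_le _ hi _) (norm_mulL2_le _ hj _))

end Angular

/-! ### The cross-sectional forms -/

section Section

variable {D : Opens (Euc 2)} {C : ℝ} (hC : ∀ i : Fin 2, ∀ x ∈ D, ‖((x i : ℝ) : ℂ)‖ ≤ C)

/-- The map `ψ ↦ (∂₁ψ, ∂₂ψ, (ik + α∂_φ)ψ)`. -/
def sectionMap (α k : ℝ) :
    L2 D × (Fin 2 → L2 D) →L[ℂ] PiLp 2 fun _ : Fin 3 => L2 D :=
  (PiLp.continuousLinearEquiv 2 ℂ fun _ : Fin 3 => L2 D).symm.toContinuousLinearMap ∘L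
    ContinuousLinearMap.pi
      ![ContinuousLinearMap.proj 0 ∘L ContinuousLinearMap.snd ℂ (L2 D) (Fin 2 → L2 D),
        ContinuousLinearMap.proj 1 ∘L ContinuousLinearMap.snd ℂ (L2 D) (Fin 2 → L2 D),
        (Complex.I * k) • ContinuousLinearMap.fst ℂ (L2 D) (Fin 2 → L2 D)
          + (α : ℂ) • (angL2 0 1 (hC 0) (hC 1) ∘L
              ContinuousLinearMap.snd ℂ (L2 D) (Fin 2 → L2 D))]

theorem sectionMap_zero (α k : ℝ) (U : L2 D × (Fin 2 → L2 D)) :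
    sectionMap hC α k U 0 = U.2 0 := rfl

theorem sectionMap_one (α k : ℝ) (U : L2 D × (Fin 2 → L2 D)) :
    sectionMap hC α k U 1 = U.2 1 := rfl

theorem sectionMap_two (α k : ℝ) (U : L2 D × (Fin 2 → L2 D)) :
    sectionMap hC α k U 2 = (Complex.I * k) • U.1 + (α : ℂ) • angL2 0 1 (hC 0) (hC 1) U.2 := rfl

theorem inner_sectionMap (α k : ℝ) (U W : L2 D × (Fin 2 → L2 D)) :
    inner ℂ (sectionMap hC α k U) (sectionMap hC α k W)
      = inner ℂ (U.2 0) (W.2 0) + inner ℂ (U.2 1) (W.2 1)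
        + inner ℂ (sectionMap hC α k U 2) (sectionMap hC α k W 2) := by
  rw [PiLp.inner_apply, Fin.sum_univ_three]
  rfl

theorem norm_sectionMap_sq (α k : ℝ) (U : L2 D × (Fin 2 → L2 D)) :
    ‖sectionMap hC α k U‖ ^ 2
      = ‖U.2 0‖ ^ 2 + ‖U.2 1‖ ^ 2 + ‖sectionMap hC α k U 2‖ ^ 2 := by
  rw [PiLp.norm_sq_eq_of_L2, Fin.sum_univ_three]
  rfl

/-- Changing `k` alters only the third component, by `i (k - k') ψ`. This is what makes the ground
state energy Lipschitz in `k` after taking square roots. -/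
theorem norm_sectionMap_le_add (α k k' : ℝ) (U : L2 D × (Fin 2 → L2 D)) :
    ‖sectionMap hC α k U‖ ≤ ‖sectionMap hC α k' U‖ + |k - k'| * ‖U.1‖ := by
  have h : ‖sectionMap hC α k U - sectionMap hC α k' U‖ = |k - k'| * ‖U.1‖ := by
    have h2 : ‖sectionMap hC α k U - sectionMap hC α k' U‖ ^ 2 = (|k - k'| * ‖U.1‖) ^ 2 := by
      rw [PiLp.norm_sq_eq_of_L2, Fin.sum_univ_three]
      simp only [PiLp.sub_apply, sectionMap_zero, sectionMap_one, sectionMap_two, sub_self,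
        norm_zero]
      rw [add_sub_add_right_eq_sub, ← sub_smul, ← mul_sub, norm_smul, norm_mul, Complex.norm_I,
        one_mul, ← Complex.ofReal_sub, Complex.norm_real, Real.norm_eq_abs]
      ring
    exact (sq_eq_sq₀ (norm_nonneg _) (by positivity)).1 h2
  rw [← h]
  exact norm_le_norm_add_norm_sub' _ _

/-- The lowest eigenvalues `m(k)²` of the cross-sectional operators
`-Δ - (ik + α∂_φ)²` depend continuously on `k` and are unbounded. -/
theorem exists_section_ground_states (hD : IsCrossSection D) {γ : Set (Euc 2)}
    (hγ : Disjoint (D : Set (Euc 2)) γ) (α : ℝ) :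
    ∃ m : ℝ → ℝ, Continuous m ∧ (∀ k, 0 ≤ m k) ∧ (∃ c : ℝ, 0 < c ∧ ∀ k, c * |k| ≤ m k) ∧
      (∀ k, ∀ W ∈ gradGraph D γ, m k * ‖W.1‖ ≤ ‖sectionMap hC α k W‖) ∧
      ∀ k, ∃ U ∈ gradGraph D γ, ‖U.1‖ = 1 ∧ ∀ W ∈ gradGraph D γ,
        inner ℂ (sectionMap hC α k W) (sectionMap hC α k U)
          = ((m k ^ 2 : ℝ) : ℂ) * inner ℂ W.1 U.1 := by
  have hC0 : 0 ≤ C := by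
    obtain ⟨x, hx⟩ := hD.isConnected.nonempty
    exact (norm_nonneg _).trans (hC 0 x hx)
  have hex : ∀ k, ∃ U ∈ gradGraph D γ, ‖U.1‖ = 1 ∧
      (∀ W ∈ gradGraph D γ, ‖sectionMap hC α k U‖ * ‖W.1‖ ≤ ‖sectionMap hC α k W‖) ∧
      ∀ W ∈ gradGraph D γ, inner ℂ (sectionMap hC α k W) (sectionMap hC α k U)
        = ((‖sectionMap hC α k U‖ ^ 2 : ℝ) : ℂ) * inner ℂ W.1 U.1 := by
    intro k
    obtain ⟨U, h1, h2, h3⟩ := exists_form_minimizer_of_compact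
      (ContinuousLinearMap.fst ℂ (L2 D) (Fin 2 → L2 D) ∘L (gradGraph D γ).subtypeL)
      (sectionMap hC α k ∘L (gradGraph D γ).subtypeL) (C := 1)
      (fun U => by
        rw [one_mul]
        change ‖U.1‖ ≤ ‖U.1.1‖ + ‖sectionMap hC α k U.1‖
        refine max_le (le_add_of_nonneg_right (norm_nonneg _)) ?_
        refine le_add_of_nonneg_of_le (norm_nonneg _) ?_
        refine (pi_norm_le_iff_of_nonneg (norm_nonneg _)).2 fun i => ?_
        have := norm_sectionMap_sq hC α k U.1
        refine le_of_sq_le_sq ?_ (norm_nonneg _)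
        rw [this]
        fin_cases i
        · simp only [Fin.zero_eta]; nlinarith [sq_nonneg ‖U.1.2 1‖]
        · simp only [Fin.mk_one]; nlinarith [sq_nonneg ‖U.1.2 0‖])
      (exists_gradGraph_fst_ne_zero hγ hD.isConnected.nonempty hD.isBounded)
      (fun ε hε => by
        obtain ⟨n, L, hL⟩ := hD.exists_finite_rank γ hε
        refine ⟨n, L, fun U => (hL U.1 U.2).trans ?_⟩
        change _ ≤ ε * (‖U.1.1‖ ^ 2 + ‖sectionMap hC α k U.1‖ ^ 2) + ‖L U.1.1‖ ^ 2
        rw [norm_sectionMap_sq]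
        refine add_le_add (mul_le_mul_of_nonneg_left ?_ hε.le) le_rfl
        linarith [sq_nonneg ‖sectionMap hC α k U.1 2‖])
    exact ⟨U.1, U.2, h1, fun W hW => h2 ⟨W, hW⟩, fun W hW => h3 ⟨W, hW⟩⟩
  choose U hU h1 h2 h3 using hex
  refine ⟨fun k => ‖sectionMap hC α k (U k)‖, ?_, fun k => norm_nonneg _,
    ⟨(1 + 2 * |α| * C)⁻¹, by positivity, fun k => ?_⟩, h2, fun k => ⟨U k, hU k, h1 k, h3 k⟩⟩
  -- The normalised minimiser at `k'` is a trial function at `k`; exchanging the roles shows that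
  -- `m` is Lipschitz with constant `1`.
  · have hle : ∀ k k', ‖sectionMap hC α k (U k)‖ ≤ ‖sectionMap hC α k' (U k')‖ + |k - k'| := by
      intro k k'
      have a1 := h2 k (U k') (hU k')
      have a2 := norm_sectionMap_le_add hC α k k' (U k')
      rw [h1, mul_one] at a1 a2
      exact a1.trans a2
    refine (LipschitzWith.of_dist_le_mul (K := 1) fun k k' => ?_).continuous
    rw [NNReal.coe_one, one_mul, Real.dist_eq, Real.dist_eq, abs_le]
    constructor
    · linarith [hle k' k, abs_sub_comm k k']
    · linarith [hle k k']
  -- Linear growth: `|k| = ‖ikψ‖`, and `ikψ` is the third component minus `α∂_φψ`. The former is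
  -- bounded by `s` and the latter by `2 |α| C s`, since `s` also controls `∂₁ψ` and `∂₂ψ`.
  · rw [inv_mul_le_iff₀ (by positivity)]
    set s := ‖sectionMap hC α k (U k)‖ with hs
    have b0 := norm_sectionMap_sq hC α k (U k)
    rw [← hs] at b0
    have b1 : ‖(U k).2 0‖ ≤ s := le_of_sq_le_sq
      (by nlinarith [sq_nonneg ‖(U k).2 1‖, sq_nonneg ‖sectionMap hC α k (U k) 2‖]) (norm_nonneg _)
    have b2 : ‖(U k).2 1‖ ≤ s := le_of_sq_le_sq
      (by nlinarith [sq_nonneg ‖(U k).2 0‖, sq_nonneg ‖sectionMap hC α k (U k) 2‖]) (norm_nonneg _)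
    have b3 : ‖sectionMap hC α k (U k) 2‖ ≤ s := le_of_sq_le_sq
      (by nlinarith [sq_nonneg ‖(U k).2 0‖, sq_nonneg ‖(U k).2 1‖]) (norm_nonneg _)
    have b4 : |k| = ‖(Complex.I * k) • (U k).1‖ := by
      rw [norm_smul, h1, norm_mul, Complex.norm_I, Complex.norm_real, Real.norm_eq_abs]
      ring
    have b5 : (Complex.I * k) • (U k).1
        = sectionMap hC α k (U k) 2 - (α : ℂ) • angL2 0 1 (hC 0) (hC 1) (U k).2 := by
      rw [sectionMap_two, add_sub_cancel_right]
    have b6 : ‖(α : ℂ) • angL2 0 1 (hC 0) (hC 1) (U k).2‖ ≤ |α| * (C * (s + s)) := by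
      rw [norm_smul, Complex.norm_real, Real.norm_eq_abs]
      gcongr
      exact (norm_angL2_le _ _ _).trans (by gcongr)
    rw [b4, b5]
    refine (norm_sub_le _ _).trans ?_
    linarith

theorem isSectionEigenvalue_iff {γ : Set (Euc 2)} (α μ : ℝ) :
    IsSectionEigenvalue D γ α μ ↔ ∃ U ∈ gradGraph D γ, U.1 ≠ 0 ∧ ∀ W ∈ gradGraph D γ,
      inner ℂ (sectionMap hC α 0 W) (sectionMap hC α 0 U) = (μ : ℂ) * inner ℂ W.1 U.1 := by
  have key : ∀ ψ φ : H1 D, inner ℂ (wpderiv 0 φ) (wpderiv 0 ψ)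
      + inner ℂ (wpderiv 1 φ) (wpderiv 1 ψ)
      + (α : ℂ) ^ 2 * ∫ x in (D : Set (Euc 2)), inner ℂ (angDeriv φ x) (angDeriv ψ x)
      = inner ℂ (sectionMap hC α 0 (gradMap D φ)) (sectionMap hC α 0 (gradMap D ψ)) := by
    intro ψ φ
    rw [inner_sectionMap, sectionMap_two, sectionMap_two]
    have e : ∫ x in (D : Set (Euc 2)), inner ℂ (angDeriv φ x) (angDeriv ψ x)
        = inner ℂ (angL2 0 1 (hC 0) (hC 1) (gradMap D φ).2)
          (angL2 0 1 (hC 0) (hC 1) (gradMap D ψ).2) := by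
      rw [L2.inner_def]
      refine integral_congr_ae ?_
      filter_upwards [coeFn_angL2 (hC 0) (hC 1) (gradMap D φ).2,
        coeFn_angL2 (hC 0) (hC 1) (gradMap D ψ).2] with x h1 h2
      rw [h1, h2]
      rfl
    rw [e]
    simp only [Complex.ofReal_zero, mul_zero, zero_smul, zero_add, inner_smul_left,
      inner_smul_right, Complex.conj_ofReal, gradMap_apply]
    ring
  constructor
  · rintro ⟨ψ, hψ, hψ0, h⟩
    refine ⟨gradMap D ψ, ⟨ψ, hψ, rfl⟩, fun h0 => hψ0 (Subtype.ext h0), ?_⟩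
    rintro _ ⟨φ, hφ, rfl⟩
    rw [← key]
    exact h φ hφ
  · rintro ⟨_, ⟨ψ, hψ, rfl⟩, hψ0, h⟩
    refine ⟨ψ, hψ, fun h0 => hψ0 (by rw [h0]; rfl), fun φ hφ => ?_⟩
    rw [key]
    exact h _ ⟨φ, hφ, rfl⟩

end Section

/-! ### Fibres of the tube -/

section Fibre

/-- The point `(x', t)` of `ℝ³`. -/
def liftCLM : Euc 2 × ℝ →L[ℝ] Euc 3 :=
  (EuclideanSpace.equiv (Fin 3) ℝ).symm.toContinuousLinearMap ∘L
    ContinuousLinearMap.pi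
      ![EuclideanSpace.proj (0 : Fin 2) ∘L ContinuousLinearMap.fst ℝ (Euc 2) ℝ,
        EuclideanSpace.proj (1 : Fin 2) ∘L ContinuousLinearMap.fst ℝ (Euc 2) ℝ,
        ContinuousLinearMap.snd ℝ (Euc 2) ℝ]

theorem liftCLM_zero (p : Euc 2 × ℝ) : liftCLM p 0 = p.1 0 := rfl

theorem liftCLM_one (p : Euc 2 × ℝ) : liftCLM p 1 = p.1 1 := rfl

theorem liftCLM_two (p : Euc 2 × ℝ) : liftCLM p 2 = p.2 := rfl

theorem proj_liftCLM (p : Euc 2 × ℝ) : proj (liftCLM p) = p.1 := by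
  ext i
  fin_cases i <;> rfl

theorem liftCLM_proj (x : Euc 3) : liftCLM (proj x, x 2) = x := by
  ext i
  fin_cases i <;> rfl

theorem liftCLM_single (i : Fin 2) :
    liftCLM (EuclideanSpace.single i 1, 0) = EuclideanSpace.single i.castSucc 1 := by
  ext j
  fin_cases i <;> fin_cases j <;> simp [liftCLM_zero, liftCLM_one, liftCLM_two]

theorem liftCLM_single_two : liftCLM (0, 1) = EuclideanSpace.single 2 1 := by
  ext j
  fin_cases j <;> simp [liftCLM_zero, liftCLM_one, liftCLM_two]

theorem measurePreserving_liftCLM : MeasurePreserving liftCLM volume volume := by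
  have h1 := (PiLp.volume_preserving_ofLp (Fin 2)).prod (MeasurePreserving.id (volume : Measure ℝ))
  have h2 := (Measure.measurePreserving_swap (μ := (volume : Measure (Fin 2 → ℝ)))
    (ν := (volume : Measure ℝ)))
  have h3 := (volume_preserving_piFinSuccAbove (fun _ : Fin 3 => ℝ) (Fin.last 2)).symm
  have h4 := PiLp.volume_preserving_toLp (Fin 3)
  have h := h4.comp (h3.comp (h2.comp h1))
  have e : ⇑liftCLM = WithLp.toLp 2 ∘ (MeasurableEquiv.piFinSuccAbove (fun _ : Fin 3 => ℝ)
      (Fin.last 2)).symm ∘ Prod.swap ∘ Prod.map (@WithLp.ofLp 2 (Fin 2 → ℝ)) id := by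
    funext p
    ext j
    fin_cases j <;> rfl
  rw [e]
  exact h

theorem measurePreserving_liftCLM_tube (D : Opens (Euc 2)) :
    MeasurePreserving liftCLM ((volume.restrict (D : Set (Euc 2))).prod volume)
      (volume.restrict (tube D : Set (Euc 3))) := by
  have h := measurePreserving_liftCLM.restrict_preimage (tube D).isOpen.measurableSet
  have e : liftCLM ⁻¹' (tube D : Set (Euc 3)) = (D : Set (Euc 2)) ×ˢ univ := by
    ext p
    change proj (liftCLM p) ∈ D ↔ _
    rw [proj_liftCLM]
    simp
  rw [e] at h
  rwa [Measure.volume_eq_prod, ← Measure.prod_restrict, Measure.restrict_univ] at h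

theorem lintegral_tube {D : Opens (Euc 2)} {F : Euc 3 → ℝ≥0∞}
    (hF : AEMeasurable F (volume.restrict (tube D : Set (Euc 3)))) :
    ∫⁻ x in (tube D : Set (Euc 3)), F x
      = ∫⁻ x in (D : Set (Euc 2)), ∫⁻ t, F (liftCLM (x, t)) := by
  have h := measurePreserving_liftCLM_tube D
  rw [← h.map_eq] at hF ⊢
  rw [lintegral_map' hF h.measurable.aemeasurable]
  exact lintegral_prod _ (hF.comp_measurable h.measurable)

theorem integral_tube {D : Opens (Euc 2)} {F : Euc 3 → ℂ}
    (hF : Integrable F (volume.restrict (tube D : Set (Euc 3)))) :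
    ∫ x in (tube D : Set (Euc 3)), F x
      = ∫ x in (D : Set (Euc 2)), ∫ t, F (liftCLM (x, t)) := by
  have h := measurePreserving_liftCLM_tube D
  rw [← h.map_eq] at hF ⊢
  rw [integral_map h.measurable.aemeasurable hF.1]
  exact integral_prod _ (hF.comp_measurable h.measurable)

/-- Allows almost-everywhere identities on `D` to be pulled back to the tube. The fibres have
infinite length, so the projection is not measure preserving. -/
theorem quasiMeasurePreserving_proj (D : Opens (Euc 2)) :
    Measure.QuasiMeasurePreserving proj (volume.restrict (tube D : Set (Euc 3)))
      (volume.restrict (D : Set (Euc 2))) := by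
  refine ⟨continuous_proj.measurable, ?_⟩
  have h := measurePreserving_liftCLM_tube D
  rw [← h.map_eq, Measure.map_map continuous_proj.measurable h.measurable]
  have e : proj ∘ liftCLM = Prod.fst := funext proj_liftCLM
  rw [e]
  exact Measure.quasiMeasurePreserving_fst.absolutelyContinuous

/-- The integral of `W` along the fibre over `x'`. -/
def fibreInt (W : Euc 3 → ℂ) (x : Euc 2) : ℂ := ∫ t, W (liftCLM (x, t))

theorem isCompact_image_coord {W : Euc 3 → ℂ} (hc : HasCompactSupport W) :
    IsCompact ((fun x : Euc 3 => x 2) '' tsupport W) :=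
  hc.image (EuclideanSpace.proj (𝕜 := ℝ) (2 : Fin 3)).continuous

theorem eq_zero_of_notMem_image_coord {W : Euc 3 → ℂ} {x : Euc 2} {t : ℝ}
    (ht : t ∉ (fun x : Euc 3 => x 2) '' tsupport W) : W (liftCLM (x, t)) = 0 :=
  image_eq_zero_of_notMem_tsupport fun h => ht ⟨_, h, rfl⟩

/-- The fibre integral is a convolution in `x₃` with the constant `1`, evaluated at `0` and
depending on the parameter `x'`; smoothness of such convolutions applies. The reflection `-s` undoes
the one in the convolution. -/
theorem contDiff_fibreInt {W : Euc 3 → ℂ} (h : ContDiff ℝ ∞ W) (hc : HasCompactSupport W) :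
    ContDiff ℝ ∞ (fibreInt W) := by
  have hk := (isCompact_image_coord hc).neg
  have key := contDiffOn_convolution_right_with_param_comp (𝕜 := ℝ) (μ := (volume : Measure ℝ))
    (n := ⊤) (ContinuousLinearMap.lsmul ℝ ℝ : ℝ →L[ℝ] ℂ →L[ℝ] ℂ) (s := (univ : Set (Euc 2)))
    (v := fun _ => (0 : ℝ)) contDiffOn_const (f := fun _ => (1 : ℝ))
    (g := fun p s => W (liftCLM (p, -s))) isOpen_univ hk
    (fun p s _ hs => eq_zero_of_notMem_image_coord fun h' => hs (Set.mem_neg.2 h'))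
    (locallyIntegrable_const 1) (by
      refine ContDiff.contDiffOn ?_
      exact h.comp (liftCLM.contDiff.comp (contDiff_fst.prodMk contDiff_snd.neg)))
  rw [contDiffOn_univ] at key
  convert key using 1
  ext x
  simp [convolution_def, fibreInt]

theorem tsupport_fibreInt_subset {W : Euc 3 → ℂ} (hc : HasCompactSupport W) :
    tsupport (fibreInt W) ⊆ proj '' tsupport W := by
  refine closure_minimal (fun x hx => ?_) (hc.image continuous_proj).isClosed
  by_contra hcon
  refine hx (integral_eq_zero_of_ae (Eventually.of_forall fun t => ?_))
  exact image_eq_zero_of_notMem_tsupport fun h => hcon ⟨_, h, proj_liftCLM _⟩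

/-- The Dirichlet set of the tube is a union of whole fibres, so projecting the support of `W` keeps
it away from `γ`. This is how test functions of the tube are fed into cross-sectional inequalities
and equations. -/
theorem isTest_fibreInt {γ : Set (Euc 2)} {W : Euc 3 → ℂ} (h : IsTest (tubeDirichlet γ) W) :
    IsTest γ (fibreInt W) := by
  refine ⟨contDiff_fibreInt h.1 h.2, HasCompactSupport.of_support_subset_isCompact
    (h.2.image continuous_proj) (subset_closure.trans (tsupport_fibreInt_subset h.2)), ?_⟩
  refine Disjoint.mono_left (tsupport_fibreInt_subset h.2) (Set.disjoint_left.2 ?_)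
  rintro _ ⟨x, hx, rfl⟩ hx'
  exact Set.disjoint_left.1 h.3 hx hx'

theorem integrable_fibre {F : Type*} [NormedAddCommGroup F] {W : Euc 3 → F} (h : Continuous W)
    (hc : HasCompactSupport W) (x : Euc 2) : Integrable fun t => W (liftCLM (x, t)) := by
  refine (h.comp (liftCLM.continuous.comp (by fun_prop))).integrable_of_hasCompactSupport ?_
  refine HasCompactSupport.of_support_subset_isCompact (hc.image
    (EuclideanSpace.proj (𝕜 := ℝ) (2 : Fin 3)).continuous) fun t ht => ?_
  exact ⟨_, subset_closure ht, rfl⟩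

theorem pderiv_fibreInt {W : Euc 3 → ℂ} (h : ContDiff ℝ ∞ W) (hc : HasCompactSupport W)
    (i : Fin 2) : pderiv i (fibreInt W) = fibreInt (pderiv i.castSucc W) := by
  have hcf : Continuous (fderiv ℝ W) := h.continuous_fderiv (by simp)
  have hK := isCompact_image_coord hc
  obtain ⟨M, hM⟩ := hcf.bounded_above_of_compact_support (hc.fderiv ℝ)
  ext x
  set j := liftCLM ∘L ContinuousLinearMap.inl ℝ (Euc 2) ℝ with hj
  have hM0 : 0 ≤ M := (norm_nonneg _).trans (hM 0)
  have hF' : Integrable fun t => (fderiv ℝ W (liftCLM (x, t))).comp j := by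
    have := integrable_fibre hcf (hc.fderiv ℝ) x
    exact ((ContinuousLinearMap.compL ℝ (Euc 2) (Euc 3) ℂ).flip j).integrable_comp this
  have key := hasFDerivAt_integral_of_dominated_of_fderiv_le (𝕜 := ℝ) (μ := (volume : Measure ℝ))
    (F := fun x t => W (liftCLM (x, t))) (F' := fun x t => (fderiv ℝ W (liftCLM (x, t))).comp j)
    (x₀ := x) (s := univ)
    -- All fibres of `W` vanish outside one compact set of heights, which gives a domination uniform
    -- in `x'`.
    (bound := ((fun x : Euc 3 => x 2) '' tsupport W).indicator fun _ => M * ‖j‖) univ_mem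
    (Eventually.of_forall fun y => (integrable_fibre h.continuous hc y).1)
    (integrable_fibre h.continuous hc x) hF'.1
    (Eventually.of_forall fun t y _ => by
      by_cases ht : t ∈ (fun x : Euc 3 => x 2) '' tsupport W
      · rw [indicator_of_mem ht]
        exact (ContinuousLinearMap.opNorm_comp_le _ _).trans
          (mul_le_mul_of_nonneg_right (hM _) (norm_nonneg _))
      · have h0 : fderiv ℝ W (liftCLM (y, t)) = 0 := by
          refine image_eq_zero_of_notMem_tsupport fun h' => ht ⟨_, tsupport_fderiv_subset ℝ h', rfl⟩
        rw [indicator_of_notMem ht, h0, ContinuousLinearMap.zero_comp, norm_zero])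
    ((integrable_indicator_iff hK.measurableSet).2 (integrableOn_const hK.measure_lt_top.ne))
    (Eventually.of_forall fun t y _ => by
      have h1 := (h.differentiable (by simp) (liftCLM (y, t))).hasFDerivAt
      have h2 : HasFDerivAt (fun y : Euc 2 => liftCLM (y, t)) j y :=
        liftCLM.hasFDerivAt.comp y (hasFDerivAt_prodMk_left y t)
      exact h1.comp y h2)
  have key' : HasFDerivAt (fibreInt W) _ x := key
  rw [pderiv, key'.fderiv, ContinuousLinearMap.integral_apply hF']
  refine integral_congr_ae (Eventually.of_forall fun t => ?_)
  simp only [ContinuousLinearMap.comp_apply, pderiv, hj, ContinuousLinearMap.inl_apply,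
    liftCLM_single]

theorem fibreInt_pderiv_two {W : Euc 3 → ℂ} (h : ContDiff ℝ ∞ W) (hc : HasCompactSupport W)
    (x : Euc 2) : fibreInt (pderiv 2 W) x = 0 := by
  refine integral_eq_zero_of_hasDerivAt_of_integrable (f := fun t => W (liftCLM (x, t)))
    (fun t => ?_) (integrable_fibre (continuous_pderiv 2 h) (hasCompactSupport_pderiv 2 hc) x)
    (integrable_fibre h.continuous hc x)
  have h1 := (h.differentiable (by simp) (liftCLM (x, t))).hasFDerivAt
  have h2 : HasDerivAt (fun t => liftCLM (x, t)) (liftCLM (0, 1)) t :=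
    liftCLM.hasFDerivAt.comp_hasDerivAt t ((hasDerivAt_const t x).prodMk (hasDerivAt_id t))
  have := h1.comp_hasDerivAt t h2
  rwa [liftCLM_single_two] at this

end Fibre

/-! ### Products of functions on the cross-section and on the line -/

section Tensor

variable {D : Opens (Euc 2)} {θ : ℝ → ℂ}

theorem continuous_coord_two (hθ : Continuous θ) : Continuous fun x : Euc 3 => θ (x 2) :=
  hθ.comp (EuclideanSpace.proj (𝕜 := ℝ) (2 : Fin 3)).continuous

theorem aestronglyMeasurable_tensor (hθ : Continuous θ) (f : L2 D) :
    AEStronglyMeasurable (fun x => f (proj x) * θ (x 2))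
      (volume.restrict (tube D : Set (Euc 3))) :=
  ((Lp.aestronglyMeasurable f).comp_quasiMeasurePreserving (quasiMeasurePreserving_proj D)).mul
    (continuous_coord_two hθ).aestronglyMeasurable

theorem memLp_tensor (hθ : Continuous θ) (hs : HasCompactSupport θ) (f : L2 D) :
    MemLp (fun x => f (proj x) * θ (x 2)) 2 (volume.restrict (tube D : Set (Euc 3))) := by
  have hm := aestronglyMeasurable_tensor hθ f
  rw [memLp_two_iff_integrable_sq_norm hm]
  refine ((measurePreserving_liftCLM_tube D).integrable_comp (hm.norm.pow 2)).1 ?_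
  have h1 := (memLp_two_iff_integrable_sq_norm (Lp.aestronglyMeasurable f)).1 (Lp.memLp f)
  have h2 := (memLp_two_iff_integrable_sq_norm hθ.aestronglyMeasurable).1
    (hθ.memLp_of_hasCompactSupport (μ := volume) hs)
  refine (h1.mul_prod h2).congr (Eventually.of_forall fun p => ?_)
  simp only [Function.comp_apply, Pi.pow_apply, proj_liftCLM, liftCLM_two, norm_mul, mul_pow]

theorem norm_toLp_tensor (hθ : Continuous θ) (hs : HasCompactSupport θ) (f : L2 D) :
    ‖(memLp_tensor hθ hs f).toLp _‖ = ‖f‖ * (eLpNorm θ 2 volume).toReal := by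
  have hm := aestronglyMeasurable_tensor hθ f
  have key : ∀ {X : Type} [MeasurableSpace X] (μ : Measure X) (g : X → ℂ),
      eLpNorm g 2 μ ^ 2 = ∫⁻ x, ‖g x‖ₑ ^ 2 ∂μ := by
    intro X _ μ g
    rw [eLpNorm_eq_lintegral_rpow_enorm_toReal two_ne_zero ENNReal.ofNat_ne_top,
      ← ENNReal.rpow_natCast, ← ENNReal.rpow_mul]
    simp
  have e : eLpNorm (fun x => f (proj x) * θ (x 2)) 2 (volume.restrict (tube D : Set (Euc 3))) ^ 2
      = (eLpNorm f 2 (volume.restrict (D : Set (Euc 2))) * eLpNorm θ 2 volume) ^ 2 := by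
    rw [mul_pow, key, key, key, lintegral_tube (hm.enorm.pow_const 2)]
    simp only [proj_liftCLM, liftCLM_two, enorm_mul, mul_pow]
    rw [← lintegral_mul_const' _ _ (by
      rw [← key]
      exact ENNReal.pow_ne_top (hθ.memLp_of_hasCompactSupport hs).eLpNorm_ne_top)]
    refine lintegral_congr fun x => ?_
    exact lintegral_const_mul' _ _ (by simp)
  rw [Lp.norm_toLp, Lp.norm_def, ← ENNReal.toReal_mul, (ENNReal.pow_right_strictMono two_ne_zero).injective e]

/-- The product `f(x') θ(x₃)`. -/
def tensorL2 (D : Opens (Euc 2)) (hθ : Continuous θ) (hs : HasCompactSupport θ) :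
    L2 D →L[ℂ] L2 (tube D) :=
  have hmem := memLp_tensor (D := D) hθ hs
  LinearMap.mkContinuous
    { toFun := fun f => (hmem f).toLp _
      map_add' := fun f g => by
        refine Lp.ext ?_
        filter_upwards [(hmem (f + g)).coeFn_toLp, (hmem f).coeFn_toLp, (hmem g).coeFn_toLp,
          (quasiMeasurePreserving_proj D).ae (Lp.coeFn_add f g),
          Lp.coeFn_add ((hmem f).toLp _) ((hmem g).toLp _)] with x h1 h2 h3 h4 h5
        rw [h1, h5, Pi.add_apply, h2, h3, h4, Pi.add_apply, add_mul]
      map_smul' := fun c f => by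
        refine Lp.ext ?_
        filter_upwards [(hmem (c • f)).coeFn_toLp, (hmem f).coeFn_toLp,
          (quasiMeasurePreserving_proj D).ae (Lp.coeFn_smul c f),
          Lp.coeFn_smul c ((hmem f).toLp _)] with x h1 h2 h3 h4
        rw [h1, RingHom.id_apply, h4, Pi.smul_apply, h2, h3, Pi.smul_apply, smul_eq_mul,
          smul_eq_mul, mul_assoc] }
    (eLpNorm θ 2 volume).toReal fun f => by
      rw [mul_comm]
      exact (norm_toLp_tensor hθ hs f).le

variable (hθ : Continuous θ) (hs : HasCompactSupport θ)

theorem coeFn_tensorL2 (f : L2 D) :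
    tensorL2 D hθ hs f =ᵐ[volume.restrict (tube D : Set (Euc 3))]
      fun x => f (proj x) * θ (x 2) := (memLp_tensor hθ hs f).coeFn_toLp

theorem norm_tensorL2 (f : L2 D) :
    ‖tensorL2 D hθ hs f‖ = ‖f‖ * (eLpNorm θ 2 volume).toReal := norm_toLp_tensor hθ hs f

theorem tensorL2_restrL2 {φ : Euc 2 → ℂ} (hφ : Continuous φ) (hc : HasCompactSupport φ)
    {ψ : Euc 3 → ℂ} (h : ∀ x, ψ x = φ (proj x) * θ (x 2)) :
    tensorL2 D hθ hs (restrL2 D φ) = restrL2 (tube D) ψ := by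
  have e := coeFn_restrL2 (memLp_test D hφ hc)
  have e1 := coeFn_tensorL2 hθ hs (restrL2 D φ)
  have e2 := (quasiMeasurePreserving_proj D).ae e
  have e3 : tensorL2 D hθ hs (restrL2 D φ) =ᵐ[volume.restrict (tube D : Set (Euc 3))] ψ := by
    filter_upwards [e1, e2] with x h1 h2
    rw [h1, h2, h]
  refine Lp.ext (e3.trans (coeFn_restrL2 ?_).symm)
  exact (memLp_congr_ae e3).1 (Lp.memLp _)

/-- Fubini: the adjoint of `f ↦ f θ` is integration along the fibres against the conjugate of `θ`.
Scalar products with a product function thereby become scalar products on the cross-section. -/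
theorem inner_restrL2_tensorL2 {W : Euc 3 → ℂ} (hW : ContDiff ℝ ∞ W)
    (hc : HasCompactSupport W) {W' : Euc 3 → ℂ} (hW' : ContDiff ℝ ∞ W')
    (hc' : HasCompactSupport W') (h : ∀ x, W' x = starRingEnd ℂ (θ (x 2)) * W x) (f : L2 D) :
    inner ℂ (restrL2 (tube D) W) (tensorL2 D hθ hs f) = inner ℂ (restrL2 D (fibreInt W')) f := by
  have hcf : HasCompactSupport (fibreInt W') := HasCompactSupport.of_support_subset_isCompact
    (hc'.image continuous_proj) (subset_closure.trans (tsupport_fibreInt_subset hc'))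
  have hi := L2.integrable_inner (𝕜 := ℂ) (restrL2 (tube D) W) (tensorL2 D hθ hs f)
  have e1 : (fun x => inner ℂ (restrL2 (tube D) W x) (tensorL2 D hθ hs f x))
      =ᵐ[volume.restrict (tube D : Set (Euc 3))]
        fun x => f (proj x) * starRingEnd ℂ (W' x) := by
    filter_upwards [coeFn_restrL2 (memLp_test (tube D) hW.continuous hc), coeFn_tensorL2 hθ hs f]
      with x h1 h2
    rw [h1, h2, h, RCLike.inner_apply, map_mul, Complex.conj_conj]
    ring
  rw [L2.inner_def, L2.inner_def, integral_congr_ae e1, integral_tube (hi.congr e1)]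
  refine integral_congr_ae ?_
  filter_upwards [coeFn_restrL2 (memLp_test D (contDiff_fibreInt hW' hc').continuous hcf)]
    with x h1
  simp only [proj_liftCLM]
  rw [h1, RCLike.inner_apply, integral_const_mul, integral_conj]
  rfl

/-- Products of functions of `H¹₀(D, γ)` and test functions belong to `H¹₀(D × ℝ, γ × ℝ)`. -/
theorem tensor_mem_gradGraph {γ : Set (Euc 2)} (hθd : ContDiff ℝ ∞ θ) {θ' : ℝ → ℂ}
    (hθ' : Continuous θ') (hs' : HasCompactSupport θ') (hd : ∀ t, HasDerivAt θ (θ' t) t)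
    {U : L2 D × (Fin 2 → L2 D)} (hU : U ∈ gradGraph D γ) :
    ((tensorL2 D hθ hs U.1, ![tensorL2 D hθ hs (U.2 0), tensorL2 D hθ hs (U.2 1),
      tensorL2 D hθ' hs' U.1]) : L2 (tube D) × (Fin 3 → L2 (tube D)))
        ∈ gradGraph (tube D) (tubeDirichlet γ) := by
  refine gradGraph_induction (p := fun U => ((tensorL2 D hθ hs U.1, ![tensorL2 D hθ hs (U.2 0),
    tensorL2 D hθ hs (U.2 1), tensorL2 D hθ' hs' U.1]) : L2 (tube D) × (Fin 3 → L2 (tube D)))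
        ∈ gradGraph (tube D) (tubeDirichlet γ)) ?_ ?_ hU
  · have hcl : IsClosed (gradGraph (tube D) (tubeDirichlet γ) :
        Set (L2 (tube D) × (Fin 3 → L2 (tube D)))) := by
      rw [coe_gradGraph]; exact isClosed_closure
    refine hcl.preimage (Continuous.prodMk (by fun_prop) (continuous_pi fun i => ?_))
    fin_cases i
    · change Continuous fun x : L2 D × (Fin 2 → L2 D) => tensorL2 D hθ hs (x.2 0); fun_prop
    · change Continuous fun x : L2 D × (Fin 2 → L2 D) => tensorL2 D hθ hs (x.2 1); fun_prop
    · change Continuous fun x : L2 D × (Fin 2 → L2 D) => tensorL2 D hθ' hs' x.1; fun_prop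
  · intro φ hφ
    set ψ : Euc 3 → ℂ := fun x => φ (proj x) * θ (x 2) with hψ
    set P : Euc 3 →L[ℝ] Euc 2 := (EuclideanSpace.equiv (Fin 2) ℝ).symm.toContinuousLinearMap ∘L
      ContinuousLinearMap.pi ![EuclideanSpace.proj (0 : Fin 3), EuclideanSpace.proj (1 : Fin 3)]
      with hP
    have hPp : ∀ x, P x = proj x := fun x => by
      ext i; fin_cases i <;> rfl
    have hψd : ∀ x, HasFDerivAt ψ (φ (proj x) • (ContinuousLinearMap.toSpanSingleton ℝ (θ' (x 2)) ∘L
        EuclideanSpace.proj (2 : Fin 3)) + θ (x 2) • (fderiv ℝ φ (proj x) ∘L P)) x := by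
      intro x
      have h1 : HasFDerivAt (fun x => φ (proj x)) (fderiv ℝ φ (proj x) ∘L P) x := by
        have := ((hφ.1.differentiable (by simp) (P x)).hasFDerivAt).comp x P.hasFDerivAt
        simpa only [hPp, Function.comp_def] using this
      have h2 : HasFDerivAt (fun x : Euc 3 => θ (x 2))
          (ContinuousLinearMap.toSpanSingleton ℝ (θ' (x 2)) ∘L
            EuclideanSpace.proj (2 : Fin 3)) x :=
        (hd (x 2)).hasFDerivAt.comp x (EuclideanSpace.proj (𝕜 := ℝ) (2 : Fin 3)).hasFDerivAt
      exact h1.mul h2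
    have hψt : IsTest (tubeDirichlet γ) ψ := by
      -- The support lies in the compact product of the two supports, which gives both compactness
      -- and the distance from the Dirichlet set.
      have hsub : Function.support ψ ⊆ liftCLM '' (tsupport φ ×ˢ tsupport θ) := fun x hx => by
        refine ⟨(proj x, x 2), ⟨subset_closure fun h0 => hx ?_, subset_closure fun h0 => hx ?_⟩,
          liftCLM_proj x⟩
        · simp [hψ, h0]
        · simp [hψ, h0]
      have hcomp := (hφ.2.isCompact.prod hs.isCompact).image liftCLM.continuous
      refine ⟨?_, HasCompactSupport.of_support_subset_isCompact hcomp hsub, ?_⟩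
      · have h1 : ContDiff ℝ ∞ fun x => φ (proj x) := by
          simpa only [← hPp] using! hφ.1.comp P.contDiff
        exact h1.mul (hθd.comp (EuclideanSpace.proj (𝕜 := ℝ) (2 : Fin 3)).contDiff)
      · refine Set.disjoint_left.2 fun x hx hx' => ?_
        obtain ⟨p, hp, rfl⟩ := closure_minimal hsub hcomp.isClosed hx
        refine Set.disjoint_left.1 hφ.3 hp.1 ?_
        change proj (liftCLM p) ∈ γ at hx'
        rwa [proj_liftCLM] at hx'
    have hmem := testGrad_mem_gradGraph (Ω := tube D) hψt
    convert hmem using 1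
    have hPs : ∀ i : Fin 2, P (EuclideanSpace.single i.castSucc 1) = EuclideanSpace.single i 1 := by
      intro i
      rw [hPp, ← liftCLM_single, proj_liftCLM]
    refine Prod.ext (tensorL2_restrL2 hθ hs hφ.1.continuous hφ.2 fun x => rfl) (funext fun i => ?_)
    fin_cases i
    · refine tensorL2_restrL2 hθ hs (continuous_pderiv 0 hφ.1) (hasCompactSupport_pderiv 0 hφ.2)
        fun x => ?_
      have := hPs 0
      simp only [Fin.castSucc_zero] at this
      simp only [pderiv, (hψd x).fderiv]
      simp [this, mul_comm]
    · refine tensorL2_restrL2 hθ hs (continuous_pderiv 1 hφ.1) (hasCompactSupport_pderiv 1 hφ.2)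
        fun x => ?_
      have := hPs 1
      simp only [Fin.castSucc_one] at this
      simp only [pderiv, (hψd x).fderiv]
      simp [this, mul_comm]
    · refine tensorL2_restrL2 hθ' hs' hφ.1.continuous hφ.2 fun x => ?_
      have : P (EuclideanSpace.single 2 1) = 0 := by
        rw [hPp, ← liftCLM_single_two, proj_liftCLM]
      simp only [pderiv, (hψd x).fderiv]
      simp [this]

end Tensor

/-! ### The form of the twisted tube -/

section TubeMap

variable {D : Opens (Euc 2)} {C : ℝ} (hC : ∀ i : Fin 2, ∀ x ∈ D, ‖((x i : ℝ) : ℂ)‖ ≤ C)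

/-- The map `u ↦ (∂₁u, ∂₂u, (∂₃ + α∂_φ)u)`. -/
def tubeMap (α : ℝ) :
    L2 (tube D) × (Fin 3 → L2 (tube D)) →L[ℂ] PiLp 2 fun _ : Fin 3 => L2 (tube D) :=
  (PiLp.continuousLinearEquiv 2 ℂ fun _ : Fin 3 => L2 (tube D)).symm.toContinuousLinearMap ∘L
    ContinuousLinearMap.pi
      ![ContinuousLinearMap.proj 0 ∘L ContinuousLinearMap.snd ℂ _ (Fin 3 → L2 (tube D)),
        ContinuousLinearMap.proj 1 ∘L ContinuousLinearMap.snd ℂ _ (Fin 3 → L2 (tube D)),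
        ContinuousLinearMap.proj 2 ∘L ContinuousLinearMap.snd ℂ _ (Fin 3 → L2 (tube D))
          + (α : ℂ) • (angL2 0 1 (fun x hx => hC 0 (proj x) hx) (fun x hx => hC 1 (proj x) hx) ∘L
              ContinuousLinearMap.snd ℂ _ (Fin 3 → L2 (tube D)))]

theorem tubeMap_two (α : ℝ) (U : L2 (tube D) × (Fin 3 → L2 (tube D))) :
    tubeMap hC α U 2 = U.2 2 + (α : ℂ) • angL2 0 1 (fun x hx => hC 0 (proj x) hx)
      (fun x hx => hC 1 (proj x) hx) U.2 := rfl

theorem coeFn_tubeMap_two (α : ℝ) (U : L2 (tube D) × (Fin 3 → L2 (tube D))) :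
    tubeMap hC α U 2 =ᵐ[volume.restrict (tube D : Set (Euc 3))] fun x =>
      U.2 2 x + (α : ℂ) * (((x 0 : ℝ) : ℂ) * U.2 1 x - ((x 1 : ℝ) : ℂ) * U.2 0 x) := by
  have h0 : ∀ x ∈ tube D, ‖((x 0 : ℝ) : ℂ)‖ ≤ C := fun x hx => hC 0 (proj x) hx
  have h1 : ∀ x ∈ tube D, ‖((x 1 : ℝ) : ℂ)‖ ≤ C := fun x hx => hC 1 (proj x) hx
  filter_upwards [coeFn_angL2 h0 h1 U.2, Lp.coeFn_smul (α : ℂ) (angL2 0 1 h0 h1 U.2),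
    Lp.coeFn_add (U.2 2) ((α : ℂ) • angL2 0 1 h0 h1 U.2)] with x e1 e2 e3
  rw [tubeMap_two, e3, Pi.add_apply, e2, Pi.smul_apply, e1, smul_eq_mul]

theorem coeFn_sectionMap_two (α k : ℝ) (U : L2 D × (Fin 2 → L2 D)) :
    sectionMap hC α k U 2 =ᵐ[volume.restrict (D : Set (Euc 2))] fun x =>
      Complex.I * k * U.1 x
        + (α : ℂ) * (((x 0 : ℝ) : ℂ) * U.2 1 x - ((x 1 : ℝ) : ℂ) * U.2 0 x) := by
  filter_upwards [coeFn_angL2 (hC 0) (hC 1) U.2,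
    Lp.coeFn_smul (α : ℂ) (angL2 0 1 (hC 0) (hC 1) U.2), Lp.coeFn_smul (Complex.I * k) U.1,
    Lp.coeFn_add ((Complex.I * k) • U.1) ((α : ℂ) • angL2 0 1 (hC 0) (hC 1) U.2)] with x e1 e2 e3 e4
  rw [sectionMap_two, e4, Pi.add_apply, e2, e3, Pi.smul_apply, Pi.smul_apply, e1, smul_eq_mul,
    smul_eq_mul]

theorem inner_tubeMap (α : ℝ) (U W : L2 (tube D) × (Fin 3 → L2 (tube D))) :
    inner ℂ (tubeMap hC α U) (tubeMap hC α W)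
      = inner ℂ (U.2 0) (W.2 0) + inner ℂ (U.2 1) (W.2 1)
        + inner ℂ (tubeMap hC α U 2) (tubeMap hC α W 2) := by
  rw [PiLp.inner_apply, Fin.sum_univ_three]
  rfl

theorem norm_tubeMap_sq (α : ℝ) (U : L2 (tube D) × (Fin 3 → L2 (tube D))) :
    ‖tubeMap hC α U‖ ^ 2 = ‖U.2 0‖ ^ 2 + ‖U.2 1‖ ^ 2 + ‖tubeMap hC α U 2‖ ^ 2 := by
  rw [PiLp.norm_sq_eq_of_L2, Fin.sum_univ_three]
  rfl

/-- The function `(∂₃ + α∂_φ)u`. -/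
def twistPderiv (α : ℝ) (u : Euc 3 → ℂ) (x : Euc 3) : ℂ :=
  pderiv 2 u x + (α : ℂ) * (((x 0 : ℝ) : ℂ) * pderiv 1 u x - ((x 1 : ℝ) : ℂ) * pderiv 0 u x)

theorem continuous_twistPderiv (α : ℝ) {u : Euc 3 → ℂ} (h : ContDiff ℝ ∞ u) :
    Continuous (twistPderiv α u) :=
  (continuous_pderiv 2 h).add (continuous_const.mul
    (((continuous_coord 0).mul (continuous_pderiv 1 h)).sub
      ((continuous_coord 1).mul (continuous_pderiv 0 h))))

theorem hasCompactSupport_twistPderiv (α : ℝ) {u : Euc 3 → ℂ} (hc : HasCompactSupport u) :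
    HasCompactSupport (twistPderiv α u) :=
  (hasCompactSupport_pderiv 2 hc).add (HasCompactSupport.mul_left
    (((hasCompactSupport_pderiv 1 hc).mul_left).sub ((hasCompactSupport_pderiv 0 hc).mul_left)))

theorem tubeMap_two_testGrad (α : ℝ) {u : Euc 3 → ℂ} (h : ContDiff ℝ ∞ u)
    (hc : HasCompactSupport u) :
    tubeMap hC α (testGrad (tube D) u) 2 = restrL2 (tube D) (twistPderiv α u) := by
  have e := fun i => coeFn_restrL2 (memLp_test (tube D) (continuous_pderiv i h)
    (hasCompactSupport_pderiv i hc))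
  refine Lp.ext ?_
  filter_upwards [coeFn_tubeMap_two hC α (testGrad (tube D) u), e 0, e 1, e 2,
    coeFn_restrL2 (memLp_test (tube D) (continuous_twistPderiv α h)
      (hasCompactSupport_twistPderiv α hc))] with x h1 h2 h3 h4 h5
  rw [h1, h5]
  simp only [testGrad, h2, h3, h4, twistPderiv]

end TubeMap

/-! ### The diamagnetic inequality along the fibres -/

section Diamagnetic

theorem sq_integral_inner_le {u v : ℝ → ℂ} (hu : MemLp u 2) (hv : MemLp v 2) :
    (∫ t, inner ℝ (u t) (v t)) ^ 2 ≤ (∫ t, ‖u t‖ ^ 2) * ∫ t, ‖v t‖ ^ 2 := by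
  have key : ∀ {f : ℝ → ℂ} (hf : MemLp f 2), ‖hf.toLp f‖ ^ 2 = ∫ t, ‖f t‖ ^ 2 := by
    intro f hf
    rw [← real_inner_self_eq_norm_sq, L2.inner_def]
    refine integral_congr_ae ?_
    filter_upwards [hf.coeFn_toLp] with t ht
    rw [ht, real_inner_self_eq_norm_sq]
  have e : ∫ t, inner ℝ (u t) (v t) = inner ℝ (hu.toLp u) (hv.toLp v) := by
    rw [L2.inner_def]
    refine integral_congr_ae ?_
    filter_upwards [hu.coeFn_toLp, hv.coeFn_toLp] with t h1 h2
    rw [h1, h2]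
  rw [← key hu, ← key hv, e, ← mul_pow, sq_le_sq, abs_of_nonneg (a := ‖_‖ * ‖_‖) (by positivity)]
  exact abs_real_inner_le_norm _ _

variable {u : Euc 3 → ℂ}

/-- The squared norm of `u` along the fibre over `x'`. -/
def fibreSq (u : Euc 3 → ℂ) (x : Euc 2) : ℝ := ∫ t, ‖u (liftCLM (x, t))‖ ^ 2

theorem fibreSq_nonneg (x : Euc 2) : 0 ≤ fibreSq u x := integral_nonneg fun _ => by positivity

theorem contDiff_ofReal_norm_sq (hu : ContDiff ℝ ∞ u) :
    ContDiff ℝ ∞ fun x => ((‖u x‖ ^ 2 : ℝ) : ℂ) :=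
  Complex.ofRealCLM.contDiff.comp (hu.norm_sq ℝ)

theorem hasCompactSupport_ofReal_norm_sq (hc : HasCompactSupport u) :
    HasCompactSupport fun x => ((‖u x‖ ^ 2 : ℝ) : ℂ) :=
  hc.comp_left (g := fun z : ℂ => ((‖z‖ ^ 2 : ℝ) : ℂ)) (by simp)

theorem hasCompactSupport_norm_sq (hc : HasCompactSupport u) :
    HasCompactSupport fun x => ‖u x‖ ^ 2 :=
  hc.comp_left (g := fun z : ℂ => ‖z‖ ^ 2) (by simp)

theorem fibreInt_ofReal_norm_sq (x : Euc 2) :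
    fibreInt (fun x => ((‖u x‖ ^ 2 : ℝ) : ℂ)) x = (fibreSq u x : ℂ) := integral_ofReal

theorem contDiff_fibreSq (hu : ContDiff ℝ ∞ u) (hc : HasCompactSupport u) :
    ContDiff ℝ ∞ (fibreSq u) := by
  have := Complex.reCLM.contDiff.comp (contDiff_fibreInt (contDiff_ofReal_norm_sq hu)
    (hasCompactSupport_ofReal_norm_sq hc))
  convert this using 1
  ext x
  rw [Function.comp_apply, fibreInt_ofReal_norm_sq]
  rfl

theorem pderiv_ofReal {d : ℕ} {f : Euc d → ℝ} (hf : ContDiff ℝ ∞ f) (i : Fin d) (x : Euc d) :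
    pderiv i (fun x => (f x : ℂ)) x = ((pderiv i f x : ℝ) : ℂ) := by
  have e : fderiv ℝ (fun x => (f x : ℂ)) x = Complex.ofRealCLM.comp (fderiv ℝ f x) :=
    (Complex.ofRealCLM.hasFDerivAt.comp x (hf.differentiable (by simp) x).hasFDerivAt).fderiv
  rw [pderiv, e]
  rfl

theorem pderiv_norm_sq (hu : ContDiff ℝ ∞ u) (i : Fin 3) (x : Euc 3) :
    pderiv i (fun x => ‖u x‖ ^ 2) x = 2 * inner ℝ (u x) (pderiv i u x) := by
  rw [pderiv, ((hu.differentiable (by simp) x).hasFDerivAt.norm_sq).fderiv]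
  simp [pderiv]
  ring

theorem pderiv_fibreSq (hu : ContDiff ℝ ∞ u) (hc : HasCompactSupport u) (i : Fin 2) (x : Euc 2) :
    pderiv i (fibreSq u) x
      = 2 * ∫ t, inner ℝ (u (liftCLM (x, t))) (pderiv i.castSucc u (liftCLM (x, t))) := by
  have h := congrFun (pderiv_fibreInt (contDiff_ofReal_norm_sq hu)
    (hasCompactSupport_ofReal_norm_sq hc) i) x
  have e : fibreInt (fun x => ((‖u x‖ ^ 2 : ℝ) : ℂ)) = fun x => (fibreSq u x : ℂ) :=
    funext fibreInt_ofReal_norm_sq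
  rw [e, pderiv_ofReal (contDiff_fibreSq hu hc)] at h
  have h2 : fibreInt (pderiv i.castSucc fun x => ((‖u x‖ ^ 2 : ℝ) : ℂ)) x
      = ((2 * ∫ t, inner ℝ (u (liftCLM (x, t))) (pderiv i.castSucc u (liftCLM (x, t))) : ℝ) : ℂ) := by
    rw [← integral_const_mul, ← integral_complex_ofReal]
    refine integral_congr_ae (Eventually.of_forall fun t => ?_)
    simp only [pderiv_ofReal (hu.norm_sq ℝ), pderiv_norm_sq hu]
  rw [h2] at h
  exact_mod_cast h

/-- The integrand is `½ ∂₃|u|²`, a derivative along the fibre of a compactly supported function.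
Because of this, `∂₃` is invisible in the derivatives of the fibre norm. -/
theorem integral_inner_pderiv_two (hu : ContDiff ℝ ∞ u) (hc : HasCompactSupport u) (x : Euc 2) :
    ∫ t, inner ℝ (u (liftCLM (x, t))) (pderiv 2 u (liftCLM (x, t))) = 0 := by
  have h := fibreInt_pderiv_two (contDiff_ofReal_norm_sq hu)
    (hasCompactSupport_ofReal_norm_sq hc) x
  have h2 : fibreInt (pderiv 2 fun x => ((‖u x‖ ^ 2 : ℝ) : ℂ)) x
      = ((2 * ∫ t, inner ℝ (u (liftCLM (x, t))) (pderiv 2 u (liftCLM (x, t))) : ℝ) : ℂ) := by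
    rw [← integral_const_mul, ← integral_complex_ofReal]
    refine integral_congr_ae (Eventually.of_forall fun t => ?_)
    simp only [pderiv_ofReal (hu.norm_sq ℝ), pderiv_norm_sq hu]
  rw [h2] at h
  have h3 : 2 * ∫ t, inner ℝ (u (liftCLM (x, t))) (pderiv 2 u (liftCLM (x, t))) = 0 := by
    exact_mod_cast h
  linarith

/-- The smoothed fibrewise norm `(‖u(x', ·)‖² + ε²)^{1/2} - ε`. -/
def fibreNorm (ε : ℝ) (u : Euc 3 → ℂ) (x : Euc 2) : ℝ := √(fibreSq u x + ε ^ 2) - ε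

theorem contDiff_fibreNorm {ε : ℝ} (hε : 0 < ε) (hu : ContDiff ℝ ∞ u) (hc : HasCompactSupport u) :
    ContDiff ℝ ∞ (fibreNorm ε u) := by
  refine ContDiff.sub (ContDiff.sqrt ((contDiff_fibreSq hu hc).add contDiff_const) fun x => ?_)
    contDiff_const
  have := fibreSq_nonneg (u := u) x
  positivity

/-- The fibre norm itself need not be smooth at its zeros. Adding `ε²` under the root makes it
smooth, and subtracting `ε` makes it vanish again wherever the fibre norm does, so it remains an
admissible trial function on the cross-section. -/
theorem isTest_fibreNorm {γ : Set (Euc 2)} {ε : ℝ} (hε : 0 < ε)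
    (hu : IsTest (tubeDirichlet γ) u) : IsTest γ fun x => (fibreNorm ε u x : ℂ) := by
  have hW : IsTest (tubeDirichlet γ) fun x => ((‖u x‖ ^ 2 : ℝ) : ℂ) :=
    ⟨contDiff_ofReal_norm_sq hu.1, hasCompactSupport_ofReal_norm_sq hu.2,
      hu.3.mono_left (closure_mono fun x hx (hx' : u x = 0) => hx (by simp [hx']))⟩
  have hT := isTest_fibreInt hW
  have hsub : Function.support (fun x => (fibreNorm ε u x : ℂ))
      ⊆ Function.support (fibreInt fun x => ((‖u x‖ ^ 2 : ℝ) : ℂ)) := by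
    intro x hx hx'
    rw [fibreInt_ofReal_norm_sq, Complex.ofReal_eq_zero] at hx'
    refine hx ?_
    simp [fibreNorm, hx', Real.sqrt_sq hε.le]
  exact ⟨Complex.ofRealCLM.contDiff.comp (contDiff_fibreNorm hε hu.1 hu.2), hT.2.mono hsub,
    hT.3.mono_left (closure_mono hsub)⟩

theorem pderiv_fibreNorm {ε : ℝ} (hε : 0 < ε) (hu : ContDiff ℝ ∞ u) (hc : HasCompactSupport u)
    (i : Fin 2) (x : Euc 2) :
    pderiv i (fibreNorm ε u) x = pderiv i (fibreSq u) x / (2 * √(fibreSq u x + ε ^ 2)) := by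
  have h0 := fibreSq_nonneg (u := u) x
  have h1 := ((((contDiff_fibreSq hu hc).differentiable (by simp) x).hasFDerivAt.add_const
    (ε ^ 2)).sqrt (by positivity)).sub_const ε
  have h2 : HasFDerivAt (fibreNorm ε u) _ x := h1
  rw [pderiv, h2.fderiv]
  simp [pderiv]
  ring

/-- Cauchy–Schwarz on the fibre gives `z² ≤ fibreSq u x · ∫ |v|²`, and enlarging the denominator by
`ε²` only helps. It is applied with `v` equal to `∂₁u`, `∂₂u` and `(∂₃ + α∂_φ)u`. -/
theorem enorm_sq_le_lintegral_fibre {ε : ℝ} (hε : 0 < ε) (hu : Continuous u)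
    (hc : HasCompactSupport u) {v : Euc 3 → ℂ} (hv : Continuous v) (hvc : HasCompactSupport v)
    (x : Euc 2) {z : ℝ} (hz : z = ∫ t, inner ℝ (u (liftCLM (x, t))) (v (liftCLM (x, t)))) :
    ‖((z / √(fibreSq u x + ε ^ 2) : ℝ) : ℂ)‖ₑ ^ 2 ≤ ∫⁻ t, ‖v (liftCLM (x, t))‖ₑ ^ 2 := by
  have h0 := fibreSq_nonneg (u := u) x
  have hmem : ∀ {w : Euc 3 → ℂ}, Continuous w → HasCompactSupport w →
      MemLp (fun t => w (liftCLM (x, t))) 2 := fun {w} hw hwc => by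
    have hi := integrable_fibre (W := fun y => ‖w y‖ ^ 2) (hw.norm.pow 2)
      (hasCompactSupport_norm_sq hwc) x
    refine (memLp_two_iff_integrable_sq_norm ?_).2 hi
    exact (hw.comp (liftCLM.continuous.comp (by fun_prop))).aestronglyMeasurable
  have hi := integrable_fibre (W := fun y => ‖v y‖ ^ 2) (hv.norm.pow 2)
    (hasCompactSupport_norm_sq hvc) x
  have e : ∫⁻ t, ‖v (liftCLM (x, t))‖ₑ ^ 2
      = ENNReal.ofReal (∫ t, ‖v (liftCLM (x, t))‖ ^ 2) := by
    rw [ofReal_integral_eq_lintegral_ofReal hi (Eventually.of_forall fun t => by positivity)]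
    refine lintegral_congr fun t => ?_
    rw [ENNReal.ofReal_pow (norm_nonneg _), ofReal_norm]
  rw [e, ← ofReal_norm, ← ENNReal.ofReal_pow (norm_nonneg _)]
  refine ENNReal.ofReal_le_ofReal ?_
  have hcs := sq_integral_inner_le (hmem hu hc) (hmem hv hvc)
  rw [← hz] at hcs
  have hI : 0 ≤ ∫ t, ‖v (liftCLM (x, t))‖ ^ 2 := integral_nonneg fun _ => by positivity
  rw [Complex.norm_real, Real.norm_eq_abs, sq_abs, div_pow, Real.sq_sqrt (by positivity),
    div_le_iff₀ (by positivity)]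
  change z ^ 2 ≤ fibreSq u x * _ at hcs
  nlinarith [mul_nonneg hI (sq_nonneg ε)]

end Diamagnetic

/-! ### The lower bound for the form of the tube -/

section LowerBound

variable {D : Opens (Euc 2)} {C : ℝ} (hC : ∀ i : Fin 2, ∀ x ∈ D, ‖((x i : ℝ) : ℂ)‖ ≤ C)

theorem sectionMap_two_testGrad_ae (α k : ℝ) {φ : Euc 2 → ℂ} (h : ContDiff ℝ ∞ φ)
    (hc : HasCompactSupport φ) :
    sectionMap hC α k (testGrad D φ) 2 =ᵐ[volume.restrict (D : Set (Euc 2))] fun x =>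
      Complex.I * k * φ x
        + (α : ℂ) * (((x 0 : ℝ) : ℂ) * pderiv 1 φ x - ((x 1 : ℝ) : ℂ) * pderiv 0 φ x) := by
  have e := fun i => coeFn_restrL2 (memLp_test D (continuous_pderiv i h)
    (hasCompactSupport_pderiv i hc))
  filter_upwards [coeFn_sectionMap_two hC α k (testGrad D φ), e 0, e 1,
    coeFn_restrL2 (memLp_test D h.continuous hc)] with x h1 h2 h3 h4
  rw [h1]
  simp only [testGrad, h2, h3, h4]

/-- The diamagnetic inequality, proved component by component: each derivative of the smoothed fibre
norm is the real pairing of `u` with the corresponding derivative of `u`, divided by the regularised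
norm. At `k = 0` this also covers the twisted component. -/
theorem norm_sectionMap_fibreNorm_le (α : ℝ) {ε : ℝ} (hε : 0 < ε) {u : Euc 3 → ℂ}
    (hu : ContDiff ℝ ∞ u) (hc : HasCompactSupport u)
    (hN : HasCompactSupport fun x => (fibreNorm ε u x : ℂ)) :
    ‖sectionMap hC α 0 (testGrad D fun x => (fibreNorm ε u x : ℂ))‖ ^ 2
      ≤ ‖tubeMap hC α (testGrad (tube D) u)‖ ^ 2 := by
  have hNd : ContDiff ℝ ∞ fun x => (fibreNorm ε u x : ℂ) :=
    Complex.ofRealCLM.contDiff.comp (contDiff_fibreNorm hε hu hc)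
  have hp : ∀ (i : Fin 2) (x : Euc 2), pderiv i (fun x => (fibreNorm ε u x : ℂ)) x
      = (((∫ t, inner ℝ (u (liftCLM (x, t))) (pderiv i.castSucc u (liftCLM (x, t))))
          / √(fibreSq u x + ε ^ 2) : ℝ) : ℂ) := by
    intro i x
    rw [pderiv_ofReal (contDiff_fibreNorm hε hu hc), pderiv_fibreNorm hε hu hc,
      pderiv_fibreSq hu hc, mul_div_mul_left _ _ two_ne_zero]
  have hle : ∀ {f : L2 D} {g : L2 (tube D)} {v : Euc 3 → ℂ}, Continuous v →
      g =ᵐ[volume.restrict (tube D : Set (Euc 3))] v →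
      (∀ᵐ x ∂volume.restrict (D : Set (Euc 2)), ‖f x‖ₑ ^ 2 ≤ ∫⁻ t, ‖v (liftCLM (x, t))‖ₑ ^ 2) →
      ‖f‖ ^ 2 ≤ ‖g‖ ^ 2 := by
    intro f g v hv hg hf
    rw [← ENNReal.ofReal_le_ofReal_iff (by positivity), ofReal_norm_sq_eq_lintegral,
      ofReal_norm_sq_eq_lintegral]
    have : ∫⁻ x in (tube D : Set (Euc 3)), ‖g x‖ₑ ^ 2
        = ∫⁻ x in (tube D : Set (Euc 3)), ‖v x‖ₑ ^ 2 := by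
      refine lintegral_congr_ae ?_
      filter_upwards [hg] with x hx
      rw [hx]
    rw [this, lintegral_tube (hv.enorm.measurable.pow_const 2).aemeasurable]
    exact lintegral_mono_ae hf
  have hi : ∀ i : Fin 2, ‖(testGrad D fun x => (fibreNorm ε u x : ℂ)).2 i‖ ^ 2
      ≤ ‖(testGrad (tube D) u).2 i.castSucc‖ ^ 2 := by
    intro i
    refine hle (continuous_pderiv i.castSucc hu) (coeFn_restrL2 (memLp_test (tube D)
      (continuous_pderiv _ hu) (hasCompactSupport_pderiv _ hc))) ?_
    filter_upwards [coeFn_restrL2 (memLp_test D (continuous_pderiv i hNd)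
      (hasCompactSupport_pderiv i hN))] with x hx
    change ‖restrL2 D _ x‖ₑ ^ 2 ≤ _
    rw [hx, hp]
    exact enorm_sq_le_lintegral_fibre hε hu.continuous hc (continuous_pderiv _ hu)
      (hasCompactSupport_pderiv _ hc) x rfl
  rw [norm_sectionMap_sq, norm_tubeMap_sq]
  refine add_le_add (add_le_add (hi 0) (hi 1)) ?_
  rw [tubeMap_two_testGrad hC α hu hc]
  have hcT := continuous_twistPderiv α hu
  have hsT := hasCompactSupport_twistPderiv α hc
  refine hle hcT (coeFn_restrL2 (memLp_test (tube D) hcT hsT)) ?_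
  filter_upwards [sectionMap_two_testGrad_ae hC α 0 hNd hN] with x hx
  -- The missing term `∫ Re(ū ∂₃u) dt` is zero, so it may be added to complete `α∂_φ u` to `(∂₃ +
  -- α∂_φ)u`. The coordinates `x 0`, `x 1` are constant on the fibre.
  have hz : α * (x 0 * (∫ t, inner ℝ (u (liftCLM (x, t))) (pderiv 1 u (liftCLM (x, t))))
      - x 1 * ∫ t, inner ℝ (u (liftCLM (x, t))) (pderiv 0 u (liftCLM (x, t))))
      = ∫ t, inner ℝ (u (liftCLM (x, t))) (twistPderiv α u (liftCLM (x, t))) := by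
    have hint : ∀ i : Fin 3, Integrable fun t =>
        inner ℝ (u (liftCLM (x, t))) (pderiv i u (liftCLM (x, t))) := fun i =>
      integrable_fibre (W := fun y => inner ℝ (u y) (pderiv i u y))
        (hu.continuous.inner (continuous_pderiv i hu))
        (hc.mono fun y hy hy' => hy (by simp [hy'])) x
    have e2 := integral_inner_pderiv_two hu hc x
    have hsum : Integrable fun t => α * (x 0 * inner ℝ (u (liftCLM (x, t)))
        (pderiv 1 u (liftCLM (x, t))) - x 1 * inner ℝ (u (liftCLM (x, t)))
          (pderiv 0 u (liftCLM (x, t)))) :=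
      (((hint 1).const_mul _).sub ((hint 0).const_mul _)).const_mul _
    rw [← integral_const_mul, ← integral_const_mul, ← integral_sub ((hint 1).const_mul _)
      ((hint 0).const_mul _), ← integral_const_mul, ← zero_add (∫ _, α * _), ← e2,
      ← integral_add (hint 2) hsum]
    refine integral_congr_ae (Eventually.of_forall fun t => ?_)
    simp only [twistPderiv, liftCLM_zero, liftCLM_one, inner_add_right, ← Complex.real_smul,
      inner_smul_right, inner_sub_right]
  have key := enorm_sq_le_lintegral_fibre hε hu.continuous hc hcT hsT x hz
  refine le_trans (le_of_eq ?_) key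
  rw [hx, hp, hp]
  congr 2
  push_cast
  ring

/-- Dominated convergence: with `g = fibreSq u x`, one has `(√(g + ε²) - ε)² ≤ g`, and `g` is
integrable over `D` with integral `‖u‖²`. -/
theorem tendsto_lintegral_fibreNorm {u : Euc 3 → ℂ} (hu : ContDiff ℝ ∞ u)
    (hc : HasCompactSupport u) :
    Tendsto (fun ε : ℝ => ∫⁻ x in (D : Set (Euc 2)), ‖(fibreNorm ε u x : ℂ)‖ₑ ^ 2) (𝓝[>] 0)
      (𝓝 (∫⁻ x in (tube D : Set (Euc 3)), ‖u x‖ₑ ^ 2)) := by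
  have e : ∀ x : Euc 2, ∫⁻ t, ‖u (liftCLM (x, t))‖ₑ ^ 2 = ENNReal.ofReal (fibreSq u x) := by
    intro x
    have hi := integrable_fibre (W := fun y => ‖u y‖ ^ 2) (hu.continuous.norm.pow 2)
      (hasCompactSupport_norm_sq hc) x
    rw [fibreSq, ofReal_integral_eq_lintegral_ofReal hi (Eventually.of_forall fun t => by positivity)]
    refine lintegral_congr fun t => ?_
    rw [ENNReal.ofReal_pow (norm_nonneg _), ofReal_norm]
  have e' : ∀ z : ℝ, ‖(z : ℂ)‖ₑ ^ 2 = ENNReal.ofReal (z ^ 2) := by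
    intro z
    rw [← ofReal_norm, ← ENNReal.ofReal_pow (norm_nonneg _), Complex.norm_real, Real.norm_eq_abs,
      sq_abs]
  have hcu := (hu.continuous.enorm.measurable.pow_const 2).aemeasurable
    (μ := volume.restrict (tube D : Set (Euc 3)))
  have hfin : ∫⁻ x in (D : Set (Euc 2)), ENNReal.ofReal (fibreSq u x) ≠ ⊤ := by
    simp only [← e]
    rw [← lintegral_tube hcu, ← ofReal_norm_restrL2_sq (memLp_test (tube D) hu.continuous hc)]
    exact ENNReal.ofReal_ne_top
  rw [lintegral_tube hcu]
  simp only [e, e']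
  have hG := (contDiff_fibreSq hu hc).continuous
  refine tendsto_lintegral_filter_of_dominated_convergence
    (fun x => ENNReal.ofReal (fibreSq u x)) ?_ ?_ hfin ?_
  · refine Eventually.of_forall fun ε => ENNReal.measurable_ofReal.comp ?_
    exact ((((hG.add continuous_const).sqrt).sub continuous_const).pow 2).measurable
  · filter_upwards [self_mem_nhdsWithin] with ε hε
    refine Eventually.of_forall fun x => ENNReal.ofReal_le_ofReal ?_
    have hε : 0 < ε := hε
    have h0 := fibreSq_nonneg (u := u) x
    have h1 : ε ≤ √(fibreSq u x + ε ^ 2) := Real.le_sqrt_of_sq_le (by linarith)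
    have h2 := Real.sq_sqrt (show 0 ≤ fibreSq u x + ε ^ 2 by positivity)
    rw [fibreNorm]
    nlinarith
  · refine Eventually.of_forall fun x => (ENNReal.continuous_ofReal.tendsto _).comp ?_
    have : Continuous fun ε : ℝ => fibreNorm ε u x ^ 2 := by unfold fibreNorm; fun_prop
    have h := this.tendsto 0
    simp only [fibreNorm, ne_eq, OfNat.ofNat_ne_zero, not_false_eq_true, zero_pow, add_zero,
      sub_zero, Real.sq_sqrt (fibreSq_nonneg (u := u) x)] at h
    exact h.mono_left nhdsWithin_le_nhds

/-- The form of the tube is bounded below by the lowest cross-sectional eigenvalue. -/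
theorem le_norm_tubeMap {γ : Set (Euc 2)} {α m : ℝ} (hm0 : 0 ≤ m)
    (hm : ∀ W ∈ gradGraph D γ, m * ‖W.1‖ ≤ ‖sectionMap hC α 0 W‖)
    {U : L2 (tube D) × (Fin 3 → L2 (tube D))}
    (hU : U ∈ gradGraph (tube D) (tubeDirichlet γ)) : m * ‖U.1‖ ≤ ‖tubeMap hC α U‖ := by
  refine gradGraph_induction (p := fun U => m * ‖U.1‖ ≤ ‖tubeMap hC α U‖)
    (isClosed_le (by fun_prop) (by fun_prop)) (fun u hu => ?_) hU
  refine le_of_sq_le_sq ?_ (norm_nonneg _)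
  rw [mul_pow, ← ENNReal.ofReal_le_ofReal_iff (by positivity), ENNReal.ofReal_mul (by positivity)]
  change _ * ENNReal.ofReal (‖restrL2 (tube D) u‖ ^ 2) ≤ _
  rw [ofReal_norm_restrL2_sq (memLp_test (tube D) hu.1.continuous hu.2)]
  -- The form bound for the smoothed fibre norm has a right-hand side independent of `ε`, so letting
  -- `ε → 0` recovers `‖u‖²` on the left.
  refine le_of_tendsto (ENNReal.Tendsto.const_mul (tendsto_lintegral_fibreNorm hu.1 hu.2)
    (Or.inr ENNReal.ofReal_ne_top)) ?_
  filter_upwards [self_mem_nhdsWithin] with ε hε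
  have hε : 0 < ε := hε
  have hT := isTest_fibreNorm hε hu
  have h1 := hm _ (testGrad_mem_gradGraph hT)
  rw [← ofReal_norm_restrL2_sq (memLp_test D hT.1.continuous hT.2),
    ← ENNReal.ofReal_mul (by positivity), ← mul_pow]
  refine ENNReal.ofReal_le_ofReal ?_
  refine le_trans (pow_le_pow_left₀ (by positivity) h1 2) ?_
  exact norm_sectionMap_fibreNorm_le hC α hε hu.1 hu.2 hT.2

end LowerBound

/-! ### Approximate eigenfunctions of the tube -/

section Weyl

theorem toReal_eLpNorm_two_sq {f : ℝ → ℂ} (hf : MemLp f 2 volume) :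
    (eLpNorm f 2 volume).toReal ^ 2 = ∫ t, ‖f t‖ ^ 2 := by
  rw [← Lp.norm_toLp f hf, ← real_inner_self_eq_norm_sq, L2.inner_def]
  refine integral_congr_ae ?_
  filter_upwards [hf.coeFn_toLp] with t ht
  rw [ht, real_inner_self_eq_norm_sq]

/-- Slowly varying cut-off functions. -/
theorem exists_cutoff {δ : ℝ} (hδ : 0 < δ) :
    ∃ χ : ℝ → ℝ, ContDiff ℝ ∞ χ ∧ HasCompactSupport χ ∧ ∫ t, χ t ^ 2 = 1 ∧
      ∫ t, deriv χ t ^ 2 ≤ δ := by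
  obtain ⟨b⟩ : Nonempty (ContDiffBump (0 : ℝ)) := ⟨⟨1, 2, by norm_num, by norm_num⟩⟩
  have hb : ContDiff ℝ ∞ b := b.contDiff
  have hbc : HasCompactSupport b := b.hasCompactSupport
  set I := ∫ t, b t ^ 2 with hI
  set K := ∫ t, deriv b t ^ 2 with hK
  have hI0 : 0 < I := by
    refine (hb.continuous.pow 2).integral_pos_of_hasCompactSupport_nonneg_nonzero
      (x := 0) ?_ (fun t => by positivity) ?_
    · exact hbc.comp_left (g := fun z : ℝ => z ^ 2) (by simp)
    · have : b 0 = 1 := b.one_of_mem_closedBall (by simp [b.rIn_pos.le])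
      simp [this]
  have hK0 : 0 ≤ K := integral_nonneg fun _ => by positivity
  -- Dilating the bump by `n` divides the ratio of `∫ (χ')²` to `∫ χ²` by `n²`.
  obtain ⟨n, hn⟩ : ∃ n : ℝ, 0 < n ∧ K / I ≤ n ^ 2 * δ := by
    refine ⟨K / I / δ + 1, by positivity, ?_⟩
    have h0 : 0 ≤ K / I / δ := by positivity
    rw [← div_le_iff₀ hδ]
    nlinarith
  obtain ⟨hn0, hn⟩ := hn
  set c := (√(n * I))⁻¹ with hc
  have hc2 : c ^ 2 = (n * I)⁻¹ := by rw [hc, inv_pow, Real.sq_sqrt (by positivity)]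
  have hd : ∀ t, deriv (fun t => c * b (t / n)) t = c / n * deriv b (t / n) := by
    intro t
    have h1 : HasDerivAt (fun t : ℝ => t / n) (1 / n) t := (hasDerivAt_id t).div_const n
    have h2 := ((hb.differentiable (by simp) (t / n)).hasDerivAt.comp t h1).const_mul c
    have h3 : HasDerivAt (fun t => c * b (t / n)) (c * (deriv b (t / n) * (1 / n))) t := h2
    rw [h3.deriv]
    ring
  refine ⟨fun t => c * b (t / n), contDiff_const.mul (hb.comp (contDiff_id.div_const n)), ?_, ?_, ?_⟩
  · refine HasCompactSupport.mul_left ?_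
    have := hbc.comp_homeomorph (Homeomorph.mulRight₀ n⁻¹ (by positivity))
    simpa [Function.comp_def, div_eq_mul_inv] using! this
  · simp only [mul_pow]
    rw [integral_const_mul, Measure.integral_comp_div (fun t => b t ^ 2) n, ← hI, hc2,
      abs_of_pos hn0, smul_eq_mul]
    field_simp
  · simp only [hd, mul_pow]
    rw [integral_const_mul, Measure.integral_comp_div (fun t => deriv b t ^ 2) n, ← hK, div_pow,
      hc2, abs_of_pos hn0, smul_eq_mul]
    have e : (n * I)⁻¹ / n ^ 2 * (n * K) = K / I / n ^ 2 := by field_simp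
    rw [e, div_le_iff₀ (by positivity), mul_comm]
    exact hn

/-- Normalised, slowly modulated plane waves. -/
theorem exists_wave (k : ℝ) {δ : ℝ} (hδ : 0 < δ) :
    ∃ θ ρ : ℝ → ℂ, ContDiff ℝ ∞ θ ∧ HasCompactSupport θ ∧ ContDiff ℝ ∞ ρ ∧ HasCompactSupport ρ ∧
      (∀ t, HasDerivAt θ (Complex.I * k * θ t + ρ t) t) ∧ (eLpNorm θ 2 volume).toReal = 1 ∧
      (eLpNorm ρ 2 volume).toReal ≤ δ := by
  -- The wave is `θ = χ e^{ikt}`, with error `ρ = χ' e^{ikt}`; `exists_cutoff` bounds the square of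
  -- the norm of `χ'`, hence `δ²`.
  obtain ⟨χ, h1, h2, h3, h4⟩ := exists_cutoff (sq_pos_of_pos hδ)
  set e : ℝ → ℂ := fun t => Complex.exp (((k * t : ℝ) : ℂ) * Complex.I) with he
  have hed : ∀ t, HasDerivAt e (Complex.I * k * e t) t := by
    intro t
    have a1 : HasDerivAt (fun t : ℝ => (((k * t : ℝ) : ℂ) * Complex.I)) (k * Complex.I) t := by
      have := ((hasDerivAt_id t).const_mul k).ofReal_comp.mul_const Complex.I
      simpa using this
    convert a1.cexp using 1
    ring
  have hec : ContDiff ℝ ∞ e := by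
    refine ContDiff.cexp ?_
    exact (Complex.ofRealCLM.contDiff.comp (contDiff_const.mul contDiff_id)).mul contDiff_const
  have hen : ∀ t, ‖e t‖ = 1 := fun t => Complex.norm_exp_ofReal_mul_I _
  have hd : ContDiff ℝ ∞ (deriv χ) := (contDiff_infty_iff_deriv.1 h1).2
  have hdc : HasCompactSupport (deriv χ) := h2.deriv
  have hχ : ∀ {f : ℝ → ℝ}, ContDiff ℝ ∞ f → HasCompactSupport f →
      ContDiff ℝ ∞ (fun t => (f t : ℂ) * e t) ∧ HasCompactSupport (fun t => (f t : ℂ) * e t) ∧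
        (eLpNorm (fun t => (f t : ℂ) * e t) 2 volume).toReal ^ 2 = ∫ t, f t ^ 2 := by
    intro f hf hfc
    have b1 : ContDiff ℝ ∞ (fun t => (f t : ℂ) * e t) := (Complex.ofRealCLM.contDiff.comp hf).mul hec
    have b2 : HasCompactSupport (fun t => (f t : ℂ) * e t) :=
      HasCompactSupport.mul_right (hfc.comp_left Complex.ofReal_zero)
    refine ⟨b1, b2, ?_⟩
    rw [toReal_eLpNorm_two_sq (b1.continuous.memLp_of_hasCompactSupport b2)]
    simp [hen]
  refine ⟨fun t => (χ t : ℂ) * e t, fun t => ((deriv χ t : ℝ) : ℂ) * e t, (hχ h1 h2).1, (hχ h1 h2).2.1,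
    (hχ hd hdc).1, (hχ hd hdc).2.1, fun t => ?_, ?_, ?_⟩
  · refine (((h1.differentiable (by simp) t).hasDerivAt.ofReal_comp).mul (hed t)).congr_deriv ?_
    ring
  · have := (hχ h1 h2).2.2
    rw [h3] at this
    exact (pow_eq_one_iff_of_nonneg ENNReal.toReal_nonneg two_ne_zero).1 this
  · exact le_of_sq_le_sq ((hχ hd hdc).2.2.trans_le h4) hδ.le

variable {η : ℝ → ℂ} {w : Euc 3 → ℂ}

theorem isTest_coord_two_mul {Γ : Set (Euc 3)} (hη : ContDiff ℝ ∞ η) (hw : IsTest Γ w) :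
    IsTest Γ fun x => η (x 2) * w x :=
  ⟨(hη.comp (EuclideanSpace.proj (𝕜 := ℝ) (2 : Fin 3)).contDiff).mul hw.1, hw.2.mul_left,
    hw.3.mono_left (tsupport_mul_subset_right (f := fun x : Euc 3 => η (x 2)))⟩

theorem pderiv_coord_two_mul {η' : ℝ → ℂ} (hη : ∀ t, HasDerivAt η (η' t) t) (hw : ContDiff ℝ ∞ w)
    (i : Fin 3) (x : Euc 3) : pderiv i (fun x => η (x 2) * w x) x
      = η (x 2) * pderiv i w x + (if i = 2 then η' (x 2) * w x else 0) := by
  have h2 : HasFDerivAt (fun x : Euc 3 => η (x 2))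
      (ContinuousLinearMap.toSpanSingleton ℝ (η' (x 2)) ∘L EuclideanSpace.proj (2 : Fin 3)) x :=
    (hη (x 2)).hasFDerivAt.comp x (EuclideanSpace.proj (𝕜 := ℝ) (2 : Fin 3)).hasFDerivAt
  have h3 : HasFDerivAt (fun x => η (x 2) * w x) _ x :=
    h2.mul ((hw.differentiable (by simp) x).hasFDerivAt)
  rw [pderiv, h3.fderiv]
  fin_cases i <;> simp [pderiv, mul_comm]

/-- The action of `∂₃ + α∂_φ` under integration along the fibres against a modulated wave. -/
theorem fibreInt_twistPderiv (α k : ℝ) {ρ : ℝ → ℂ} (hη : ContDiff ℝ ∞ η) (hρ : ContDiff ℝ ∞ ρ)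
    (hd : ∀ t, HasDerivAt η (-(Complex.I * k * η t) + ρ t) t) {Γ : Set (Euc 3)}
    (hw : IsTest Γ w) (x : Euc 2) :
    fibreInt (fun y => η (y 2) * twistPderiv α w y) x
      = Complex.I * k * fibreInt (fun y => η (y 2) * w y) x
        + (α : ℂ) * (((x 0 : ℝ) : ℂ) * pderiv 1 (fibreInt fun y => η (y 2) * w y) x
          - ((x 1 : ℝ) : ℂ) * pderiv 0 (fibreInt fun y => η (y 2) * w y) x)
        - fibreInt (fun y => ρ (y 2) * w y) x := by
  have hT := isTest_coord_two_mul hη hw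
  have hR := isTest_coord_two_mul hρ hw
  set V : Euc 3 → ℂ := fun y => η (y 2) * w y with hV
  have i0 := integrable_fibre hT.1.continuous hT.2 x
  have iR := integrable_fibre hR.1.continuous hR.2 x
  have ip := fun i => integrable_fibre (continuous_pderiv i hT.1) (hasCompactSupport_pderiv i hT.2) x
  have e0 := pderiv_fibreInt hT.1 hT.2 0
  have e1 := pderiv_fibreInt hT.1 hT.2 1
  have e2 := fibreInt_pderiv_two hT.1 hT.2 x
  simp only [Fin.castSucc_zero, Fin.castSucc_one] at e0 e1
  -- The inserted zero is the fibre integral of `∂₃(ηw)`. As `∂₃(ηw) = η∂₃w + (-ikη + ρ)w`, it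
  -- converts `η∂₃w` into `ikηw - ρw`.
  rw [e0, e1, ← add_zero (Complex.I * k * _), ← e2]
  simp only [fibreInt]
  have iA : Integrable fun t => Complex.I * k * V (liftCLM (x, t)) := i0.const_mul _
  have iB : Integrable fun t => Complex.I * k * V (liftCLM (x, t)) + pderiv 2 V (liftCLM (x, t)) :=
    iA.add (ip 2)
  have iC1 : Integrable fun t => ((x 0 : ℝ) : ℂ) * pderiv 1 V (liftCLM (x, t)) := (ip 1).const_mul _
  have iC0 : Integrable fun t => ((x 1 : ℝ) : ℂ) * pderiv 0 V (liftCLM (x, t)) := (ip 0).const_mul _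
  have iC : Integrable fun t => (α : ℂ) * (((x 0 : ℝ) : ℂ) * pderiv 1 V (liftCLM (x, t))
      - ((x 1 : ℝ) : ℂ) * pderiv 0 V (liftCLM (x, t))) := (iC1.sub iC0).const_mul _
  have iD : Integrable fun t => Complex.I * k * V (liftCLM (x, t)) + pderiv 2 V (liftCLM (x, t))
      + (α : ℂ) * (((x 0 : ℝ) : ℂ) * pderiv 1 V (liftCLM (x, t))
        - ((x 1 : ℝ) : ℂ) * pderiv 0 V (liftCLM (x, t))) := iB.add iC
  rw [← integral_const_mul (Complex.I * (k : ℂ)), ← integral_add iA (ip 2),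
    ← integral_const_mul ((x 0 : ℝ) : ℂ), ← integral_const_mul ((x 1 : ℝ) : ℂ),
    ← integral_sub iC1 iC0, ← integral_const_mul (α : ℂ), ← integral_add iB iC,
    ← integral_sub iD iR]
  refine integral_congr_ae (Eventually.of_forall fun t => ?_)
  simp only [hV, pderiv_coord_two_mul hd hw.1, twistPderiv, liftCLM_zero, liftCLM_one, liftCLM_two]
  simp
  ring

end Weyl

/-! ### Ground states times plane waves as approximate eigenfunctions. -/

section WeylSequence

variable {D : Opens (Euc 2)} {C : ℝ} (hC : ∀ i : Fin 2, ∀ x ∈ D, ‖((x i : ℝ) : ℂ)‖ ≤ C)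

/-- Every cross-sectional eigenvalue at frequency `k` is an approximate eigenvalue of the tube. -/
theorem exists_approximate_eigenfunction {γ : Set (Euc 2)} {α k μ : ℝ}
    {U : L2 D × (Fin 2 → L2 D)} (hU : U ∈ gradGraph D γ) (hU1 : ‖U.1‖ = 1)
    (h : ∀ W ∈ gradGraph D γ,
      inner ℂ (sectionMap hC α k W) (sectionMap hC α k U) = (μ : ℂ) * inner ℂ W.1 U.1)
    {ε : ℝ} (hε : 0 < ε) :
    ∃ v ∈ gradGraph (tube D) (tubeDirichlet γ), ‖v.1‖ = 1 ∧
      ∀ w ∈ gradGraph (tube D) (tubeDirichlet γ),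
        ‖inner ℂ (tubeMap hC α w) (tubeMap hC α v) - μ * inner ℂ w.1 v.1‖
          ≤ ε * (‖w.1‖ + ‖tubeMap hC α w‖) := by
  set B := sectionMap hC α k U 2 with hB
  -- The final error consists of `ρ` multiplied by `U.1`, of norm `1`, and by `B`; this `δ` makes
  -- both at most `ε`.
  obtain ⟨θ, ρ, hθ, hθc, hρ, hρc, hd, hθ1, hρ1⟩ :=
    exists_wave k (δ := ε / (‖B‖ + 1)) (by positivity)
  have hθ' : Continuous fun t => Complex.I * k * θ t + ρ t := by
    have := hθ.continuous
    have := hρ.continuous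
    fun_prop
  have hθc' : HasCompactSupport fun t => Complex.I * k * θ t + ρ t := hθc.mul_left.add hρc
  set A := tensorL2 D hθ.continuous hθc with hA
  set A' := tensorL2 D hθ' hθc' with hA'
  set R := tensorL2 D hρ.continuous hρc with hR
  set v : L2 (tube D) × (Fin 3 → L2 (tube D)) := (A U.1, ![A (U.2 0), A (U.2 1), A' U.1]) with hv
  -- `(∂₃ + α∂_φ)(ψθ) = θ (ik + α∂_φ)ψ + ρψ`: up to the small term with `ρ`, the derivative along
  -- the tube acts as the frequency `k`.
  have hv2 : tubeMap hC α v 2 = A B + R U.1 := by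
    refine Lp.ext ?_
    have q := quasiMeasurePreserving_proj D
    filter_upwards [coeFn_tubeMap_two hC α v, coeFn_tensorL2 hθ.continuous hθc (U.2 0),
      coeFn_tensorL2 hθ.continuous hθc (U.2 1), coeFn_tensorL2 hθ' hθc' U.1,
      coeFn_tensorL2 hθ.continuous hθc B, coeFn_tensorL2 hρ.continuous hρc U.1,
      q.ae (coeFn_sectionMap_two hC α k U), Lp.coeFn_add (A B) (R U.1)]
      with x a1 a2 a3 a4 a5 a6 a7 a8
    have b0 : v.2 0 x = U.2 0 (proj x) * θ (x 2) := a2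
    have b1 : v.2 1 x = U.2 1 (proj x) * θ (x 2) := a3
    have b2 : v.2 2 x = U.1 (proj x) * (Complex.I * k * θ (x 2) + ρ (x 2)) := a4
    have p0 : (proj x) 0 = x 0 := rfl
    have p1 : (proj x) 1 = x 1 := rfl
    rw [a1, b0, b1, b2, a8, Pi.add_apply, a5, a6, a7, p0, p1]
    ring
  have hvm : v ∈ gradGraph (tube D) (tubeDirichlet γ) :=
    tensor_mem_gradGraph hθ.continuous hθc hθ hθ' hθc' hd hU
  refine ⟨v, hvm, ?_, fun w hw => ?_⟩
  · change ‖A U.1‖ = 1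
    rw [hA, norm_tensorL2, hU1, hθ1, one_mul]
  refine gradGraph_induction
    (p := fun w => ‖inner ℂ (tubeMap hC α w) (tubeMap hC α v) - μ * inner ℂ w.1 v.1‖
          ≤ ε * (‖w.1‖ + ‖tubeMap hC α w‖))
    (isClosed_le (by fun_prop) (by fun_prop)) (fun w hw => ?_) hw
  set η : ℝ → ℂ := fun t => starRingEnd ℂ (θ t) with hη
  set σ : ℝ → ℂ := fun t => starRingEnd ℂ (ρ t) with hσ
  have hηs : ContDiff ℝ ∞ η := Complex.conjCLE.contDiff.comp hθ
  have hσs : ContDiff ℝ ∞ σ := Complex.conjCLE.contDiff.comp hρ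
  have hηd : ∀ t, HasDerivAt η (-(Complex.I * k * η t) + σ t) t := by
    intro t
    refine ((Complex.conjCLE : ℂ →L[ℝ] ℂ).hasFDerivAt.comp_hasDerivAt t (hd t)).congr_deriv ?_
    simp [hη, hσ]
  have hT := isTest_coord_two_mul hηs hw
  have hS := isTest_coord_two_mul hσs hw
  have hP := isTest_fibreInt hT
  have hQ := isTest_fibreInt hS
  -- `P` is the component of `w` along the wave `θ`. It is a test function on the cross-section, so
  -- the eigenvalue equation for `U` may be tested with it.
  set P := fibreInt fun x => η (x 2) * w x with hPdef
  set Q := fibreInt fun x => σ (x 2) * w x with hQdef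
  have hi : ∀ (i : Fin 2) (f : L2 D), inner ℂ (restrL2 (tube D) (pderiv i.castSucc w)) (A f)
      = inner ℂ (restrL2 D (pderiv i P)) f := by
    intro i f
    rw [hPdef, pderiv_fibreInt hT.1 hT.2]
    have hcd : ContDiff ℝ ∞ (pderiv i.castSucc w) :=
      (hw.1.fderiv_right (m := ∞) (by simp)).clm_apply contDiff_const
    have e : pderiv i.castSucc (fun x => η (x 2) * w x)
        = fun x => η (x 2) * pderiv i.castSucc w x := by
      funext x
      rw [pderiv_coord_two_mul hηd hw.1, if_neg (by fin_cases i <;> decide), add_zero]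
    rw [e]
    exact inner_restrL2_tensorL2 _ _ hcd (hasCompactSupport_pderiv _ hw.2)
      ((hηs.comp (EuclideanSpace.proj (𝕜 := ℝ) (2 : Fin 3)).contDiff).mul hcd)
      (hasCompactSupport_pderiv _ hw.2).mul_left (fun x => rfl) f
  have hW : ∀ f : L2 D, inner ℂ (restrL2 (tube D) w) (A f) = inner ℂ (restrL2 D P) f := fun f =>
    inner_restrL2_tensorL2 _ _ hw.1 hw.2 hT.1 hT.2 (fun x => rfl) f
  have hWρ : ∀ f : L2 D, inner ℂ (restrL2 (tube D) w) (R f) = inner ℂ (restrL2 D Q) f := fun f =>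
    inner_restrL2_tensorL2 _ _ hw.1 hw.2 hS.1 hS.2 (fun x => rfl) f
  have htw : ContDiff ℝ ∞ (twistPderiv α w) := by
    have hcd : ∀ i, ContDiff ℝ ∞ (pderiv i w) := fun i =>
      (hw.1.fderiv_right (m := ∞) (by simp)).clm_apply contDiff_const
    have hco : ∀ i : Fin 3, ContDiff ℝ ∞ fun x : Euc 3 => ((x i : ℝ) : ℂ) := fun i =>
      Complex.ofRealCLM.contDiff.comp (EuclideanSpace.proj (𝕜 := ℝ) i).contDiff
    exact (hcd 2).add (contDiff_const.mul (((hco 0).mul (hcd 1)).sub ((hco 1).mul (hcd 0))))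
  have htc := hasCompactSupport_twistPderiv α hw.2
  have hM : ∀ f : L2 D, inner ℂ (tubeMap hC α (testGrad (tube D) w) 2) (A f)
      = inner ℂ (sectionMap hC α k (testGrad D P) 2) f - inner ℂ (restrL2 (tube D) w) (R f) := by
    intro f
    have htT : ContDiff ℝ ∞ fun x : Euc 3 => η (x 2) * twistPderiv α w x :=
      (hηs.comp (EuclideanSpace.proj (𝕜 := ℝ) (2 : Fin 3)).contDiff).mul htw
    rw [tubeMap_two_testGrad hC α hw.1 hw.2, inner_restrL2_tensorL2 _ _ htw htc htT htc.mul_left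
      (fun x => rfl) f, hWρ, ← inner_sub_left]
    congr 1
    have hc : HasCompactSupport (fibreInt fun x : Euc 3 => η (x 2) * twistPderiv α w x) :=
      HasCompactSupport.of_support_subset_isCompact (htc.mul_left.image continuous_proj)
        (subset_closure.trans (tsupport_fibreInt_subset htc.mul_left))
    refine Lp.ext ?_
    filter_upwards [coeFn_restrL2 (memLp_test D
      (contDiff_fibreInt htT htc.mul_left).continuous hc), sectionMap_two_testGrad_ae hC α k hP.1 hP.2,
      coeFn_restrL2 (memLp_test D hQ.1.continuous hQ.2),
      Lp.coeFn_sub (sectionMap hC α k (testGrad D P) 2) (restrL2 D Q)] with x a1 a2 a3 a4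
    rw [a1, a4, Pi.sub_apply, a2, a3]
    exact fibreInt_twistPderiv α k hηs hσs hηd hw x
  have hmain := h _ (testGrad_mem_gradGraph (Ω := D) hP)
  rw [inner_sectionMap, ← hB] at hmain
  -- All terms without `ρ` assemble into the cross-sectional eigenvalue equation tested with `P` and
  -- cancel.
  have e : inner ℂ (tubeMap hC α (testGrad (tube D) w)) (tubeMap hC α v)
        - μ * inner ℂ (testGrad (tube D) w).1 v.1
      = inner ℂ (tubeMap hC α (testGrad (tube D) w) 2) (R U.1)
        - inner ℂ (restrL2 (tube D) w) (R B) := by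
    rw [inner_tubeMap, hv2, inner_add_right, hM]
    have a0 : inner ℂ ((testGrad (tube D) w).2 0) (v.2 0)
      = inner ℂ ((testGrad D P).2 0) (U.2 0) := hi 0 _
    have a1 : inner ℂ ((testGrad (tube D) w).2 1) (v.2 1)
      = inner ℂ ((testGrad D P).2 1) (U.2 1) := hi 1 _
    have a2 : inner ℂ (testGrad (tube D) w).1 v.1 = inner ℂ (testGrad D P).1 U.1 := hW _
    rw [a0, a1, a2, ← hmain]
    ring
  rw [e]
  set S := tubeMap hC α (testGrad (tube D) w) with hSdef
  have hS2 : ‖S 2‖ ≤ ‖S‖ := PiLp.norm_apply_le S 2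
  have hr0 : 0 ≤ (eLpNorm ρ 2 volume).toReal := ENNReal.toReal_nonneg
  have c1 : ‖inner ℂ (S 2) (R U.1)‖ ≤ ‖S‖ * (eLpNorm ρ 2 volume).toReal := by
    refine (norm_inner_le_norm _ _).trans ?_
    rw [hR, norm_tensorL2, hU1, one_mul]
    gcongr
  have c2 : ‖inner ℂ (restrL2 (tube D) w) (R B)‖
      ≤ ‖restrL2 (tube D) w‖ * (‖B‖ * (eLpNorm ρ 2 volume).toReal) := by
    refine (norm_inner_le_norm _ _).trans ?_
    rw [hR, norm_tensorL2]
  rw [le_div_iff₀ (by positivity)] at hρ1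
  change _ ≤ ε * (‖restrL2 (tube D) w‖ + ‖S‖)
  refine (norm_sub_le _ _).trans ((add_le_add c1 c2).trans ?_)
  have d1 : (eLpNorm ρ 2 volume).toReal ≤ ε := by
    nlinarith [mul_nonneg hr0 (norm_nonneg B)]
  have d2 : ‖B‖ * (eLpNorm ρ 2 volume).toReal ≤ ε := by linarith
  rw [mul_add, add_comm, mul_comm ε, mul_comm ε]
  exact add_le_add (mul_le_mul_of_nonneg_left d2 (norm_nonneg _))
    (mul_le_mul_of_nonneg_left d1 (norm_nonneg _))

end WeylSequence

/-! ### The operator of the twisted tube -/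

section Operator

variable {D : Opens (Euc 2)} {γ : Set (Euc 2)}

theorem IsFiniteUnionOfArcs.subset_frontier (h : IsFiniteUnionOfArcs D γ) :
    γ ⊆ frontier (D : Set (Euc 2)) := by
  obtain ⟨n, A, hA, rfl⟩ := h
  refine iUnion_subset fun j => ?_
  obtain ⟨c, -, -, h1, -, h2⟩ := hA j
  exact h2.trans h1

theorem disjoint_of_subset_frontier {X : Type*} [TopologicalSpace X] {U : Opens X} {S : Set X}
    (h : S ⊆ frontier (U : Set X)) : Disjoint (U : Set X) S :=
  (disjoint_of_subset_left h (by rw [U.isOpen.frontier_eq]; exact disjoint_sdiff_left)).symm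

theorem exists_coord_bound {d : ℕ} {Ω : Opens (Euc d)}
    (h : Bornology.IsBounded (Ω : Set (Euc d))) :
    ∃ C : ℝ, ∀ i : Fin d, ∀ x ∈ Ω, ‖((x i : ℝ) : ℂ)‖ ≤ C := by
  obtain ⟨C, hC⟩ := isBounded_iff_forall_norm_le.1 h
  refine ⟨C, fun i x hx => ?_⟩
  rw [Complex.norm_real]
  exact (PiLp.norm_apply_le x i).trans (hC x hx)

variable {C : ℝ} (hC : ∀ i : Fin 2, ∀ x ∈ D, ‖((x i : ℝ) : ℂ)‖ ≤ C) {α : ℝ} {β : ℝ → ℝ}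

include hC in
theorem twistDeriv_ae_eq (hα : ∀ z, deriv β z = α) (u : H1 (tube D)) :
    twistDeriv β u =ᵐ[volume.restrict (tube D : Set (Euc 3))]
      tubeMap hC α (gradMap (tube D) u) 2 := by
  filter_upwards [coeFn_tubeMap_two hC α (gradMap (tube D) u)] with x hx
  rw [hx, twistDeriv, hα]
  rfl

include hC in
theorem mem_formDomain_iff (hα : ∀ z, deriv β z = α) (u : H1 (tube D)) :
    u ∈ formDomain D γ β ↔ u ∈ H10 (tube D) (tubeDirichlet γ) :=
  ⟨fun h => h.1, fun h => ⟨h, (memLp_congr_ae (twistDeriv_ae_eq hC hα u)).2 (Lp.memLp _)⟩⟩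

theorem twistForm_eq (hα : ∀ z, deriv β z = α) (v u : H1 (tube D)) :
    twistForm β v u
      = inner ℂ (tubeMap hC α (gradMap (tube D) v)) (tubeMap hC α (gradMap (tube D) u)) := by
  rw [inner_tubeMap, L2.inner_def (tubeMap hC α (gradMap (tube D) v) 2)]
  refine congrArg₂ _ rfl (integral_congr_ae ?_)
  filter_upwards [twistDeriv_ae_eq hC hα v, twistDeriv_ae_eq hC hα u] with x h1 h2
  rw [h1, h2]

/-- Brings the operator into the form required by `form_operator_spectrum`. The finiteness condition
in the form domain is automatic here, since the coordinates are bounded on `D` and `deriv β` is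
constant. -/
theorem mem_graph_twistOp_iff (hγ : γ ⊆ frontier (D : Set (Euc 2))) (hβ : ContDiff ℝ 1 β)
    (hα : ∀ z, deriv β z = α) (p : L2 (tube D) × L2 (tube D)) :
    p ∈ (twistOp D γ β).graph ↔ ∃ v : gradGraph (tube D) (tubeDirichlet γ), v.1.1 = p.1 ∧
      ∀ u : gradGraph (tube D) (tubeDirichlet γ),
        inner ℂ (tubeMap hC α u.1) (tubeMap hC α v.1) = inner ℂ u.1.1 p.2 := by
  rw [twistOp, Submodule.toLinearPMap_graph_eq _ (twistGraph_singleValued hγ hβ)]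
  constructor
  · rintro ⟨u, hu, h1, h2⟩
    refine ⟨⟨_, u, hu.1, rfl⟩, h1, ?_⟩
    rintro ⟨_, w, hw, rfl⟩
    rw [← twistForm_eq hC hα]
    exact h2 w ((mem_formDomain_iff hC hα w).2 hw)
  · rintro ⟨⟨_, u, hu, rfl⟩, h1, h2⟩
    refine ⟨u, (mem_formDomain_iff hC hα u).2 hu, h1, fun w hw => ?_⟩
    rw [twistForm_eq hC hα]
    exact h2 ⟨_, w, hw.1, rfl⟩

/-- Closedness of the form: `∂₃u` is recovered as the twisted derivative minus `α∂_φ u`, and the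
latter is bounded by `∂₁u` and `∂₂u` because the cross-section is bounded. -/
theorem norm_le_norm_fst_add_norm_tubeMap (hC0 : 0 ≤ C)
    (U : L2 (tube D) × (Fin 3 → L2 (tube D))) :
    ‖U‖ ≤ (1 + 2 * |α| * C) * (‖U.1‖ + ‖tubeMap hC α U‖) := by
  set S := tubeMap hC α U with hS
  have h : ∀ j, ‖S j‖ ≤ ‖S‖ := fun j => PiLp.norm_apply_le S j
  have hK : 0 ≤ 2 * |α| * C := by positivity
  have hle : ‖U.1‖ + ‖S‖ ≤ (1 + 2 * |α| * C) * (‖U.1‖ + ‖S‖) :=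
    le_mul_of_one_le_left (by positivity) (by linarith)
  refine max_le (le_trans (le_add_of_nonneg_right (norm_nonneg _)) hle) ?_
  refine (pi_norm_le_iff_of_nonneg (by positivity)).2 fun i => ?_
  fin_cases i
  · exact (h 0).trans ((le_add_of_nonneg_left (norm_nonneg _)).trans hle)
  · exact (h 1).trans ((le_add_of_nonneg_left (norm_nonneg _)).trans hle)
  · set a := angL2 0 1 (fun x hx => hC 0 (proj x) hx) (fun x hx => hC 1 (proj x) hx) U.2 with ha
    have e : U.2 2 = S 2 - (α : ℂ) • a := by
      rw [hS, tubeMap_two, add_sub_cancel_right]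
    have h1 : ‖(α : ℂ) • a‖ ≤ |α| * (C * (‖S‖ + ‖S‖)) := by
      rw [norm_smul, Complex.norm_real, Real.norm_eq_abs]
      gcongr
      exact (norm_angL2_le _ _ _).trans
        (mul_le_mul_of_nonneg_left (add_le_add (h 1) (h 0)) hC0)
    change ‖U.2 2‖ ≤ _
    rw [e]
    refine (norm_sub_le _ _).trans ((add_le_add (h 2) h1).trans ?_)
    nlinarith [norm_nonneg U.1, mul_nonneg hK (norm_nonneg U.1)]

/-- The lowest cross-sectional eigenvalue. -/
theorem isLeast_sectionEigenvalue {m : ℝ} (hm0 : 0 ≤ m)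
    (hm : ∀ W ∈ gradGraph D γ, m * ‖W.1‖ ≤ ‖sectionMap hC α 0 W‖)
    (hU : ∃ U ∈ gradGraph D γ, ‖U.1‖ = 1 ∧ ∀ W ∈ gradGraph D γ,
      inner ℂ (sectionMap hC α 0 W) (sectionMap hC α 0 U) = ((m ^ 2 : ℝ) : ℂ) * inner ℂ W.1 U.1) :
    IsLeast {μ : ℝ | IsSectionEigenvalue D γ α μ} (m ^ 2) := by
  constructor
  · obtain ⟨U, h1, h2, h3⟩ := hU
    refine (isSectionEigenvalue_iff hC α _).2 ⟨U, h1, fun h0 => ?_, h3⟩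
    rw [h0, norm_zero] at h2
    exact zero_ne_one h2
  · intro μ hμ
    obtain ⟨V, h1, h2, h3⟩ := (isSectionEigenvalue_iff hC α _).1 hμ
    -- Testing the equation of `V` with `V` itself shows that `μ` is its Rayleigh quotient, which is
    -- at least `m²`.
    have h4 := h3 V h1
    rw [inner_self_eq_norm_sq_to_K, inner_self_eq_norm_sq_to_K] at h4
    have h5 : ‖sectionMap hC α 0 V‖ ^ 2 = μ * ‖V.1‖ ^ 2 := by
      refine Complex.ofReal_injective ?_
      push_cast
      exact h4
    have h6 := pow_le_pow_left₀ (by positivity) (hm V h1) 2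
    rw [h5, mul_pow] at h6
    have : 0 < ‖V.1‖ ^ 2 := by have := norm_pos_iff.2 h2; positivity
    exact le_of_mul_le_mul_right h6 this

/-- The spectrum of the operator of a tube twisted at a constant rate. -/
theorem twistOp_spectrum (D : Opens (Euc 2)) (γ : Set (Euc 2)) (hD : IsCrossSection D)
    (hγ : IsFiniteUnionOfArcs D γ) (α : ℝ) (β : ℝ → ℝ) (hβ : ContDiff ℝ 1 β)
    (hα : ∀ z, deriv β z = α) :
    IsSelfAdjoint (twistOp D γ β) ∧
    (∀ u : (twistOp D γ β).domain, 0 ≤ (inner ℂ (u : L2 (tube D)) (twistOp D γ β u)).re) ∧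
    ∃ lam : ℝ, IsLeast {μ : ℝ | IsSectionEigenvalue D γ α μ} lam ∧
      opSpectrum (twistOp D γ β) = (fun t : ℝ => (t : ℂ)) '' Set.Ici lam := by
  have hfr := hγ.subset_frontier
  have hdis : Disjoint (D : Set (Euc 2)) γ := disjoint_of_subset_frontier hfr
  have hdis3 : Disjoint (tube D : Set (Euc 3)) (tubeDirichlet γ) := hdis.preimage proj
  obtain ⟨C, hC⟩ := exists_coord_bound hD.isBounded
  have hC0 : 0 ≤ C := by
    obtain ⟨x, hx⟩ := hD.isConnected.nonempty
    exact (norm_nonneg _).trans (hC 0 x hx)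
  obtain ⟨m, hmc, hm0, ⟨c, hc, hcm⟩, hle, hgs⟩ := exists_section_ground_states hC hD hdis α
  obtain ⟨hsa, hpos, hlow, hweyl⟩ := form_operator_spectrum
    (ContinuousLinearMap.fst ℂ (L2 (tube D)) (Fin 3 → L2 (tube D))
      ∘L (gradGraph (tube D) (tubeDirichlet γ)).subtypeL)
    (tubeMap hC α ∘L (gradGraph (tube D) (tubeDirichlet γ)).subtypeL)
    (fun v => norm_le_norm_fst_add_norm_tubeMap hC hC0 v.1)
    (denseRange_gradGraph_fst hdis3) (mem_graph_twistOp_iff hC hfr hβ hα)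
  refine ⟨hsa, hpos, m 0 ^ 2, isLeast_sectionEigenvalue hC (hm0 0) (hle 0) (hgs 0), ?_⟩
  refine Set.Subset.antisymm (hlow _ (sq_nonneg _) fun u => ?_) ?_
  · have := le_norm_tubeMap hC (hm0 0) (hle 0) u.2
    have h2 := pow_le_pow_left₀ (mul_nonneg (hm0 0) (norm_nonneg _)) this 2
    rwa [mul_pow] at h2
  · rintro _ ⟨μ, hμ, rfl⟩
    have hμ : m 0 ^ 2 ≤ μ := hμ
    have hμ0 : 0 ≤ μ := (sq_nonneg _).trans hμ
    -- Intermediate value theorem between `k = 0`, where `m 0 ≤ √μ`, and `k = √μ / c`, where linear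
    -- growth gives `m k ≥ √μ`.
    obtain ⟨k, hk⟩ : ∃ k, m k = √μ := by
      have h1 : m 0 ≤ √μ := Real.le_sqrt_of_sq_le hμ
      have h2 : √μ ≤ m (√μ / c) := by
        refine le_trans (le_of_eq ?_) (hcm _)
        rw [abs_of_nonneg (div_nonneg (Real.sqrt_nonneg _) hc.le)]
        field_simp
      exact mem_range_of_exists_le_of_exists_ge hmc ⟨0, h1⟩ ⟨_, h2⟩
    obtain ⟨U, hU, hU1, hUe⟩ := hgs k
    rw [hk, Real.sq_sqrt hμ0] at hUe
    refine hweyl μ fun ε hε => ?_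
    obtain ⟨v, hv, hv1, hvw⟩ := exists_approximate_eigenfunction hC hU hU1 hUe hε
    exact ⟨⟨v, hv⟩, hv1, fun w => hvw w.1 w.2⟩

end Operator

end TwistedTube

end

theorem mainTheorem3 (D : TopologicalSpace.Opens (TwistedTube.Euc 2))
    (γD : Set (TwistedTube.Euc 2)) (hD : TwistedTube.IsCrossSection D)
    (hγ : TwistedTube.IsFiniteUnionOfArcs D γD)
    (α : ℝ) (β₀ : ℝ → ℝ) (hβ : ContDiff ℝ 1 β₀) (hα : ∀ z, deriv β₀ z = α) :
    IsSelfAdjoint (TwistedTube.twistOp D γD β₀) ∧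
    (∀ u : (TwistedTube.twistOp D γD β₀).domain,
      0 ≤ (inner ℂ (u : TwistedTube.L2 (TwistedTube.tube D))
        (TwistedTube.twistOp D γD β₀ u)).re) ∧
    ∃ lam : ℝ, IsLeast {μ : ℝ | TwistedTube.IsSectionEigenvalue D γD α μ} lam ∧
      TwistedTube.opSpectrum (TwistedTube.twistOp D γD β₀)
        = (fun t : ℝ => (t : ℂ)) '' Set.Ici lam :=
  TwistedTube.twistOp_spectrum D γD hD hγ α β₀ hβ hα
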